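/- Let $T>0$, $Q_T=(0,T)\times(0,1)$, $x_0\in(0,1)$, and let $a:[0,1]\to\mathbb R$ satisfy $a(x_0)=0$ and $a>0$ on $[0,1]\setminus\{x_0\}$. Assume that one of the following holds. (WD) $a\in W^{1,1}(0,1)$ and $(x-x_0)a'\le Ka$ a.e. in $[0,1]$ for some $K\in(0,1)$. (SD) $a\in W^{1,\infty}(0,1)$ and $(x-x_0)a'\le Ka$ a.e. in $[0,1]$ for some $K\in[1,2)$. If moreover $K>\frac43$, there is $\vartheta\in(0,K]$ such that $x\mapsto a(x)/|x-x_0|^{\vartheta}$ is nonincreasing on $[0,x_0)$ and nondecreasing on $(x_0,1]$; and if $K>\frac32$, this map is also bounded below by a positive constant and there is $\Sigma>0$ with $|a'(x)|\le\Sigma|x-x_0|^{2\vartheta-3}$ for a.e. $x\in[0,1]$. In case (WD), let $\mathcal H^1_a$ be the space of all $u$ absolutely continuous on $[0,1]$ with $\sqrt a\,u'\in L^2(0,1)$ and $u(0)=u(1)=0$; in case (SD), let $\mathcal H^1_a$ be the space of all $u\in L^2(0,1)$ that are locally absolutely continuous on $[0,x_0)\cup(x_0,1]$ with $\sqrt a\,u'\in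 L^2(0,1)$ and $u(0)=u(1)=0$. In both cases let $\mathcal H^2_a=\{u\in\mathcal H^1_a: au'\in H^1(0,1)\}$, with the norms $\|u\|_{\mathcal H^1_a}^2=\|u\|_{L^2}^2+\|\sqrt a\,u'\|_{L^2}^2$ and $\|u\|_{\mathcal H^2_a}^2=\|u\|_{\mathcal H^1_a}^2+\|(au')'\|_{L^2}^2$. Let $c_1>0$ and $c_2>\max\left\{\frac{(1-x_0)^2}{a(1)(2-K)},\frac{x_0^2}{a(0)(2-K)}\right\}$, and set $$\Theta(t)=\frac1{[t(T-t)]^4},\qquad \psi(x)=c_1\left[\int_{x_0}^x\frac{y-x_0}{a(y)}\,dy-c_2\right],\qquad \varphi(t,x)=\Theta(t)\psi(x).$$ Then there exist constants $C>0$ and $s_0>0$ such that, for every $h\in L^2(Q_T)$, every solution $v\in L^2(0,T;\mathcal H^2_a)\cap H^1(0,T;\mathcal H^1_a)$ of $$v_t+(av_x)_x=h\ \text{ in }Q_T,\qquad v(t,0)=v(t,1)=0\ \text{ for }t\in(0,T),$$ and every $s\ge s_0$, all the integrals below are finite and $$\int_{Q_T}\left(s\Theta a\,v_x^2+s^3\Theta^3\frac{(x-x_0)^2}{a}v^2\right)e^{2s\varphi}\,dx\,dt\le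 C\left(\int_{Q_T}h^2e^{2s\varphi}\,dx\,dt+sc_1\int_0^T\left[a\,\Theta\,e^{2s\varphi}(x-x_0)v_x^2\right]_{x=0}^{x=1}dt\right).$$ -/

import Mathlib

open MeasureTheory Set Filter Topology
open scoped ENNReal ContDiff

namespace DegenerateParabolic

noncomputable section

/-! ### One-dimensional Sobolev functions on `(0,1)` -/

/-- Lebesgue measure on `(0,1)`. -/
abbrev μI : Measure ℝ := volume.restrict (Ioo 0 1)

/-- The space `L²(0,1)`. -/
abbrev L2I : Type := Lp ℝ 2 μI

/-- The space derivative of a function on `[0,1]`; at the end points it is one-sided. -/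
def dx (u : ℝ → ℝ) (x : ℝ) : ℝ := derivWithin u (Icc 0 1) x

/-- `f` is the continuous representative of an element of `W^{1,p}(0,1)`: it is absolutely continuous
on `[0,1]` and its derivative, which exists almost everywhere, belongs to `L^p(0,1)`. -/
def MemW1 (p : ℝ≥0∞) (f : ℝ → ℝ) : Prop :=
  AbsolutelyContinuousOnInterval f 0 1 ∧ MemLp (dx f) p μI

/-! ### The degenerate coefficient -/

/-- The weakly degenerate case. -/
structure WeaklyDegenerate (a : ℝ → ℝ) (x₀ K : ℝ) : Prop where
  x₀_mem : x₀ ∈ Ioo (0 : ℝ) 1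
  zero : a x₀ = 0
  pos : ∀ x ∈ Icc (0 : ℝ) 1, x ≠ x₀ → 0 < a x
  memW1 : MemW1 1 a
  K_mem : K ∈ Ioo (0 : ℝ) 1
  growth : ∀ᵐ x ∂μI, (x - x₀) * dx a x ≤ K * a x

/-- The strongly degenerate case. -/
structure StronglyDegenerate (a : ℝ → ℝ) (x₀ K : ℝ) : Prop where
  x₀_mem : x₀ ∈ Ioo (0 : ℝ) 1
  zero : a x₀ = 0
  pos : ∀ x ∈ Icc (0 : ℝ) 1, x ≠ x₀ → 0 < a x
  memW1 : MemW1 ∞ a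
  K_mem : K ∈ Ico (1 : ℝ) 2
  growth : ∀ᵐ x ∂μI, (x - x₀) * dx a x ≤ K * a x

/-- The additional requirements on a strongly degenerate coefficient with `K > 4/3`. -/
def ExtraCondition (a : ℝ → ℝ) (x₀ K : ℝ) : Prop :=
  ∃ ϑ ∈ Ioc 0 K,
    AntitoneOn (fun x => a x / |x - x₀| ^ ϑ) (Ico 0 x₀) ∧
    MonotoneOn (fun x => a x / |x - x₀| ^ ϑ) (Ioc x₀ 1) ∧
    (3 / 2 < K →
      (∃ m > 0, ∀ x ∈ Icc (0 : ℝ) 1, x ≠ x₀ → m ≤ a x / |x - x₀| ^ ϑ) ∧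
      ∃ S > 0, ∀ᵐ x ∂μI, |dx a x| ≤ S * |x - x₀| ^ (2 * ϑ - 3))

/-- The standing hypothesis on the coefficient. -/
def CoefficientHypothesis (a : ℝ → ℝ) (x₀ K : ℝ) : Prop :=
  WeaklyDegenerate a x₀ K ∨
    (StronglyDegenerate a x₀ K ∧ (4 / 3 < K → ExtraCondition a x₀ K))

/-! ### The weighted spaces -/

/-- The absolute continuity required of functions in the weighted spaces: on `[0,1]` in the weakly
degenerate case `K < 1`, locally on `[0,x₀) ∪ (x₀,1]` in the strongly degenerate case `1 ≤ K`. -/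
def WeightedAC (x₀ K : ℝ) (u : ℝ → ℝ) : Prop :=
  (K < 1 → AbsolutelyContinuousOnInterval u 0 1) ∧
  (1 ≤ K → (∀ c ∈ Ico 0 x₀, AbsolutelyContinuousOnInterval u 0 c) ∧
    ∀ c ∈ Ioc x₀ 1, AbsolutelyContinuousOnInterval u c 1)

/-- `u ∈ 𝓗¹_a(0,1)`. -/
structure MemH1a (a : ℝ → ℝ) (x₀ K : ℝ) (u : ℝ → ℝ) : Prop where
  memL2 : MemLp u 2 μI
  ac : WeightedAC x₀ K u
  weighted : MemLp (fun x => √(a x) * dx u x) 2 μI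
  left : u 0 = 0
  right : u 1 = 0

/-- The flux `a u'`. -/
def flux (a u : ℝ → ℝ) (x : ℝ) : ℝ := a x * dx u x

/-- `u ∈ 𝓗²_a(0,1)`, that is, `u ∈ 𝓗¹_a(0,1)` and `a u' ∈ H¹(0,1)`. -/
def MemH2a (a : ℝ → ℝ) (x₀ K : ℝ) (u : ℝ → ℝ) : Prop :=
  MemH1a a x₀ K u ∧ ∃ g, MemW1 2 g ∧ g =ᵐ[μI] flux a u

theorem WeightedAC.ae_differentiable {x₀ K : ℝ} {u : ℝ → ℝ} (h : WeightedAC x₀ K u) :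
    ∀ᵐ x ∂μI, DifferentiableWithinAt ℝ u (Icc 0 1) x := by
  rw [ae_restrict_iff' measurableSet_Ioo]
  rcases lt_or_ge K 1 with hK | hK
  · filter_upwards [(h.1 hK).ae_differentiableAt] with x hx hx01
    exact (hx (by rw [uIcc_of_le zero_le_one]; exact Ioo_subset_Icc_self hx01)).differentiableWithinAt
  · obtain ⟨h1, h2⟩ := h.2 hK
    have e1 : ∀ᵐ x : ℝ, ∀ q : ℚ, (q : ℝ) ∈ Ico 0 x₀ → x ∈ uIcc 0 (q : ℝ) →
        DifferentiableAt ℝ u x := by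
      rw [ae_all_iff]
      intro q
      by_cases hq : (q : ℝ) ∈ Ico 0 x₀
      · filter_upwards [(h1 q hq).ae_differentiableAt] with x hx _ using hx
      · exact Eventually.of_forall fun x hx => absurd hx hq
    have e2 : ∀ᵐ x : ℝ, ∀ q : ℚ, (q : ℝ) ∈ Ioc x₀ 1 → x ∈ uIcc (q : ℝ) 1 →
        DifferentiableAt ℝ u x := by
      rw [ae_all_iff]
      intro q
      by_cases hq : (q : ℝ) ∈ Ioc x₀ 1
      · filter_upwards [(h2 q hq).ae_differentiableAt] with x hx _ using hx
      · exact Eventually.of_forall fun x hx => absurd hx hq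
    have e3 : ∀ᵐ x : ℝ, x ≠ x₀ := by
      simp [ae_iff]
    filter_upwards [e1, e2, e3] with x hx1 hx2 hx3 hx
    rcases lt_or_gt_of_ne hx3 with hlt | hgt
    · obtain ⟨q, hq1, hq2⟩ := exists_rat_btwn hlt
      have : (0 : ℝ) ≤ q := by linarith [hx.1]
      exact (hx1 q ⟨this, hq2⟩
        (by rw [uIcc_of_le this]; exact ⟨hx.1.le, hq1.le⟩)).differentiableWithinAt
    · obtain ⟨q, hq1, hq2⟩ := exists_rat_btwn hgt
      have : (q : ℝ) ≤ 1 := by linarith [hx.2]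
      exact (hx2 q ⟨hq1, this⟩
        (by rw [uIcc_of_le this]; exact ⟨hq2.le, hx.2.le⟩)).differentiableWithinAt

theorem MemW1.ae_differentiable {p : ℝ≥0∞} {f : ℝ → ℝ} (h : MemW1 p f) :
    ∀ᵐ x ∂μI, DifferentiableWithinAt ℝ f (Icc 0 1) x := by
  have : WeightedAC 0 0 f := ⟨fun _ => h.1, fun h0 => absurd h0 (by norm_num)⟩
  exact this.ae_differentiable

theorem dx_add_ae {u w : ℝ → ℝ} (hu : ∀ᵐ x ∂μI, DifferentiableWithinAt ℝ u (Icc 0 1) x)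
    (hw : ∀ᵐ x ∂μI, DifferentiableWithinAt ℝ w (Icc 0 1) x) :
    dx (u + w) =ᵐ[μI] dx u + dx w := by
  filter_upwards [hu, hw] with x h1 h2
  exact derivWithin_add h1 h2

theorem dx_smul_ae (c : ℝ) {u : ℝ → ℝ}
    (hu : ∀ᵐ x ∂μI, DifferentiableWithinAt ℝ u (Icc 0 1) x) :
    dx (c • u) =ᵐ[μI] c • dx u := by
  filter_upwards [hu] with x h1
  exact derivWithin_const_smul c h1

theorem MemW1.add {p : ℝ≥0∞} {f g : ℝ → ℝ} (hf : MemW1 p f) (hg : MemW1 p g) :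
    MemW1 p (f + g) :=
  ⟨hf.1.add hg.1,
    (hf.2.add hg.2).ae_eq (dx_add_ae hf.ae_differentiable hg.ae_differentiable).symm⟩

theorem MemW1.smul {p : ℝ≥0∞} {f : ℝ → ℝ} (c : ℝ) (hf : MemW1 p f) : MemW1 p (c • f) :=
  ⟨hf.1.const_smul c, (hf.2.const_smul c).ae_eq (dx_smul_ae c hf.ae_differentiable).symm⟩

theorem WeightedAC.add {x₀ K : ℝ} {u w : ℝ → ℝ} (hu : WeightedAC x₀ K u)
    (hw : WeightedAC x₀ K w) : WeightedAC x₀ K (u + w) :=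
  ⟨fun h => (hu.1 h).add (hw.1 h), fun h =>
    ⟨fun c hc => ((hu.2 h).1 c hc).add ((hw.2 h).1 c hc),
      fun c hc => ((hu.2 h).2 c hc).add ((hw.2 h).2 c hc)⟩⟩

theorem WeightedAC.smul {x₀ K : ℝ} {u : ℝ → ℝ} (r : ℝ) (hu : WeightedAC x₀ K u) :
    WeightedAC x₀ K (r • u) :=
  ⟨fun h => (hu.1 h).const_smul r, fun h =>
    ⟨fun c hc => ((hu.2 h).1 c hc).const_smul r, fun c hc => ((hu.2 h).2 c hc).const_smul r⟩⟩

theorem mul_dx_add_ae (b : ℝ → ℝ) {x₀ K : ℝ} {u w : ℝ → ℝ} (hu : WeightedAC x₀ K u)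
    (hw : WeightedAC x₀ K w) :
    (fun x => b x * dx (u + w) x) =ᵐ[μI] (fun x => b x * dx u x) + fun x => b x * dx w x := by
  filter_upwards [dx_add_ae hu.ae_differentiable hw.ae_differentiable] with x h
  simp only [h, Pi.add_apply]; ring

theorem mul_dx_smul_ae (b : ℝ → ℝ) {x₀ K : ℝ} (r : ℝ) {u : ℝ → ℝ} (hu : WeightedAC x₀ K u) :
    (fun x => b x * dx (r • u) x) =ᵐ[μI] r • fun x => b x * dx u x := by
  filter_upwards [dx_smul_ae r hu.ae_differentiable] with x h
  simp only [h, Pi.smul_apply, smul_eq_mul]; ring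

theorem MemH1a.add {a : ℝ → ℝ} {x₀ K : ℝ} {u w : ℝ → ℝ} (hu : MemH1a a x₀ K u)
    (hw : MemH1a a x₀ K w) : MemH1a a x₀ K (u + w) where
  memL2 := hu.memL2.add hw.memL2
  ac := hu.ac.add hw.ac
  weighted := (hu.weighted.add hw.weighted).ae_eq (mul_dx_add_ae _ hu.ac hw.ac).symm
  left := by simp [hu.left, hw.left]
  right := by simp [hu.right, hw.right]

theorem MemH1a.smul {a : ℝ → ℝ} {x₀ K : ℝ} {u : ℝ → ℝ} (r : ℝ) (hu : MemH1a a x₀ K u) :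
    MemH1a a x₀ K (r • u) where
  memL2 := hu.memL2.const_smul r
  ac := hu.ac.smul r
  weighted := (hu.weighted.const_smul r).ae_eq (mul_dx_smul_ae _ r hu.ac).symm
  left := by simp [hu.left]
  right := by simp [hu.right]

/-- The element `p` of `L²(0,1) × L²(0,1)` is the pair `(u, √a u')` of a function
`u ∈ 𝓗¹_a(0,1)`. -/
structure RepH1a (a : ℝ → ℝ) (x₀ K : ℝ) (u : ℝ → ℝ) (p : WithLp 2 (L2I × L2I)) : Prop where
  mem : MemH1a a x₀ K u
  fst : p.fst =ᵐ[μI] u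
  snd : p.snd =ᵐ[μI] fun x => √(a x) * dx u x

theorem RepH1a.add {a : ℝ → ℝ} {x₀ K : ℝ} {u w : ℝ → ℝ} {p q : WithLp 2 (L2I × L2I)}
    (hu : RepH1a a x₀ K u p) (hw : RepH1a a x₀ K w q) : RepH1a a x₀ K (u + w) (p + q) where
  mem := hu.mem.add hw.mem
  fst := (Lp.coeFn_add p.fst q.fst).trans (hu.fst.add hw.fst)
  snd := (Lp.coeFn_add p.snd q.snd).trans
    ((hu.snd.add hw.snd).trans (mul_dx_add_ae _ hu.mem.ac hw.mem.ac).symm)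

theorem RepH1a.smul {a : ℝ → ℝ} {x₀ K : ℝ} (r : ℝ) {u : ℝ → ℝ} {p : WithLp 2 (L2I × L2I)}
    (hu : RepH1a a x₀ K u p) : RepH1a a x₀ K (r • u) (r • p) where
  mem := hu.mem.smul r
  fst := (Lp.coeFn_smul r p.fst).trans (hu.fst.const_smul r)
  snd := (Lp.coeFn_smul r p.snd).trans
    ((hu.snd.const_smul r).trans (mul_dx_smul_ae _ r hu.mem.ac).symm)

theorem MemH1a.zero (a : ℝ → ℝ) (x₀ K : ℝ) : MemH1a a x₀ K 0 := by
  have hac : ∀ b c : ℝ, AbsolutelyContinuousOnInterval (0 : ℝ → ℝ) b c := fun b c =>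
    ((LipschitzWith.const (0 : ℝ)).lipschitzOnWith (s := uIcc b c)).absolutelyContinuousOnInterval
  have hd : dx 0 = 0 := by ext x; simp [dx]
  exact ⟨MemLp.zero, ⟨fun _ => hac _ _, fun _ => ⟨fun _ _ => hac _ _, fun _ _ => hac _ _⟩⟩,
    by simp [hd], rfl, rfl⟩

theorem RepH1a.zero (a : ℝ → ℝ) (x₀ K : ℝ) : RepH1a a x₀ K 0 0 where
  mem := MemH1a.zero a x₀ K
  fst := Lp.coeFn_zero ℝ 2 μI
  snd := by
    have hd : dx 0 = 0 := by ext x; simp [dx]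
    filter_upwards [Lp.coeFn_zero ℝ 2 μI] with x hx
    simpa [hd] using hx

/-- The Hilbert space `𝓗¹_a(0,1)`. A function `u` is identified with the pair `(u, √a u')`, so that
the norm is the one given by `‖u‖² + ‖√a u'‖²` with norms in `L²(0,1)`. -/
def H1a (a : ℝ → ℝ) (x₀ K : ℝ) : Submodule ℝ (WithLp 2 (L2I × L2I)) where
  carrier := {p | ∃ u, RepH1a a x₀ K u p}
  add_mem' := by
    rintro p q ⟨u, hu⟩ ⟨w, hw⟩
    exact ⟨u + w, hu.add hw⟩
  zero_mem' := ⟨0, RepH1a.zero a x₀ K⟩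
  smul_mem' := by
    rintro r p ⟨u, hu⟩
    exact ⟨r • u, hu.smul r⟩

/-- The element `P` of `𝓗¹_a(0,1) × L²(0,1)` is the pair `(u, (a u')')` of a function
`u ∈ 𝓗²_a(0,1)`; here `g` is the continuous representative of `a u'`. -/
def RepH2a (a : ℝ → ℝ) (x₀ K : ℝ) (u : ℝ → ℝ) (P : WithLp 2 (H1a a x₀ K × L2I)) : Prop :=
  RepH1a a x₀ K u P.fst ∧ ∃ g, MemW1 2 g ∧ g =ᵐ[μI] flux a u ∧ P.snd =ᵐ[μI] dx g

/-- The Hilbert space `𝓗²_a(0,1)`. A function `u` is identified with the pair `(u, (a u')')`, so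
that the norm is the one given by `‖u‖² + ‖(a u')'‖²`, with norms in `𝓗¹_a(0,1)` and `L²(0,1)`. -/
def H2a (a : ℝ → ℝ) (x₀ K : ℝ) : Submodule ℝ (WithLp 2 (H1a a x₀ K × L2I)) where
  carrier := {P | ∃ u, RepH2a a x₀ K u P}
  add_mem' := by
    rintro P Q ⟨u, hu, g, hg, hgu, hP⟩ ⟨w, hw, k, hk, hkw, hQ⟩
    exact ⟨u + w, hu.add hw, g + k, hg.add hk,
      (hgu.add hkw).trans (mul_dx_add_ae a hu.mem.ac hw.mem.ac).symm,
      (Lp.coeFn_add P.snd Q.snd).trans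
        ((hP.add hQ).trans (dx_add_ae hg.ae_differentiable hk.ae_differentiable).symm)⟩
  zero_mem' := by
    have hd : dx 0 = 0 := by ext x; simp [dx]
    have hac : AbsolutelyContinuousOnInterval (0 : ℝ → ℝ) 0 1 :=
      ((LipschitzWith.const (0 : ℝ)).lipschitzOnWith (s := uIcc 0 1)).absolutelyContinuousOnInterval
    refine ⟨0, RepH1a.zero a x₀ K, 0, ⟨hac, by simp [hd]⟩, ?_, ?_⟩
    · exact Eventually.of_forall fun x => by simp [flux, hd]
    · rw [hd]; exact Lp.coeFn_zero ℝ 2 μI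
  smul_mem' := by
    rintro r P ⟨u, hu, g, hg, hgu, hP⟩
    exact ⟨r • u, hu.smul r, r • g, hg.smul r,
      (hgu.const_smul r).trans (mul_dx_smul_ae a r hu.mem.ac).symm,
      (Lp.coeFn_smul r P.snd).trans
        ((hP.const_smul r).trans (dx_smul_ae r hg.ae_differentiable).symm)⟩

/-! ### Time-dependent functions

A function on `(0,T) × (0,1)` is written `v : ℝ → ℝ → ℝ`, with `v t x` its value at `(t, x)`; for
almost every `t` the function `v t` is the representative of an element of `𝓗¹_a(0,1)` that is
absolutely continuous in the sense of that space. -/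

/-- Lebesgue measure on the time interval `(0,T)`. -/
abbrev μT (T : ℝ) : Measure ℝ := volume.restrict (Ioo 0 T)

/-- The cylinder `Q_T = (0,T) × (0,1)`. -/
def QT (T : ℝ) : Set (ℝ × ℝ) := Ioo 0 T ×ˢ Ioo 0 1

/-- `v ∈ L²(0,T; 𝓗²_a(0,1))`, as a Bochner space. -/
def MemL2H2 (a : ℝ → ℝ) (x₀ K T : ℝ) (v : ℝ → ℝ → ℝ) : Prop :=
  ∃ V : ℝ → H2a a x₀ K, MemLp V 2 (μT T) ∧ ∀ᵐ t ∂μT T, RepH2a a x₀ K (v t) (V t)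

/-- `v ∈ H¹(0,T; 𝓗¹_a(0,1))` with weak time derivative `vt`: both `v` and `vt` belong to the
Bochner space `L²(0,T; 𝓗¹_a(0,1))`, and `∫ η' v dt = - ∫ η vt dt` for all test functions `η` on
`(0,T)`. The vector-valued integrals are taken in the complete space `L²(0,1) × L²(0,1)`, of which
`𝓗¹_a(0,1)` is a subspace with the induced norm. -/
def HasTimeDerivH1 (a : ℝ → ℝ) (x₀ K T : ℝ) (v vt : ℝ → ℝ → ℝ) : Prop :=
  ∃ V W : ℝ → H1a a x₀ K,
    MemLp V 2 (μT T) ∧ (∀ᵐ t ∂μT T, RepH1a a x₀ K (v t) (V t)) ∧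
    MemLp W 2 (μT T) ∧ (∀ᵐ t ∂μT T, RepH1a a x₀ K (vt t) (W t)) ∧
    ∀ η : ℝ → ℝ, ContDiff ℝ ∞ η → HasCompactSupport η → tsupport η ⊆ Ioo 0 T →
      ∫ t in Ioo 0 T, deriv η t • (V t : WithLp 2 (L2I × L2I)) =
        -∫ t in Ioo 0 T, η t • (W t : WithLp 2 (L2I × L2I))

/-- `v` belongs to `L²(0,T; 𝓗²_a(0,1)) ∩ H¹(0,T; 𝓗¹_a(0,1))` and solves `v_t + (a v_x)_x = h` in
`Q_T` with `v(t,0) = v(t,1) = 0`, where `h ∈ L²(Q_T)`. For almost every `t` the function `a v_x(t,·)`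
coincides on `[0,1] \ {x₀}` with its continuous representative, so that `(a v_x)_x` is its derivative
almost everywhere. -/
structure IsSolution (a : ℝ → ℝ) (x₀ K T : ℝ) (h v : ℝ → ℝ → ℝ) : Prop where
  source : MemLp (fun p : ℝ × ℝ => h p.1 p.2) 2 (volume.restrict (QT T))
  memL2H2 : MemL2H2 a x₀ K T v
  equation : ∃ vt : ℝ → ℝ → ℝ, HasTimeDerivH1 a x₀ K T v vt ∧
    ∀ᵐ t ∂μT T, ∀ᵐ x ∂μI, vt t x + dx (flux a (v t)) x = h t x
  boundary : ∀ᵐ t ∂μT T, v t 0 = 0 ∧ v t 1 = 0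

/-! ### The weight -/

/-- `Θ(t) = 1 / [t (T - t)]⁴`. -/
def Theta (T t : ℝ) : ℝ := 1 / (t * (T - t)) ^ 4

/-- `ψ(x) = c₁ (∫_{x₀}^x (y - x₀) / a(y) dy - c₂)`. -/
def psi (a : ℝ → ℝ) (x₀ c₁ c₂ x : ℝ) : ℝ :=
  c₁ * ((∫ y in x₀..x, (y - x₀) / a y) - c₂)

/-- `φ(t,x) = Θ(t) ψ(x)`. -/
def phi (a : ℝ → ℝ) (x₀ c₁ c₂ T t x : ℝ) : ℝ := Theta T t * psi a x₀ c₁ c₂ x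

/-- The integrand `(s Θ a v_x² + s³ Θ³ (x - x₀)² / a v²) e^{2sφ}`. -/
def energyDensity (a : ℝ → ℝ) (x₀ c₁ c₂ T s : ℝ) (v : ℝ → ℝ → ℝ) (t x : ℝ) : ℝ :=
  (s * Theta T t * a x * (dx (v t) x) ^ 2 +
      s ^ 3 * Theta T t ^ 3 * ((x - x₀) ^ 2 / a x) * (v t x) ^ 2) *
    Real.exp (2 * s * phi a x₀ c₁ c₂ T t x)

/-- The integrand `h² e^{2sφ}`. -/
def sourceDensity (a : ℝ → ℝ) (x₀ c₁ c₂ T s : ℝ) (h : ℝ → ℝ → ℝ) (t x : ℝ) : ℝ :=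
  (h t x) ^ 2 * Real.exp (2 * s * phi a x₀ c₁ c₂ T t x)

/-- The boundary integrand `a Θ e^{2sφ} (x - x₀) v_x²`. -/
def boundaryDensity (a : ℝ → ℝ) (x₀ c₁ c₂ T s : ℝ) (v : ℝ → ℝ → ℝ) (t x : ℝ) : ℝ :=
  a x * Theta T t * Real.exp (2 * s * phi a x₀ c₁ c₂ T t x) * (x - x₀) * (dx (v t) x) ^ 2

end

end DegenerateParabolic

open DegenerateParabolic

/-! Conjugate by the weight. Put w = e^{sφ}v, κ = c₁sΘ, b = (x-x₀)²/a. Since sφ_x = κ(x-x₀)/a, one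
has e^{sφ}h = A + B with A = (a w_x)_x + (κ²b - sφ_t)w, the symmetric part, and B = w_t -
2κ(x-x₀)w_x - κw, the antisymmetric one. As AB ≤ (A+B)²/2, it suffices to bound the integral of AB
from below.

Space, at a fixed time (`IsAdmissible.le_integral_conjugated`). The growth condition on a amounts to
a((x-x₀)/a)' ≥ 1-K and (x-x₀)b' ≥ (2-K)b. Integration by parts then yields κ(2-K)∫a w_x² and
κ³(2-K)∫b w², up to boundary terms at 0 and 1, a term in sφ_t, and a time derivative. The degeneracy
point is crossed in two ways. Primitives such as (x-x₀)/a·(a w_x)² are nonpositive to the left of x₀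
and nonnegative to its right, so their values near x₀ can be dropped from an inequality
(`HasPuncturedACDeriv.integral_le`). Where an equality is needed, the one-sided limits at x₀ exist,
and they vanish because 1/|x-x₀| is not integrable (`eq_zero_of_tendsto_of_le_abs_sub_mul`).

Lower order terms. They carry Θ' or Θ'', both O(Θ²). The term ∫Θ²w² is controlled without any Hardy
inequality: integrating ((x-x₀)w²)' and completing a square gives ∫w² ≤ r∫a w_x² + r⁻¹∫b w² for
every r > 0 (`IsAdmissible.integral_sq_le`), and r of order 1/Θ produces exactly Θ∫a w_x² and Θ³∫b
w², to be absorbed for large s (`absorb_lower_order`).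

Time. What remains is the integral over Q_T of the time derivative of a quadratic form in v and √a
v_x. For almost every x both functions are primitives in t of square integrable functions, so the
product rule holds along lines of constant x. The choice of c₂ makes ψ ≤ -ε < 0, so e^{2sφ} beats
every power of Θ and nothing is left at t = 0, T (`IsDegenerate.integral_timeDensity`). Fubini's
theorem joins this with the inequality on time slices; it requires jointly measurable
representatives of the Bochner functions, which are built by differentiating primitives in x. -/

namespace DegenerateParabolic

/-! ### Absolutely continuous functions with a prescribed derivative -/

theorem _root_.AbsolutelyContinuousOnInterval.comp_lipschitzOnWith {f φ : ℝ → ℝ} {c d : ℝ}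
    {s : Set ℝ} {L : NNReal} (hf : AbsolutelyContinuousOnInterval f c d)
    (hφ : LipschitzOnWith L φ s) (hs : MapsTo f (uIcc c d) s) :
    AbsolutelyContinuousOnInterval (fun x => φ (f x)) c d := by
  rw [absolutelyContinuousOnInterval_iff] at hf ⊢
  intro ε hε
  obtain ⟨δ, hδ, h⟩ := hf (ε / (L + 1)) (by positivity)
  refine ⟨δ, hδ, fun E hE hEδ => ?_⟩
  have h1 := h E hE hEδ
  have hE' : ∀ i ∈ Finset.range E.1, (E.2 i).1 ∈ uIcc c d ∧ (E.2 i).2 ∈ uIcc c d := hE.1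
  calc ∑ i ∈ Finset.range E.1, dist (φ (f (E.2 i).1)) (φ (f (E.2 i).2))
      ≤ ∑ i ∈ Finset.range E.1, L * dist (f (E.2 i).1) (f (E.2 i).2) :=
        Finset.sum_le_sum fun i hi =>
          hφ.dist_le_mul _ (hs (hE' i hi).1) _ (hs (hE' i hi).2)
    _ = L * ∑ i ∈ Finset.range E.1, dist (f (E.2 i).1) (f (E.2 i).2) := by
        rw [Finset.mul_sum]
    _ ≤ (L + 1) * ∑ i ∈ Finset.range E.1, dist (f (E.2 i).1) (f (E.2 i).2) := by
        gcongr; linarith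
    _ < (L + 1) * (ε / (L + 1)) := by gcongr
    _ = ε := by field_simp

/-- `f` is absolutely continuous on `[c,d]` and its derivative is `f'` almost everywhere. -/
structure HasACDeriv (f f' : ℝ → ℝ) (c d : ℝ) : Prop where
  ac : AbsolutelyContinuousOnInterval f c d
  deriv : ∀ᵐ x, x ∈ Ioo c d → HasDerivAt f (f' x) x

namespace HasACDeriv

variable {f f' g g' : ℝ → ℝ} {c d c' d' : ℝ}

theorem mono (h : HasACDeriv f f' c d) (hc : c ≤ c') (hcd : c' ≤ d') (hd : d' ≤ d) :
    HasACDeriv f f' c' d' where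
  ac := h.ac.mono (by
    rw [uIcc_of_le hcd, uIcc_of_le (hc.trans (hcd.trans hd))]; exact Icc_subset_Icc hc hd)
  deriv := by
    filter_upwards [h.deriv] with x hx hx'
    exact hx (Ioo_subset_Ioo hc hd hx')

theorem ae_deriv (h : HasACDeriv f f' c d) (hcd : c ≤ d) :
    ∀ᵐ x, x ∈ uIoc c d → _root_.deriv f x = f' x := by
  have hd : ∀ᵐ x : ℝ, x ≠ d := by simp [ae_iff]
  filter_upwards [h.deriv, hd] with x hx hxd hx'
  rw [uIoc_of_le hcd] at hx'
  exact (hx ⟨hx'.1, lt_of_le_of_ne hx'.2 hxd⟩).deriv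

theorem intervalIntegrable (h : HasACDeriv f f' c d) (hcd : c ≤ d) :
    IntervalIntegrable f' volume c d := by
  refine h.ac.intervalIntegrable_deriv.congr_ae ?_
  rw [Filter.EventuallyEq, ae_restrict_iff' measurableSet_uIoc]
  exact h.ae_deriv hcd

theorem integral_eq (h : HasACDeriv f f' c d) (hcd : c ≤ d) :
    ∫ x in c..d, f' x = f d - f c := by
  rw [← h.ac.integral_deriv_eq_sub]
  refine intervalIntegral.integral_congr_ae ?_
  filter_upwards [h.ae_deriv hcd] with x hx hx' using (hx hx').symm

theorem continuousOn (h : HasACDeriv f f' c d) (hcd : c ≤ d) : ContinuousOn f (Icc c d) := by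
  simpa [uIcc_of_le hcd] using h.ac.continuousOn

theorem congr_deriv (h : HasACDeriv f f' c d) (hg : ∀ᵐ x, x ∈ Ioo c d → f' x = g' x) :
    HasACDeriv f g' c d where
  ac := h.ac
  deriv := by
    filter_upwards [h.deriv, hg] with x hx hx' hm
    exact hx' hm ▸ hx hm

theorem add (hf : HasACDeriv f f' c d) (hg : HasACDeriv g g' c d) :
    HasACDeriv (fun x => f x + g x) (fun x => f' x + g' x) c d where
  ac := hf.ac.add hg.ac
  deriv := by
    filter_upwards [hf.deriv, hg.deriv] with x h1 h2 hx using (h1 hx).add (h2 hx)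

theorem const_mul (r : ℝ) (hf : HasACDeriv f f' c d) :
    HasACDeriv (fun x => r * f x) (fun x => r * f' x) c d where
  ac := hf.ac.const_mul r
  deriv := by
    filter_upwards [hf.deriv] with x h1 hx using (h1 hx).const_mul r

theorem mul (hf : HasACDeriv f f' c d) (hg : HasACDeriv g g' c d) :
    HasACDeriv (fun x => f x * g x) (fun x => f' x * g x + f x * g' x) c d where
  ac := hf.ac.mul hg.ac
  deriv := by
    filter_upwards [hf.deriv, hg.deriv] with x h1 h2 hx using (h1 hx).mul (h2 hx)

theorem of_contDiffOn (hf : ContDiffOn ℝ 1 f (uIcc c d))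
    (hf' : ∀ x ∈ Ioo c d, HasDerivAt f (f' x) x) : HasACDeriv f f' c d where
  ac := hf.absolutelyContinuousOnInterval
  deriv := Eventually.of_forall hf'

theorem of_contDiff (hf : ContDiff ℝ 1 f) (hf' : ∀ x, HasDerivAt f (f' x) x) :
    HasACDeriv f f' c d := of_contDiffOn hf.contDiffOn fun x _ => hf' x

/-- The image of a compact interval under f is compact and convex, so a function that is C¹ near it
is Lipschitz on it, and Lipschitz maps preserve absolute continuity. -/
theorem comp {φ φ' : ℝ → ℝ} (hcd : c ≤ d) (hf : HasACDeriv f f' c d)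
    (hφ : ∀ x ∈ Icc c d, ContDiffAt ℝ 1 φ (f x))
    (hφ' : ∀ x ∈ Ioo c d, HasDerivAt φ (φ' (f x)) (f x)) :
    HasACDeriv (fun x => φ (f x)) (fun x => φ' (f x) * f' x) c d where
  ac := by
    have hc := hf.continuousOn hcd
    have hcomp : IsCompact (f '' Icc c d) := isCompact_Icc.image_of_continuousOn hc
    have hconv : Convex ℝ (f '' Icc c d) :=
      ((isPreconnected_Icc.image f hc).ordConnected).convex
    have hcd1 : ContDiffOn ℝ 1 φ (f '' Icc c d) := by
      rintro _ ⟨x, hx, rfl⟩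
      exact (hφ x hx).contDiffWithinAt
    obtain ⟨L, hL⟩ := hcd1.exists_lipschitzOnWith (by decide) hconv hcomp
    refine hf.ac.comp_lipschitzOnWith hL ?_
    rw [uIcc_of_le hcd]
    exact mapsTo_image f _
  deriv := by
    filter_upwards [hf.deriv] with x h1 hx using (hφ' x hx).comp x (h1 hx)

theorem inv (hcd : c ≤ d) (hf : HasACDeriv f f' c d) (h0 : ∀ x ∈ Icc c d, f x ≠ 0) :
    HasACDeriv (fun x => (f x)⁻¹) (fun x => -(f x ^ 2)⁻¹ * f' x) c d :=
  hf.comp (φ := fun y => y⁻¹) (φ' := fun y => -(y ^ 2)⁻¹) hcd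
    (fun x hx => contDiffAt_inv ℝ (h0 x hx))
    fun x hx => hasDerivAt_inv (h0 x (Ioo_subset_Icc_self hx))

theorem exp (hcd : c ≤ d) (hf : HasACDeriv f f' c d) :
    HasACDeriv (fun x => Real.exp (f x)) (fun x => Real.exp (f x) * f' x) c d :=
  hf.comp hcd (fun _ _ => Real.contDiff_exp.contDiffAt) fun _ _ => Real.hasDerivAt_exp _

theorem of_integral {r : ℝ} (hcd : c ≤ d) (hf' : IntervalIntegrable f' volume c d)
    {e : ℝ} (he : e ∈ Icc c d) :
    HasACDeriv (fun x => r + ∫ y in e..x, f' y) f' c d where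
  ac := by
    have h1 : AbsolutelyContinuousOnInterval (fun _ : ℝ => r) c d :=
      ((LipschitzWith.const r).lipschitzOnWith (s := uIcc c d)).absolutelyContinuousOnInterval
    exact h1.add (hf'.absolutelyContinuousOnInterval_intervalIntegral
      (by rwa [uIcc_of_le hcd]))
  deriv := by
    filter_upwards [hf'.ae_hasDerivAt_integral] with x hx hx'
    rw [uIcc_of_le hcd] at hx
    exact (hx (Ioo_subset_Icc_self hx') e he).const_add r

end HasACDeriv

/-! ### One-sided limits at a singular end point -/

/-- Integrability of the derivative up to the singular point forces a one-sided limit there,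
whatever value f takes at the point itself. That the limit is zero, when it is, comes from a
separate argument. -/
theorem tendsto_of_hasACDeriv_right {f f' : ℝ → ℝ} {a b : ℝ} (hab : a < b)
    (h : ∀ c ∈ Ioc a b, HasACDeriv f f' c b) (hf' : IntervalIntegrable f' volume a b) :
    Tendsto f (𝓝[>] a) (𝓝 (f b - ∫ x in a..b, f' x)) := by
  have h1 : Tendsto (fun c => ∫ x in b..c, f' x) (𝓝[>] a) (𝓝 (∫ x in b..a, f' x)) := by
    have h2 := intervalIntegral.continuousOn_primitive_interval' hf' (right_mem_uIcc)
    rw [uIcc_of_le hab.le] at h2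
    exact (h2 a (left_mem_Icc.2 hab.le)).mono_left
      (nhdsWithin_le_of_mem (Icc_mem_nhdsGT hab))
  rw [intervalIntegral.integral_symm] at h1
  have h3 := h1.const_add (f b)
  refine (h3.congr' ?_)
  filter_upwards [Ioc_mem_nhdsGT hab] with c hc
  rw [intervalIntegral.integral_symm, (h c hc).integral_eq hc.2]
  ring

theorem tendsto_of_hasACDeriv_left {f f' : ℝ → ℝ} {a b : ℝ} (hab : a < b)
    (h : ∀ c ∈ Ico a b, HasACDeriv f f' a c) (hf' : IntervalIntegrable f' volume a b) :
    Tendsto f (𝓝[<] b) (𝓝 (f a + ∫ x in a..b, f' x)) := by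
  have h1 : Tendsto (fun c => ∫ x in a..c, f' x) (𝓝[<] b) (𝓝 (∫ x in a..b, f' x)) := by
    have h2 := intervalIntegral.continuousOn_primitive_interval' hf' (left_mem_uIcc)
    rw [uIcc_of_le hab.le] at h2
    exact (h2 b (right_mem_Icc.2 hab.le)).mono_left
      (nhdsWithin_le_of_mem (Icc_mem_nhdsLT hab))
  have h3 := h1.const_add (f a)
  refine (h3.congr' ?_)
  filter_upwards [Ico_mem_nhdsLT hab] with c hc
  rw [(h c hc).integral_eq hc.1]
  ring

end DegenerateParabolic

/-! ### Integration by parts on the interval punctured at `x₀` -/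

namespace DegenerateParabolic

theorem Integrable.intervalIntegrable_muI {g : ℝ → ℝ} (hg : Integrable g μI) {c d : ℝ}
    (hc : c ∈ Icc (0 : ℝ) 1) (hd : d ∈ Icc (0 : ℝ) 1) : IntervalIntegrable g volume c d := by
  have h : IntervalIntegrable g volume 0 1 := by
    rw [intervalIntegrable_iff_integrableOn_Ioo_of_le zero_le_one]; exact hg
  refine h.mono_set ?_
  rw [uIcc_of_le zero_le_one]
  exact uIcc_subset_Icc hc hd

theorem integral_muI_eq_interval (g : ℝ → ℝ) : ∫ x, g x ∂μI = ∫ x in (0 : ℝ)..1, g x := by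
  rw [intervalIntegral.integral_of_le zero_le_one, integral_Ioc_eq_integral_Ioo]

theorem integral_muI_eq_add {g : ℝ → ℝ} (hg : Integrable g μI) {x₀ : ℝ}
    (hx₀ : x₀ ∈ Ioo (0 : ℝ) 1) :
    ∫ x, g x ∂μI = (∫ x in (0 : ℝ)..x₀, g x) + ∫ x in x₀..1, g x := by
  rw [integral_muI_eq_interval]
  have h := Ioo_subset_Icc_self hx₀
  exact (intervalIntegral.integral_add_adjacent_intervals
    (Integrable.intervalIntegrable_muI hg (by simp) h)
    (Integrable.intervalIntegrable_muI hg h (by simp))).symm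

theorem intervalIntegral_mono_ae_Ioo {f g : ℝ → ℝ} {c d : ℝ} (hcd : c ≤ d)
    (hf : IntervalIntegrable f volume c d) (hg : IntervalIntegrable g volume c d)
    (h : ∀ᵐ x : ℝ, x ∈ Ioo c d → f x ≤ g x) : ∫ x in c..d, f x ≤ ∫ x in c..d, g x := by
  rw [intervalIntegral.integral_of_le hcd, intervalIntegral.integral_of_le hcd,
    integral_Ioc_eq_integral_Ioo, integral_Ioc_eq_integral_Ioo]
  rw [intervalIntegrable_iff_integrableOn_Ioo_of_le hcd] at hf hg
  exact integral_mono_ae hf hg ((ae_restrict_iff' measurableSet_Ioo).2 h)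

theorem ae_muI_iff {p : ℝ → Prop} : (∀ᵐ x ∂μI, p x) ↔ ∀ᵐ x : ℝ, x ∈ Ioo (0 : ℝ) 1 → p x :=
  ae_restrict_iff' measurableSet_Ioo

theorem ae_muI_ne (x₀ : ℝ) : ∀ᵐ x ∂μI, x ≠ x₀ := by
  refine ae_restrict_of_ae ?_
  simp [ae_iff]

theorem ae_muI_mem : ∀ᵐ x ∂μI, x ∈ Ioo (0 : ℝ) 1 := ae_restrict_mem measurableSet_Ioo

/-- `f` is absolutely continuous on compact subintervals of `[0,x₀) ∪ (x₀,1]` with derivative `f'`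
almost everywhere. -/
structure HasPuncturedACDeriv (x₀ : ℝ) (f f' : ℝ → ℝ) : Prop where
  left : ∀ c ∈ Ico 0 x₀, HasACDeriv f f' 0 c
  right : ∀ c ∈ Ioc x₀ 1, HasACDeriv f f' c 1

theorem HasACDeriv.punctured {f f' : ℝ → ℝ} {x₀ : ℝ} (hx₀ : x₀ ∈ Ioo (0 : ℝ) 1)
    (h : HasACDeriv f f' 0 1) : HasPuncturedACDeriv x₀ f f' where
  left _ hc := h.mono le_rfl hc.1 (hc.2.le.trans hx₀.2.le)
  right _ hc := h.mono (hx₀.1.le.trans hc.1.le) hc.2 le_rfl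

namespace HasPuncturedACDeriv

variable {x₀ : ℝ} {f f' g g' : ℝ → ℝ}

theorem mul (hf : HasPuncturedACDeriv x₀ f f') (hg : HasPuncturedACDeriv x₀ g g') :
    HasPuncturedACDeriv x₀ (fun x => f x * g x) (fun x => f' x * g x + f x * g' x) where
  left c hc := (hf.left c hc).mul (hg.left c hc)
  right c hc := (hf.right c hc).mul (hg.right c hc)

theorem add (hf : HasPuncturedACDeriv x₀ f f') (hg : HasPuncturedACDeriv x₀ g g') :
    HasPuncturedACDeriv x₀ (fun x => f x + g x) (fun x => f' x + g' x) where
  left c hc := (hf.left c hc).add (hg.left c hc)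
  right c hc := (hf.right c hc).add (hg.right c hc)

theorem inv (hf : HasPuncturedACDeriv x₀ f f') (h0 : ∀ x ∈ Icc (0 : ℝ) 1, x ≠ x₀ → f x ≠ 0)
    (hx₀ : x₀ ∈ Ioo (0 : ℝ) 1) :
    HasPuncturedACDeriv x₀ (fun x => (f x)⁻¹) (fun x => -(f x ^ 2)⁻¹ * f' x) where
  left c hc := (hf.left c hc).inv hc.1 fun x hx =>
    h0 x ⟨hx.1, by linarith [hx.2, hc.2, hx₀.2]⟩ (by linarith [hx.2, hc.2] : x < x₀).ne
  right c hc := (hf.right c hc).inv hc.2 fun x hx =>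
    h0 x ⟨by linarith [hx.1, hc.1, hx₀.1], hx.2⟩ (by linarith [hx.1, hc.1] : x₀ < x).ne'

theorem congr_deriv (hf : HasPuncturedACDeriv x₀ f f') (hx₀ : x₀ ∈ Ioo (0 : ℝ) 1)
    (h : ∀ᵐ x ∂μI, f' x = g' x) : HasPuncturedACDeriv x₀ f g' := by
  rw [ae_muI_iff] at h
  refine ⟨fun c hc => (hf.left c hc).congr_deriv ?_, fun c hc => (hf.right c hc).congr_deriv ?_⟩
  · filter_upwards [h] with x hx hx' using hx ⟨hx'.1, by linarith [hx'.2, hc.2, hx₀.2]⟩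
  · filter_upwards [h] with x hx hx' using hx ⟨by linarith [hx'.1, hc.1, hx₀.1], hx'.2⟩

theorem continuousAt (hf : HasPuncturedACDeriv x₀ f f') {x : ℝ} (hx : x ∈ Ioo (0 : ℝ) 1)
    (hne : x ≠ x₀) : ContinuousAt f x := by
  rcases lt_or_gt_of_ne hne with hlt | hgt
  · obtain ⟨c, hc1, hc2⟩ := exists_between hlt
    have hc0 : (0 : ℝ) ≤ c := by linarith [hx.1]
    exact ((hf.left c ⟨hc0, hc2⟩).continuousOn hc0).continuousAt (Icc_mem_nhds hx.1 hc1)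
  · obtain ⟨c, hc1, hc2⟩ := exists_between hgt
    have hc0 : c ≤ (1 : ℝ) := by linarith [hx.2]
    exact ((hf.right c ⟨hc1, hc0⟩).continuousOn hc0).continuousAt (Icc_mem_nhds hc2 hx.2)

/-- The integral inequality for functions of favourable sign near the singular point. -/
theorem integral_le (hf : HasPuncturedACDeriv x₀ f f') (hx₀ : x₀ ∈ Ioo (0 : ℝ) 1)
    (hg : Integrable g μI) (hle : ∀ᵐ x ∂μI, g x ≤ f' x)
    (hneg : ∀ x ∈ Ioo 0 x₀, f x ≤ 0) (hpos : ∀ x ∈ Ioo x₀ 1, 0 ≤ f x) :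
    ∫ x, g x ∂μI ≤ f 1 - f 0 := by
  rw [integral_muI_eq_add hg hx₀]
  rw [ae_muI_iff] at hle
  have hx : x₀ ∈ Icc (0 : ℝ) 1 := Ioo_subset_Icc_self hx₀
  have hgl := Integrable.intervalIntegrable_muI hg (by simp : (0 : ℝ) ∈ Icc (0 : ℝ) 1) hx
  have hgr := Integrable.intervalIntegrable_muI hg hx (by simp : (1 : ℝ) ∈ Icc (0 : ℝ) 1)
  have hL : ∫ x in (0 : ℝ)..x₀, g x ≤ - f 0 := by
    have h2 := intervalIntegral.continuousOn_primitive_interval' hgl left_mem_uIcc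
    rw [uIcc_of_le hx₀.1.le] at h2
    have h1 : Tendsto (fun c => ∫ x in (0 : ℝ)..c, g x) (𝓝[<] x₀) (𝓝 (∫ x in (0 : ℝ)..x₀, g x)) :=
      (h2 x₀ (right_mem_Icc.2 hx₀.1.le)).mono_left
        (nhdsWithin_le_of_mem (Icc_mem_nhdsLT hx₀.1))
    -- Only the minorant g is integrable up to x₀; f' need not be. The integral of f' stops at c <
    -- x₀, where f c ≤ 0 may be discarded, and only the integral of g passes to the limit.
    refine le_of_tendsto h1 ?_
    filter_upwards [Ioo_mem_nhdsLT hx₀.1] with c hc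
    have h3 := hf.left c ⟨hc.1.le, hc.2⟩
    have h4 := h3.integral_eq hc.1.le
    have h5 : ∫ x in (0 : ℝ)..c, g x ≤ ∫ x in (0 : ℝ)..c, f' x := by
      refine intervalIntegral_mono_ae_Ioo hc.1.le ?_ (h3.intervalIntegrable hc.1.le) ?_
      · exact Integrable.intervalIntegrable_muI hg (by simp) ⟨hc.1.le, by linarith [hc.2, hx₀.2]⟩
      · filter_upwards [hle] with x hx hx' using hx ⟨hx'.1, by linarith [hx'.2, hc.2, hx₀.2]⟩
    linarith [hneg c hc]
  have hR : ∫ x in x₀..1, g x ≤ f 1 := by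
    have h2 := intervalIntegral.continuousOn_primitive_interval' hgr right_mem_uIcc
    rw [uIcc_of_le hx₀.2.le] at h2
    have h1 : Tendsto (fun c => ∫ x in (1 : ℝ)..c, g x) (𝓝[>] x₀) (𝓝 (∫ x in (1 : ℝ)..x₀, g x)) :=
      (h2 x₀ (left_mem_Icc.2 hx₀.2.le)).mono_left
        (nhdsWithin_le_of_mem (Icc_mem_nhdsGT hx₀.2))
    rw [intervalIntegral.integral_symm]
    rw [neg_le]
    refine ge_of_tendsto h1 ?_
    filter_upwards [Ioo_mem_nhdsGT hx₀.2] with c hc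
    rw [intervalIntegral.integral_symm, neg_le_neg_iff]
    have h3 := hf.right c ⟨hc.1, hc.2.le⟩
    have h4 := h3.integral_eq hc.2.le
    have h5 : ∫ x in c..1, g x ≤ ∫ x in c..1, f' x := by
      refine intervalIntegral_mono_ae_Ioo hc.2.le ?_ (h3.intervalIntegrable hc.2.le) ?_
      · exact Integrable.intervalIntegrable_muI hg ⟨by linarith [hc.1, hx₀.1], hc.2.le⟩ (by simp)
      · filter_upwards [hle] with x hx hx' using hx ⟨by linarith [hx'.1, hc.1, hx₀.1], hx'.2⟩
    linarith [hpos c hc]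
  linarith

theorem integral_eq_of_tendsto (hf : HasPuncturedACDeriv x₀ f f') (hx₀ : x₀ ∈ Ioo (0 : ℝ) 1)
    (hf' : Integrable f' μI) {ℓ : ℝ} (hl : Tendsto f (𝓝[<] x₀) (𝓝 ℓ))
    (hr : Tendsto f (𝓝[>] x₀) (𝓝 ℓ)) : ∫ x, f' x ∂μI = f 1 - f 0 := by
  rw [integral_muI_eq_add hf' hx₀]
  have hx : x₀ ∈ Icc (0 : ℝ) 1 := Ioo_subset_Icc_self hx₀
  have h1 := tendsto_nhds_unique hl (tendsto_of_hasACDeriv_left hx₀.1 hf.left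
    (Integrable.intervalIntegrable_muI hf' (by simp) hx))
  have h2 := tendsto_nhds_unique hr (tendsto_of_hasACDeriv_right hx₀.2 hf.right
    (Integrable.intervalIntegrable_muI hf' hx (by simp)))
  linarith

end HasPuncturedACDeriv

/-- A nonzero limit would give 1/|x - x₀| ≤ (2/|ℓ|) G on an interval ending at x₀, making 1/(x - x₀)
integrable there. The filter is left abstract so as to cover both sides of x₀. -/
theorem eq_zero_of_tendsto_of_le_abs_sub_mul {l : Filter ℝ} {x₀ ℓ : ℝ} {f G : ℝ → ℝ}
    (hl : ∀ s ∈ l, ∃ e ∈ Icc (0 : ℝ) 1, e ≠ x₀ ∧ uIoo x₀ e ⊆ s) (hx₀ : x₀ ∈ Ioo (0 : ℝ) 1)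
    (hf : Tendsto f l (𝓝 ℓ)) (hG : Integrable G μI)
    (hle : ∀ᵐ x ∂μI, |f x| ≤ |x - x₀| * G x) : ℓ = 0 := by
  by_contra h0
  have hpos : 0 < |ℓ| / 2 := by positivity
  have h1 : ∀ᶠ x in l, |ℓ| / 2 < |f x| :=
    (hf.abs).eventually (lt_mem_nhds (by linarith))
  obtain ⟨e, he, hne, hes⟩ := hl _ h1
  have hint : IntervalIntegrable (fun x => (x - x₀)⁻¹) volume x₀ e := by
    have hG' := Integrable.intervalIntegrable_muI hG (Ioo_subset_Icc_self hx₀) he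
    have hG2 := hG'.const_mul (2 / |ℓ|)
    refine hG2.mono_fun (by fun_prop) ?_
    rw [ae_muI_iff] at hle
    have e1 : ∀ᵐ x : ℝ, x ≠ e := by simp [ae_iff]
    have e2 : ∀ᵐ x : ℝ, x ≠ x₀ := by simp [ae_iff]
    rw [Filter.EventuallyLE, ae_restrict_iff' measurableSet_uIoc]
    filter_upwards [hle, e1, e2] with x hx hxe hxx hx'
    have hmem : x ∈ uIoo x₀ e := by
      rcases lt_or_gt_of_ne hne with h | h
      · rw [uIoc_of_ge h.le] at hx'
        rw [uIoo_of_gt h]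
        exact ⟨hx'.1, lt_of_le_of_ne hx'.2 hxx⟩
      · rw [uIoc_of_le h.le] at hx'
        rw [uIoo_of_lt h]
        exact ⟨hx'.1, lt_of_le_of_ne hx'.2 hxe⟩
    have hx01 : x ∈ Ioo (0 : ℝ) 1 := by
      rcases lt_or_gt_of_ne hne with h | h
      · rw [uIoo_of_gt h] at hmem
        exact ⟨he.1.trans_lt hmem.1, hmem.2.trans hx₀.2⟩
      · rw [uIoo_of_lt h] at hmem
        exact ⟨hx₀.1.trans hmem.1, hmem.2.trans_le he.2⟩
    have h2 := hx hx01
    have h3 : |ℓ| / 2 < |f x| := hes hmem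
    have h4 : 0 < |x - x₀| := abs_pos.2 (sub_ne_zero.2 hxx)
    rw [norm_inv, Real.norm_eq_abs, Real.norm_eq_abs]
    refine le_trans ?_ (le_abs_self _)
    rw [inv_le_iff_one_le_mul₀ h4]
    have h5 : |ℓ| / 2 < |x - x₀| * G x := h3.trans_le h2
    have hl0 : 0 < |ℓ| := by linarith
    calc (1 : ℝ) = 2 / |ℓ| * (|ℓ| / 2) := by field_simp
      _ ≤ 2 / |ℓ| * (|x - x₀| * G x) := by gcongr
      _ = _ := by ring
  rw [intervalIntegrable_sub_inv_iff] at hint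
  rcases hint with h | h
  · exact hne h.symm
  · exact h left_mem_uIcc

theorem exists_uIoo_subset_of_mem_nhdsGT {x₀ : ℝ} (hx₀ : x₀ ∈ Ioo (0 : ℝ) 1) :
    ∀ s ∈ 𝓝[>] x₀, ∃ e ∈ Icc (0 : ℝ) 1, e ≠ x₀ ∧ uIoo x₀ e ⊆ s := by
  intro s hs
  obtain ⟨e, he, hes⟩ := (mem_nhdsGT_iff_exists_mem_Ioc_Ioo_subset hx₀.2).1 hs
  exact ⟨e, ⟨hx₀.1.le.trans he.1.le, he.2⟩, he.1.ne', by rwa [uIoo_of_lt he.1]⟩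

theorem exists_uIoo_subset_of_mem_nhdsLT {x₀ : ℝ} (hx₀ : x₀ ∈ Ioo (0 : ℝ) 1) :
    ∀ s ∈ 𝓝[<] x₀, ∃ e ∈ Icc (0 : ℝ) 1, e ≠ x₀ ∧ uIoo x₀ e ⊆ s := by
  intro s hs
  obtain ⟨e, he, hes⟩ := (mem_nhdsLT_iff_exists_mem_Ico_Ioo_subset hx₀.1).1 hs
  exact ⟨e, ⟨he.1, he.2.le.trans hx₀.2.le⟩, he.2.ne, by rwa [uIoo_of_gt he.2]⟩

/-- Integration of the derivative of a function with a power that is controlled at the singular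
point. -/
theorem HasPuncturedACDeriv.integral_eq_of_pow_le {x₀ : ℝ} {f f' G : ℝ → ℝ} {n : ℕ} (hn : n ≠ 0)
    (hf : HasPuncturedACDeriv x₀ f f') (hx₀ : x₀ ∈ Ioo (0 : ℝ) 1) (hf' : Integrable f' μI)
    (hG : Integrable G μI) (hle : ∀ᵐ x ∂μI, |f x| ^ n ≤ |x - x₀| * G x) :
    ∫ x, f' x ∂μI = f 1 - f 0 := by
  have hx : x₀ ∈ Icc (0 : ℝ) 1 := Ioo_subset_Icc_self hx₀
  have hl := tendsto_of_hasACDeriv_left hx₀.1 hf.left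
    (Integrable.intervalIntegrable_muI hf' (by simp) hx)
  have hr := tendsto_of_hasACDeriv_right hx₀.2 hf.right
    (Integrable.intervalIntegrable_muI hf' hx (by simp))
  have hle' : ∀ᵐ x ∂μI, |f x ^ n| ≤ |x - x₀| * G x := by
    filter_upwards [hle] with x hx
    rwa [abs_pow]
  -- Both one-sided limits exist by integrability of f'. Their n-th powers vanish by the hypothesis,
  -- so the limits agree and f behaves as if continuous at x₀.
  have h1 := eq_zero_of_tendsto_of_le_abs_sub_mul (exists_uIoo_subset_of_mem_nhdsLT hx₀) hx₀
    (hl.pow n) hG hle'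
  have h2 := eq_zero_of_tendsto_of_le_abs_sub_mul (exists_uIoo_subset_of_mem_nhdsGT hx₀) hx₀
    (hr.pow n) hG hle'
  rw [pow_eq_zero_iff hn] at h1 h2
  rw [h1] at hl
  rw [h2] at hr
  exact hf.integral_eq_of_tendsto hx₀ hf' hl hr

/-- Cauchy–Schwarz against the constant 1, read off from the nonnegativity of the variance of f
about its mean m. -/
theorem sq_intervalIntegral_le {f : ℝ → ℝ} {c d : ℝ} (hf : IntervalIntegrable f volume c d)
    (hf2 : IntervalIntegrable (fun x => f x ^ 2) volume c d) :
    (∫ x in c..d, f x) ^ 2 ≤ (d - c) * ∫ x in c..d, f x ^ 2 := by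
  wlog hcd : c ≤ d generalizing c d
  · have := this hf.symm hf2.symm (le_of_not_ge hcd)
    rw [intervalIntegral.integral_symm, intervalIntegral.integral_symm d c]
    nlinarith
  rcases hcd.eq_or_lt with rfl | hlt
  · simp
  set m := (∫ x in c..d, f x) / (d - c) with hm
  have h0 : 0 ≤ ∫ x in c..d, (f x - m) ^ 2 :=
    intervalIntegral.integral_nonneg hcd fun x _ => sq_nonneg _
  have h1 : ∫ x in c..d, (f x - m) ^ 2 =
      (∫ x in c..d, f x ^ 2) - 2 * m * (∫ x in c..d, f x) + m ^ 2 * (d - c) := by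
    have : ∀ x, (f x - m) ^ 2 = f x ^ 2 - 2 * m * f x + m ^ 2 := fun x => by ring
    simp_rw [this]
    rw [intervalIntegral.integral_add (hf2.sub (hf.const_mul _)) (by simp),
      intervalIntegral.integral_sub hf2 (hf.const_mul _), intervalIntegral.integral_const_mul,
      intervalIntegral.integral_const, smul_eq_mul]
    ring
  have h2 : 0 < d - c := sub_pos.2 hlt
  have h3 : (∫ x in c..d, f x) = m * (d - c) := by rw [hm]; field_simp
  rw [h1, h3] at h0
  rw [h3]
  nlinarith

end DegenerateParabolic

/-! ### The degenerate coefficient, its weights, and the exponent `psi` -/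

namespace DegenerateParabolic

theorem dx_eq_deriv (u : ℝ → ℝ) {x : ℝ} (hx : x ∈ Ioo (0 : ℝ) 1) : dx u x = deriv u x :=
  derivWithin_of_mem_nhds (Icc_mem_nhds hx.1 hx.2)

theorem hasACDeriv_dx {u : ℝ → ℝ} {c d : ℝ} (h : AbsolutelyContinuousOnInterval u c d)
    (hc : 0 ≤ c) (hcd : c ≤ d) (hd : d ≤ 1) : HasACDeriv u (dx u) c d where
  ac := h
  deriv := by
    filter_upwards [h.ae_differentiableAt] with x hx hx'
    rw [dx_eq_deriv u ⟨hc.trans_lt hx'.1, hx'.2.trans_le hd⟩]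
    exact (hx (by rw [uIcc_of_le hcd]; exact Ioo_subset_Icc_self hx')).hasDerivAt

/-- The properties of the degenerate coefficient shared by both cases. -/
structure IsDegenerate (a : ℝ → ℝ) (x₀ K : ℝ) : Prop where
  x₀_mem : x₀ ∈ Ioo (0 : ℝ) 1
  zero : a x₀ = 0
  pos : ∀ x ∈ Icc (0 : ℝ) 1, x ≠ x₀ → 0 < a x
  ac : AbsolutelyContinuousOnInterval a 0 1
  lt_two : K < 2
  growth : ∀ᵐ x ∂μI, (x - x₀) * dx a x ≤ K * a x
  linear : 1 ≤ K → ∃ L, ∀ x ∈ Icc (0 : ℝ) 1, a x ≤ L * |x - x₀|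

theorem CoefficientHypothesis.isDegenerate {a : ℝ → ℝ} {x₀ K : ℝ}
    (h : CoefficientHypothesis a x₀ K) : IsDegenerate a x₀ K := by
  rcases h with h | ⟨h, -⟩
  · exact ⟨h.x₀_mem, h.zero, h.pos, h.memW1.1, by linarith [h.K_mem.2], h.growth,
      fun hK => absurd h.K_mem.2 (not_lt.2 hK)⟩
  · refine ⟨h.x₀_mem, h.zero, h.pos, h.memW1.1, h.K_mem.2, h.growth, fun _ => ?_⟩
    -- In the strongly degenerate case a' is essentially bounded, so a is Lipschitz; as a(x₀) = 0,
    -- it grows at most linearly away from x₀.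
    obtain ⟨L, hL⟩ : ∃ L : ℝ, ∀ᵐ x ∂μI, ‖dx a x‖ ≤ L := by
      have h1 := h.memW1.2.eLpNorm_lt_top
      rw [eLpNorm_exponent_top] at h1
      refine ⟨(eLpNormEssSup (dx a) μI).toReal, ?_⟩
      filter_upwards [enorm_ae_le_eLpNormEssSup (dx a) μI] with x hx
      have := ENNReal.toReal_mono h1.ne hx
      simpa using this
    refine ⟨L, fun x hx => ?_⟩
    have hx₀ := Ioo_subset_Icc_self h.x₀_mem
    rw [ae_muI_iff] at hL
    have key : ∀ c ∈ Icc (0 : ℝ) 1, ∀ d ∈ Icc (0 : ℝ) 1, c ≤ d → |a d - a c| ≤ L * |d - c| := by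
      intro c hc d hd hcd
      have h2 : HasACDeriv a (dx a) c d := (hasACDeriv_dx h.memW1.1 le_rfl zero_le_one le_rfl).mono
        hc.1 hcd hd.2
      rw [← h2.integral_eq hcd, ← Real.norm_eq_abs]
      refine intervalIntegral.norm_integral_le_of_norm_le_const_ae ?_
      have hd' : ∀ᵐ x : ℝ, x ≠ d := by simp [ae_iff]
      filter_upwards [hL, hd'] with y hy hyd hy'
      rw [uIoc_of_le hcd] at hy'
      exact hy ⟨hc.1.trans_lt hy'.1, (lt_of_le_of_ne hy'.2 hyd).trans_le hd.2⟩
    rcases le_total x x₀ with hle | hle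
    · have := key x hx x₀ hx₀ hle
      rw [h.zero, zero_sub, abs_neg, abs_sub_comm] at this
      exact (le_abs_self _).trans this
    · have := key x₀ hx₀ x hx hle
      rw [h.zero, sub_zero] at this
      exact (le_abs_self _).trans this

/-- The weight `(x - x₀) / a`. -/
noncomputable def linWeight (a : ℝ → ℝ) (x₀ x : ℝ) : ℝ := (x - x₀) / a x

/-- The weight `(x - x₀)² / a`. -/
noncomputable def quadWeight (a : ℝ → ℝ) (x₀ x : ℝ) : ℝ := (x - x₀) ^ 2 / a x

namespace IsDegenerate

variable {a : ℝ → ℝ} {x₀ K : ℝ}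

theorem hasACDeriv (h : IsDegenerate a x₀ K) : HasACDeriv a (dx a) 0 1 :=
  hasACDeriv_dx h.ac le_rfl zero_le_one le_rfl

theorem continuousOn (h : IsDegenerate a x₀ K) : ContinuousOn a (Icc 0 1) :=
  h.hasACDeriv.continuousOn zero_le_one

theorem nonneg (h : IsDegenerate a x₀ K) {x : ℝ} (hx : x ∈ Icc (0 : ℝ) 1) : 0 ≤ a x := by
  by_cases hne : x = x₀
  · rw [hne, h.zero]
  · exact (h.pos x hx hne).le

theorem hasPunctured_sub (x₀ : ℝ) (hx₀ : x₀ ∈ Ioo (0 : ℝ) 1) :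
    HasPuncturedACDeriv x₀ (fun x => x - x₀) fun _ => 1 :=
  HasACDeriv.punctured hx₀ (HasACDeriv.of_contDiff (by fun_prop)
    fun x => (hasDerivAt_id x).sub_const x₀)

/-- Here m'a = (a - (x - x₀)a')/a, so the bound is the growth condition divided by a. -/
theorem exists_linWeight_deriv (h : IsDegenerate a x₀ K) :
    ∃ m', HasPuncturedACDeriv x₀ (linWeight a x₀) m' ∧
      ∀ᵐ x ∂μI, (1 - K) ≤ m' x * a x := by
  have h1 := (hasPunctured_sub x₀ h.x₀_mem).mul
    ((h.hasACDeriv.punctured h.x₀_mem).inv (fun x hx hne => (h.pos x hx hne).ne') h.x₀_mem)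
  refine ⟨_, h1, ?_⟩
  filter_upwards [h.growth, ae_muI_mem, ae_muI_ne x₀] with x hx hx01 hne
  have ha := h.pos x (Ioo_subset_Icc_self hx01) hne
  have e : (1 * (a x)⁻¹ + (x - x₀) * (-(a x ^ 2)⁻¹ * dx a x)) * a x
      = (a x - (x - x₀) * dx a x) / a x := by
    field_simp
    ring
  rw [e, le_div_iff₀ ha]
  linarith

theorem quadWeight_eq (x : ℝ) : quadWeight a x₀ x = linWeight a x₀ x * (x - x₀) := by
  rw [quadWeight, linWeight]; ring

/-- Write the weight as m(x - x₀) with m the linear weight. Then b'(x - x₀) = (m'a + 1)b, and m'a +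
1 ≥ 2 - K. -/
theorem exists_quadWeight_deriv (h : IsDegenerate a x₀ K) :
    ∃ b', HasPuncturedACDeriv x₀ (quadWeight a x₀) b' ∧
      ∀ᵐ x ∂μI, (2 - K) * quadWeight a x₀ x ≤ b' x * (x - x₀) := by
  obtain ⟨m', hm, hle⟩ := h.exists_linWeight_deriv
  have h1 := hm.mul (hasPunctured_sub x₀ h.x₀_mem)
  refine ⟨fun x => m' x * (x - x₀) + linWeight a x₀ x * 1, ?_, ?_⟩
  · have : quadWeight a x₀ = fun x => linWeight a x₀ x * (x - x₀) := funext quadWeight_eq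
    rw [this]; exact h1
  filter_upwards [hle, ae_muI_mem, ae_muI_ne x₀] with x hx hx01 hne
  have ha := h.pos x (Ioo_subset_Icc_self hx01) hne
  have e : (m' x * (x - x₀) + linWeight a x₀ x * 1) * (x - x₀)
      = (m' x * a x + 1) * quadWeight a x₀ x := by
    rw [quadWeight, linWeight]; field_simp
  rw [e]
  have h0 : 0 ≤ quadWeight a x₀ x := by rw [quadWeight]; positivity
  nlinarith

theorem quadWeight_nonneg (h : IsDegenerate a x₀ K) {x : ℝ} (hx : x ∈ Icc (0 : ℝ) 1) :
    0 ≤ quadWeight a x₀ x := div_nonneg (sq_nonneg _) (h.nonneg hx)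

/-- Since b = m(x - x₀), dividing (2 - K)b ≤ b'(x - x₀) by x - x₀ > 0 gives (2 - K)m ≤ b'. This one
inequality yields the monotonicity of b, the integrability of m up to x₀ and the bound on the
integral defining ψ. To the left of x₀ the division reverses the inequality. -/
theorem integral_linWeight_le_right (h : IsDegenerate a x₀ K) {c d : ℝ} (hc : x₀ < c)
    (hcd : c ≤ d) (hd : d ≤ 1) : IntervalIntegrable (linWeight a x₀) volume c d ∧
    (2 - K) * ∫ x in c..d, linWeight a x₀ x ≤ quadWeight a x₀ d - quadWeight a x₀ c := by
  obtain ⟨b', hb, hle⟩ := h.exists_quadWeight_deriv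
  obtain ⟨m', hm, -⟩ := h.exists_linWeight_deriv
  have hbd := (hb.right c ⟨hc, hcd.trans hd⟩).mono le_rfl hcd hd
  have hmd := (hm.right c ⟨hc, hcd.trans hd⟩).mono le_rfl hcd hd
  have hmi : IntervalIntegrable (linWeight a x₀) volume c d :=
    (hmd.continuousOn hcd).intervalIntegrable_of_Icc hcd
  refine ⟨hmi, ?_⟩
  rw [← hbd.integral_eq hcd, ← intervalIntegral.integral_const_mul]
  refine intervalIntegral_mono_ae_Ioo hcd (hmi.const_mul _) (hbd.intervalIntegrable hcd) ?_
  rw [ae_muI_iff] at hle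
  filter_upwards [hle] with x hx hx'
  have h1 := hx ⟨by linarith [hx'.1, h.x₀_mem.1], by linarith [hx'.2]⟩
  have h2 : 0 < x - x₀ := by linarith [hx'.1]
  rw [quadWeight_eq, ← mul_assoc] at h1
  exact le_of_mul_le_mul_right h1 h2

theorem integral_linWeight_ge_left (h : IsDegenerate a x₀ K) {c d : ℝ} (hc : 0 ≤ c)
    (hcd : c ≤ d) (hd : d < x₀) : IntervalIntegrable (linWeight a x₀) volume c d ∧
    quadWeight a x₀ d - quadWeight a x₀ c ≤ (2 - K) * ∫ x in c..d, linWeight a x₀ x := by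
  obtain ⟨b', hb, hle⟩ := h.exists_quadWeight_deriv
  obtain ⟨m', hm, -⟩ := h.exists_linWeight_deriv
  have hbd := (hb.left d ⟨hc.trans hcd, hd⟩).mono hc hcd le_rfl
  have hmd := (hm.left d ⟨hc.trans hcd, hd⟩).mono hc hcd le_rfl
  have hmi : IntervalIntegrable (linWeight a x₀) volume c d :=
    (hmd.continuousOn hcd).intervalIntegrable_of_Icc hcd
  refine ⟨hmi, ?_⟩
  rw [← hbd.integral_eq hcd, ← intervalIntegral.integral_const_mul]
  refine intervalIntegral_mono_ae_Ioo hcd (hbd.intervalIntegrable hcd) (hmi.const_mul _) ?_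
  rw [ae_muI_iff] at hle
  filter_upwards [hle] with x hx hx'
  have h1 := hx ⟨by linarith [hx'.1], by linarith [hx'.2, h.x₀_mem.2]⟩
  have h2 : 0 < x₀ - x := by linarith [hx'.2]
  rw [quadWeight_eq, ← mul_assoc] at h1
  nlinarith

theorem linWeight_nonneg (h : IsDegenerate a x₀ K) {x : ℝ} (hx : x₀ ≤ x) (hx1 : x ≤ 1) :
    0 ≤ linWeight a x₀ x :=
  div_nonneg (by linarith) (h.nonneg ⟨h.x₀_mem.1.le.trans hx, hx1⟩)

theorem linWeight_nonpos (h : IsDegenerate a x₀ K) {x : ℝ} (hx : x ≤ x₀) (hx1 : 0 ≤ x) :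
    linWeight a x₀ x ≤ 0 :=
  div_nonpos_of_nonpos_of_nonneg (by linarith) (h.nonneg ⟨hx1, hx.trans h.x₀_mem.2.le⟩)

theorem quadWeight_mono (h : IsDegenerate a x₀ K) {c d : ℝ} (hc : x₀ < c)
    (hcd : c ≤ d) (hd : d ≤ 1) : quadWeight a x₀ c ≤ quadWeight a x₀ d := by
  have h1 := (h.integral_linWeight_le_right hc hcd hd).2
  have h2 : 0 ≤ ∫ x in c..d, linWeight a x₀ x := intervalIntegral.integral_nonneg hcd
    fun x hx => h.linWeight_nonneg (by linarith [hx.1]) (by linarith [hx.2])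
  nlinarith [h.lt_two]

theorem quadWeight_anti (h : IsDegenerate a x₀ K) {c d : ℝ} (hc : 0 ≤ c)
    (hcd : c ≤ d) (hd : d < x₀) : quadWeight a x₀ d ≤ quadWeight a x₀ c := by
  have h1 := (h.integral_linWeight_ge_left hc hcd hd).2
  have h2 : ∫ x in c..d, linWeight a x₀ x ≤ 0 := by
    have : 0 ≤ ∫ x in c..d, -linWeight a x₀ x := intervalIntegral.integral_nonneg hcd
      fun x hx => by linarith [h.linWeight_nonpos (x := x) (by linarith [hx.2]) (by linarith [hx.1])]
    rw [intervalIntegral.integral_neg] at this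
    linarith
  nlinarith [h.lt_two]

theorem quadWeight_le (h : IsDegenerate a x₀ K) {x : ℝ} (hx : x ∈ Icc (0 : ℝ) 1) :
    quadWeight a x₀ x ≤ max (quadWeight a x₀ 1) (quadWeight a x₀ 0) := by
  rcases lt_trichotomy x x₀ with hlt | rfl | hgt
  · exact (h.quadWeight_anti le_rfl hx.1 hlt).trans (le_max_right _ _)
  · have : quadWeight a x x = 0 := by simp [quadWeight]
    rw [this]
    exact (h.quadWeight_nonneg (by simp)).trans (le_max_left _ _)
  · exact (h.quadWeight_mono hgt hx.2 le_rfl).trans (le_max_left _ _)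

/-- The weight is nonnegative here, and its integrals over [x₀ + (1 - x₀)/(n + 1), 1] are bounded by
b(1)/(2 - K) uniformly in n. -/
theorem intervalIntegrable_linWeight_right (h : IsDegenerate a x₀ K) :
    IntervalIntegrable (linWeight a x₀) volume x₀ 1 := by
  have hK : 0 < 2 - K := by linarith [h.lt_two]
  have hx := h.x₀_mem.2
  have hmem : ∀ n : ℕ, x₀ < x₀ + (1 - x₀) * (1 / ((n : ℝ) + 1)) ∧
      x₀ + (1 - x₀) * (1 / ((n : ℝ) + 1)) ≤ 1 := fun n => by
    have h1 : 0 < 1 / ((n : ℝ) + 1) := Nat.one_div_pos_of_nat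
    have h2 : 1 / ((n : ℝ) + 1) ≤ 1 := by
      rw [div_le_one (by positivity)]; linarith [Nat.cast_nonneg (α := ℝ) n]
    constructor <;> nlinarith
  rw [intervalIntegrable_iff_integrableOn_Ioc_of_le hx.le]
  refine integrableOn_Ioc_of_intervalIntegral_norm_bounded_left (l := atTop)
    (a := fun n : ℕ => x₀ + (1 - x₀) * (1 / ((n : ℝ) + 1))) (I := quadWeight a x₀ 1 / (2 - K))
    (fun n => ?_) ?_ (Eventually.of_forall fun n => ?_)
  · exact (intervalIntegrable_iff_integrableOn_Ioc_of_le (hmem n).2).1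
      (h.integral_linWeight_le_right (hmem n).1 (hmem n).2 le_rfl).1
  · simpa using (tendsto_one_div_add_atTop_nhds_zero_nat (𝕜 := ℝ)).const_mul (1 - x₀)
      |>.const_add x₀
  · have h1 := (h.integral_linWeight_le_right (hmem n).1 (hmem n).2 le_rfl).2
    rw [intervalIntegral.integral_of_le (hmem n).2] at h1
    rw [le_div_iff₀ hK]
    have h2 : ∫ x in Ioc (x₀ + (1 - x₀) * (1 / ((n : ℝ) + 1))) 1, ‖linWeight a x₀ x‖ =
        ∫ x in Ioc (x₀ + (1 - x₀) * (1 / ((n : ℝ) + 1))) 1, linWeight a x₀ x := by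
      refine setIntegral_congr_fun measurableSet_Ioc fun x hx => ?_
      exact Real.norm_of_nonneg (h.linWeight_nonneg ((hmem n).1.trans hx.1).le hx.2)
    rw [h2]
    have h3 := h.quadWeight_nonneg
      (Ioc_subset_Icc_self ⟨h.x₀_mem.1.trans (hmem n).1, (hmem n).2⟩)
    linarith

theorem intervalIntegrable_linWeight_left (h : IsDegenerate a x₀ K) :
    IntervalIntegrable (linWeight a x₀) volume 0 x₀ := by
  have hK : 0 < 2 - K := by linarith [h.lt_two]
  have hx := h.x₀_mem.1
  have hmem : ∀ n : ℕ, x₀ - x₀ * (1 / ((n : ℝ) + 1)) < x₀ ∧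
      0 ≤ x₀ - x₀ * (1 / ((n : ℝ) + 1)) := fun n => by
    have h1 : 0 < 1 / ((n : ℝ) + 1) := Nat.one_div_pos_of_nat
    have h2 : 1 / ((n : ℝ) + 1) ≤ 1 := by
      rw [div_le_one (by positivity)]; linarith [Nat.cast_nonneg (α := ℝ) n]
    constructor <;> nlinarith
  rw [intervalIntegrable_iff_integrableOn_Ioc_of_le hx.le]
  refine integrableOn_Ioc_of_intervalIntegral_norm_bounded_right (l := atTop)
    (b := fun n : ℕ => x₀ - x₀ * (1 / ((n : ℝ) + 1))) (I := quadWeight a x₀ 0 / (2 - K))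
    (fun n => ?_) ?_ (Eventually.of_forall fun n => ?_)
  · exact (intervalIntegrable_iff_integrableOn_Ioc_of_le (hmem n).2).1
      (h.integral_linWeight_ge_left le_rfl (hmem n).2 (hmem n).1).1
  · simpa using (tendsto_one_div_add_atTop_nhds_zero_nat (𝕜 := ℝ)).const_mul x₀
      |>.const_sub x₀
  · have h1 := (h.integral_linWeight_ge_left le_rfl (hmem n).2 (hmem n).1).2
    rw [intervalIntegral.integral_of_le (hmem n).2] at h1
    rw [le_div_iff₀ hK]
    have h2 : ∫ x in Ioc 0 (x₀ - x₀ * (1 / ((n : ℝ) + 1))), ‖linWeight a x₀ x‖ =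
        -∫ x in Ioc 0 (x₀ - x₀ * (1 / ((n : ℝ) + 1))), linWeight a x₀ x := by
      rw [← integral_neg]
      refine setIntegral_congr_fun measurableSet_Ioc fun x hx => ?_
      exact Real.norm_of_nonpos (h.linWeight_nonpos (hx.2.trans (hmem n).1.le) hx.1.le)
    rw [h2]
    have h3 := h.quadWeight_nonneg
      (⟨(hmem n).2, ((hmem n).1.trans h.x₀_mem.2).le⟩ : _ ∈ Icc (0 : ℝ) 1)
    linarith

theorem intervalIntegrable_linWeight (h : IsDegenerate a x₀ K) :
    IntervalIntegrable (linWeight a x₀) volume 0 1 :=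
  h.intervalIntegrable_linWeight_left.trans h.intervalIntegrable_linWeight_right

theorem integral_linWeight_nonneg (h : IsDegenerate a x₀ K) {x : ℝ} (hx : x ∈ Icc (0 : ℝ) 1) :
    0 ≤ ∫ y in x₀..x, linWeight a x₀ y := by
  rcases le_total x x₀ with hle | hle
  · rw [intervalIntegral.integral_symm, ← intervalIntegral.integral_neg]
    exact intervalIntegral.integral_nonneg hle fun y hy =>
      neg_nonneg.2 (h.linWeight_nonpos hy.2 (hx.1.trans hy.1))
  · exact intervalIntegral.integral_nonneg hle fun y hy =>
      h.linWeight_nonneg hy.1 (hy.2.trans hx.2)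

/-- Let the inner end point tend to x₀ in the estimates away from x₀, discarding the nonnegative
value of b there; no limit of b at x₀ has to be identified. -/
theorem integral_linWeight_le (h : IsDegenerate a x₀ K) {x : ℝ} (hx : x ∈ Icc (0 : ℝ) 1) :
    (2 - K) * ∫ y in x₀..x, linWeight a x₀ y ≤ quadWeight a x₀ x := by
  have hx₀ := Ioo_subset_Icc_self h.x₀_mem
  have hi : ∀ c ∈ Icc (0 : ℝ) 1, ∀ d ∈ Icc (0 : ℝ) 1,
      IntervalIntegrable (linWeight a x₀) volume c d := fun c hc d hd =>
    h.intervalIntegrable_linWeight.mono_set (by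
      rw [uIcc_of_le zero_le_one]; exact uIcc_subset_Icc hc hd)
  have hcont := intervalIntegral.continuousOn_primitive_interval' (hi x hx x₀ hx₀) left_mem_uIcc
  rcases lt_trichotomy x x₀ with hlt | rfl | hgt
  · rw [uIcc_of_le hlt.le] at hcont
    have h1 : Tendsto (fun c => ∫ y in x..c, linWeight a x₀ y) (𝓝[<] x₀)
        (𝓝 (∫ y in x..x₀, linWeight a x₀ y)) :=
      (hcont x₀ (right_mem_Icc.2 hlt.le)).mono_left (nhdsWithin_le_of_mem (Icc_mem_nhdsLT hlt))
    rw [intervalIntegral.integral_symm]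
    have h2 := (h1.const_mul (2 - K)).neg
    rw [mul_neg]
    refine le_of_tendsto h2 ?_
    filter_upwards [Ioo_mem_nhdsLT hlt] with c hc
    have h3 := (h.integral_linWeight_ge_left hx.1 hc.1.le hc.2).2
    have h4 := h.quadWeight_nonneg (x := c) ⟨hx.1.trans hc.1.le, (hc.2.trans h.x₀_mem.2).le⟩
    linarith
  · simp [quadWeight]
  · rw [uIcc_of_ge hgt.le] at hcont
    have h1 : Tendsto (fun c => ∫ y in x..c, linWeight a x₀ y) (𝓝[>] x₀)
        (𝓝 (∫ y in x..x₀, linWeight a x₀ y)) :=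
      (hcont x₀ (left_mem_Icc.2 hgt.le)).mono_left (nhdsWithin_le_of_mem (Icc_mem_nhdsGT hgt))
    rw [intervalIntegral.integral_symm]
    have h2 := (h1.neg.const_mul (2 - K))
    refine le_of_tendsto h2 ?_
    filter_upwards [Ioo_mem_nhdsGT hgt] with c hc
    rw [← intervalIntegral.integral_symm]
    have h3 := (h.integral_linWeight_le_right hc.1 hc.2.le hx.2).2
    have h4 := h.quadWeight_nonneg (x := c) ⟨(h.x₀_mem.1.trans hc.1).le, hc.2.le.trans hx.2⟩
    linarith

theorem hasACDeriv_psi (h : IsDegenerate a x₀ K) (c₁ c₂ : ℝ) :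
    HasACDeriv (psi a x₀ c₁ c₂) (fun x => c₁ * linWeight a x₀ x) 0 1 := by
  have h1 := (HasACDeriv.of_integral (r := -c₂) zero_le_one h.intervalIntegrable_linWeight
    (Ioo_subset_Icc_self h.x₀_mem)).const_mul c₁
  have : psi a x₀ c₁ c₂ = fun x => c₁ * (-c₂ + ∫ y in x₀..x, linWeight a x₀ y) := by
    funext x
    simp only [psi, linWeight]
    ring
  rw [this]
  exact h1

/-- The exponent `ψ` is bounded and bounded away from zero. -/
theorem exists_psi_bounds (h : IsDegenerate a x₀ K) {c₁ c₂ : ℝ} (hc₁ : 0 < c₁)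
    (hc₂ : max ((1 - x₀) ^ 2 / (a 1 * (2 - K))) (x₀ ^ 2 / (a 0 * (2 - K))) < c₂) :
    0 < c₂ ∧ ∃ ε > 0, ∀ x ∈ Icc (0 : ℝ) 1, -(c₁ * c₂) ≤ psi a x₀ c₁ c₂ x ∧
      psi a x₀ c₁ c₂ x ≤ -ε := by
  have hK : 0 < 2 - K := by linarith [h.lt_two]
  set M := max (quadWeight a x₀ 1) (quadWeight a x₀ 0) with hM
  have hM0 : 0 ≤ M := (h.quadWeight_nonneg (by simp)).trans (le_max_left _ _)
  -- The lower bound on c₂ is this inequality: the integral in ψ is at most M/(2 - K), so ψ stays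
  -- below a negative constant.
  have hMc : M / (2 - K) < c₂ := by
    rw [div_lt_iff₀ hK, hM, max_lt_iff]
    have h1 := lt_of_le_of_lt (le_max_left _ _) hc₂
    have h0 := lt_of_le_of_lt (le_max_right _ _) hc₂
    rw [← div_div, div_lt_iff₀ hK] at h1 h0
    refine ⟨h1, ?_⟩
    simpa [quadWeight] using h0
  refine ⟨lt_of_le_of_lt (by positivity) hMc, c₁ * (c₂ - M / (2 - K)),
    mul_pos hc₁ (by linarith), fun x hx => ?_⟩
  have h1 := h.integral_linWeight_nonneg hx
  have h2 := (h.integral_linWeight_le hx).trans (h.quadWeight_le hx)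
  have h3 : ∫ y in x₀..x, linWeight a x₀ y ≤ M / (2 - K) := by
    rw [le_div_iff₀ hK]; linarith
  have e : psi a x₀ c₁ c₂ x = c₁ * ((∫ y in x₀..x, linWeight a x₀ y) - c₂) := rfl
  rw [e]
  constructor <;> nlinarith

end IsDegenerate
end DegenerateParabolic

/-! ### Admissible functions and integration by parts across the degeneracy -/

namespace DegenerateParabolic

theorem _root_.MeasureTheory.MemLp.integrable_mul_two {α : Type*} [MeasurableSpace α]
    {μ : Measure α} {f g : α → ℝ} (hf : MemLp f 2 μ) (hg : MemLp g 2 μ) :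
    Integrable (fun x => f x * g x) μ := hf.integrable_mul hg

theorem _root_.MeasureTheory.MemLp.bounded_mul {α : Type*} [MeasurableSpace α]
    {μ : Measure α} {f φ : α → ℝ} (hf : MemLp f 2 μ) (hφ : AEStronglyMeasurable φ μ) (C : ℝ)
    (hC : ∀ᵐ x ∂μ, |φ x| ≤ C) : MemLp (fun x => φ x * f x) 2 μ := by
  refine MemLp.of_le_mul (c := C) hf (hφ.mul hf.1) ?_
  filter_upwards [hC] with x hx
  rw [norm_mul]
  gcongr
  exact hx

/-- Functions with the properties of the elements of `𝓗¹_a(0,1)` and their derivatives, in a form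
common to both cases. -/
structure IsAdmissible (a : ℝ → ℝ) (x₀ K : ℝ) (u u' : ℝ → ℝ) : Prop where
  punctured : HasPuncturedACDeriv x₀ u u'
  memLp : MemLp u 2 μI
  weighted : MemLp (fun x => √(a x) * u' x) 2 μI
  left : u 0 = 0
  right : u 1 = 0
  continuousAt : K < 1 → ContinuousAt u x₀

/-- The weight `(x - x₀) / √a`. -/
noncomputable def rootWeight (a : ℝ → ℝ) (x₀ x : ℝ) : ℝ := (x - x₀) / √(a x)

section

variable {a : ℝ → ℝ} {x₀ K : ℝ}

theorem IsDegenerate.aemeasurable (h : IsDegenerate a x₀ K) : AEMeasurable a μI :=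
  (h.continuousOn.mono Ioo_subset_Icc_self).aemeasurable measurableSet_Ioo

theorem IsDegenerate.rootWeight_meas (h : IsDegenerate a x₀ K) :
    AEStronglyMeasurable (rootWeight a x₀) μI := by
  have h1 := h.aemeasurable
  have : AEMeasurable (rootWeight a x₀) μI :=
    (by fun_prop : AEMeasurable (fun x : ℝ => x - x₀) μI).div h1.sqrt
  exact this.aestronglyMeasurable

theorem IsDegenerate.quadWeight_meas (h : IsDegenerate a x₀ K) :
    AEStronglyMeasurable (quadWeight a x₀) μI := by
  have h1 := h.aemeasurable
  have : AEMeasurable (quadWeight a x₀) μI :=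
    (by fun_prop : AEMeasurable (fun x : ℝ => (x - x₀) ^ 2) μI).div h1
  exact this.aestronglyMeasurable

theorem IsDegenerate.rootWeight_sq (h : IsDegenerate a x₀ K) {x : ℝ} (hx : x ∈ Icc (0 : ℝ) 1) :
    rootWeight a x₀ x ^ 2 = quadWeight a x₀ x := by
  rw [rootWeight, quadWeight, div_pow, Real.sq_sqrt (h.nonneg hx)]

theorem IsDegenerate.exists_rootWeight_bound (h : IsDegenerate a x₀ K) :
    ∃ C, 0 ≤ C ∧ ∀ x ∈ Icc (0 : ℝ) 1, |rootWeight a x₀ x| ≤ C ∧ |quadWeight a x₀ x| ≤ C := by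
  set M := max (quadWeight a x₀ 1) (quadWeight a x₀ 0)
  refine ⟨max (√M) M, (Real.sqrt_nonneg _).trans (le_max_left _ _), fun x hx => ⟨?_, ?_⟩⟩
  · refine le_trans ?_ (le_max_left _ _)
    apply Real.abs_le_sqrt
    rw [h.rootWeight_sq hx]
    exact h.quadWeight_le hx
  · refine le_trans ?_ (le_max_right _ _)
    rw [abs_of_nonneg (h.quadWeight_nonneg hx)]
    exact h.quadWeight_le hx

theorem IsDegenerate.sqrt_mul_rootWeight (h : IsDegenerate a x₀ K) {x : ℝ}
    (hx : x ∈ Ioo (0 : ℝ) 1) (hne : x ≠ x₀) : √(a x) * rootWeight a x₀ x = x - x₀ := by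
  have := Real.sqrt_pos.2 (h.pos x (Ioo_subset_Icc_self hx) hne)
  rw [rootWeight]
  field_simp

theorem IsDegenerate.memLp_rootWeight_mul (h : IsDegenerate a x₀ K) {f : ℝ → ℝ}
    (hf : MemLp f 2 μI) : MemLp (fun x => rootWeight a x₀ x * f x) 2 μI := by
  obtain ⟨C, -, hC⟩ := h.exists_rootWeight_bound
  refine hf.bounded_mul h.rootWeight_meas C ?_
  filter_upwards [ae_muI_mem] with x hx using (hC x (Ioo_subset_Icc_self hx)).1

theorem IsDegenerate.memLp_quadWeight_mul (h : IsDegenerate a x₀ K) {f : ℝ → ℝ}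
    (hf : MemLp f 2 μI) : MemLp (fun x => quadWeight a x₀ x * f x) 2 μI := by
  obtain ⟨C, -, hC⟩ := h.exists_rootWeight_bound
  refine hf.bounded_mul h.quadWeight_meas C ?_
  filter_upwards [ae_muI_mem] with x hx using (hC x (Ioo_subset_Icc_self hx)).2

/-- Multiplication by a bounded absolutely continuous function. -/
theorem memLp_mul_of_hasACDeriv {F F' f : ℝ → ℝ} (hF : HasACDeriv F F' 0 1)
    (hf : MemLp f 2 μI) : MemLp (fun x => F x * f x) 2 μI := by
  have hc := hF.continuousOn zero_le_one
  obtain ⟨C, hC⟩ := isCompact_Icc.exists_bound_of_continuousOn hc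
  refine hf.bounded_mul ((hc.mono Ioo_subset_Icc_self).aestronglyMeasurable measurableSet_Ioo) C ?_
  filter_upwards [ae_muI_mem] with x hx using hC x (Ioo_subset_Icc_self hx)

namespace IsAdmissible

variable {u u' : ℝ → ℝ}

theorem memLp_sub_mul (hu : IsAdmissible a x₀ K u u') (h : IsDegenerate a x₀ K) :
    MemLp (fun x => (x - x₀) * u' x) 2 μI := by
  refine (h.memLp_rootWeight_mul hu.weighted).ae_eq ?_
  filter_upwards [ae_muI_mem, ae_muI_ne x₀] with x hx hne
  linear_combination u' x * h.sqrt_mul_rootWeight hx hne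

theorem integrable_weighted (hu : IsAdmissible a x₀ K u u') (h : IsDegenerate a x₀ K)
    {v v' : ℝ → ℝ} (hv : IsAdmissible a x₀ K v v') :
    Integrable (fun x => a x * u' x * v' x) μI := by
  refine (hu.weighted.integrable_mul_two hv.weighted).congr ?_
  filter_upwards [ae_muI_mem] with x hx
  linear_combination u' x * v' x * Real.mul_self_sqrt (h.nonneg (Ioo_subset_Icc_self hx))

theorem integrable_quad (hu : IsAdmissible a x₀ K u u') (h : IsDegenerate a x₀ K) :
    Integrable (fun x => quadWeight a x₀ x * u x ^ 2) μI := by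
  refine ((h.memLp_quadWeight_mul hu.memLp).integrable_mul_two hu.memLp).congr
    (Eventually.of_forall fun x => ?_)
  ring

theorem integrable_sq (hu : IsAdmissible a x₀ K u u') : Integrable (fun x => u x ^ 2) μI :=
  hu.memLp.integrable_sq

/-- The function `((x - x₀) u²)'`. -/
theorem integrable_cross (hu : IsAdmissible a x₀ K u u') (h : IsDegenerate a x₀ K) :
    Integrable (fun x => u x ^ 2 + 2 * (x - x₀) * u x * u' x) μI := by
  refine (hu.integrable_sq.add
    (((hu.memLp_sub_mul h).integrable_mul_two hu.memLp).const_mul 2)).congr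
    (Eventually.of_forall fun x => ?_)
  simp only [Pi.add_apply]
  ring

theorem integrable_mul_cross (hu : IsAdmissible a x₀ K u u') (h : IsDegenerate a x₀ K)
    {F F' : ℝ → ℝ} (hF : HasACDeriv F F' 0 1) :
    Integrable (fun x => F x * (u x ^ 2 + 2 * (x - x₀) * u x * u' x)) μI := by
  have h1 := memLp_mul_of_hasACDeriv hF hu.memLp
  refine ((h1.integrable_mul_two hu.memLp).add
    ((h1.integrable_mul_two (hu.memLp_sub_mul h)).const_mul 2)).congr
    (Eventually.of_forall fun x => ?_)
  simp only [Pi.add_apply]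
  ring

theorem integrable_quad_cross (hu : IsAdmissible a x₀ K u u') (h : IsDegenerate a x₀ K) :
    Integrable (fun x => quadWeight a x₀ x * (u x ^ 2 + 2 * (x - x₀) * u x * u' x)) μI := by
  have h1 := h.memLp_quadWeight_mul hu.memLp
  refine ((h1.integrable_mul_two hu.memLp).add
    ((h1.integrable_mul_two (hu.memLp_sub_mul h)).const_mul 2)).congr
    (Eventually.of_forall fun x => ?_)
  simp only [Pi.add_apply]
  ring

theorem punctured_cross (hu : IsAdmissible a x₀ K u u') (hx₀ : x₀ ∈ Ioo (0 : ℝ) 1) :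
    HasPuncturedACDeriv x₀ (fun x => (x - x₀) * (u x * u x))
      fun x => 1 * (u x * u x) + (x - x₀) * (u' x * u x + u x * u' x) :=
  (IsDegenerate.hasPunctured_sub x₀ hx₀).mul (hu.punctured.mul hu.punctured)

/-- The integrand is the derivative of (x - x₀)u², which vanishes at 0 and 1 and is nonpositive to
the left of x₀, nonnegative to its right. -/
theorem integral_cross_nonpos (hu : IsAdmissible a x₀ K u u') (h : IsDegenerate a x₀ K) :
    ∫ x, u x ^ 2 + 2 * (x - x₀) * u x * u' x ∂μI ≤ 0 := by
  have h1 := (hu.punctured_cross h.x₀_mem).integral_le h.x₀_mem (hu.integrable_cross h)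
    (Eventually.of_forall fun x => by nlinarith)
    (fun x hx => by nlinarith [hx.2, mul_self_nonneg (u x)])
    (fun x hx => mul_nonneg (by linarith [hx.1]) (mul_self_nonneg _))
  simpa [hu.left, hu.right] using h1

/-- Differentiate b(x - x₀)u² and use b'(x - x₀) ≥ (2 - K)b. The sign of x - x₀ makes the
contribution at x₀ favourable. -/
theorem integral_quad_cross_le (hu : IsAdmissible a x₀ K u u') (h : IsDegenerate a x₀ K) :
    ∫ x, (2 - K) * (quadWeight a x₀ x * u x ^ 2) +
      quadWeight a x₀ x * (u x ^ 2 + 2 * (x - x₀) * u x * u' x) ∂μI ≤ 0 := by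
  obtain ⟨b', hb, hle⟩ := h.exists_quadWeight_deriv
  have h1 := (hb.mul (hu.punctured_cross h.x₀_mem)).integral_le
    (g := fun x => (2 - K) * (quadWeight a x₀ x * u x ^ 2) +
      quadWeight a x₀ x * (u x ^ 2 + 2 * (x - x₀) * u x * u' x)) h.x₀_mem
    (((hu.integrable_quad h).const_mul _).add (hu.integrable_quad_cross h)) ?_ ?_ ?_
  · simpa [hu.left, hu.right] using h1
  · filter_upwards [hle] with x hx
    nlinarith [mul_le_mul_of_nonneg_right hx (sq_nonneg (u x))]
  · intro x hx
    have h2 := h.quadWeight_nonneg (x := x) ⟨hx.1.le, (hx.2.trans h.x₀_mem.2).le⟩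
    exact mul_nonpos_of_nonneg_of_nonpos h2
      (mul_nonpos_of_nonpos_of_nonneg (by linarith [hx.2]) (mul_self_nonneg _))
  · intro x hx
    have h2 := h.quadWeight_nonneg (x := x) ⟨(h.x₀_mem.1.trans hx.1).le, hx.2.le⟩
    exact mul_nonneg h2 (mul_nonneg (by linarith [hx.1]) (mul_self_nonneg _))

/-- The integrand is the derivative of ψ(x - x₀)u². An equality is required because this term is
later multiplied by μ = sΘ', which has no sign. The primitive is at most C|x - x₀|u² in modulus, so
its limits at x₀ vanish. -/
theorem integral_psi_cross_eq (hu : IsAdmissible a x₀ K u u') (h : IsDegenerate a x₀ K)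
    (c₁ c₂ : ℝ) :
    ∫ x, c₁ * (quadWeight a x₀ x * u x ^ 2) +
      psi a x₀ c₁ c₂ x * (u x ^ 2 + 2 * (x - x₀) * u x * u' x) ∂μI = 0 := by
  have hψ := h.hasACDeriv_psi c₁ c₂
  obtain ⟨C, hC⟩ := isCompact_Icc.exists_bound_of_continuousOn (hψ.continuousOn zero_le_one)
  have h1 := (hψ.punctured h.x₀_mem).mul (hu.punctured_cross h.x₀_mem)
  have e : ∀ x, c₁ * linWeight a x₀ x * ((x - x₀) * (u x * u x)) + psi a x₀ c₁ c₂ x *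
      (1 * (u x * u x) + (x - x₀) * (u' x * u x + u x * u' x)) =
      c₁ * (quadWeight a x₀ x * u x ^ 2) +
        psi a x₀ c₁ c₂ x * (u x ^ 2 + 2 * (x - x₀) * u x * u' x) := fun x => by
    rw [IsDegenerate.quadWeight_eq]; ring
  have h2 := h1.integral_eq_of_pow_le (n := 1) (G := fun x => C * u x ^ 2) one_ne_zero h.x₀_mem
    ((((hu.integrable_quad h).const_mul c₁).add (hu.integrable_mul_cross h hψ)).congr
      (Eventually.of_forall fun x => (e x).symm)) (hu.integrable_sq.const_mul C) ?_
  · simp_rw [e] at h2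
    simpa [hu.left, hu.right] using h2
  · filter_upwards [ae_muI_mem] with x hx
    have h3 := hC x (Ioo_subset_Icc_self hx)
    rw [Real.norm_eq_abs] at h3
    rw [pow_one, abs_mul, abs_mul, abs_mul_self, ← sq]
    have h4 : 0 ≤ |x - x₀| * u x ^ 2 := by positivity
    nlinarith

variable {W W' y y' : ℝ → ℝ}

/-- Green's formula across the degeneracy point. -/
theorem integral_flux_deriv (hu : IsAdmissible a x₀ K u u') (h : IsDegenerate a x₀ K)
    (hW : HasACDeriv W W' 0 1) (hW' : MemLp W' 2 μI) (hWu : ∀ᵐ x ∂μI, W x = a x * u' x)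
    (hy : IsAdmissible a x₀ K y y') :
    Integrable (fun x => W' x * y x + a x * u' x * y' x) μI ∧
    ∫ x, W' x * y x + a x * u' x * y' x ∂μI = 0 := by
  have hx₀ := h.x₀_mem
  have hi : Integrable (fun x => W' x * y x + a x * u' x * y' x) μI :=
    (hW'.integrable_mul_two hy.memLp).add (hu.integrable_weighted h hy)
  have hp := ((hW.punctured hx₀).mul hy.punctured).congr_deriv hx₀
    (g' := fun x => W' x * y x + a x * u' x * y' x)
    (by filter_upwards [hWu] with x hx; rw [hx])
  refine ⟨hi, ?_⟩
  have hfin : W 1 * y 1 - W 0 * y 0 = 0 := by rw [hy.left, hy.right]; ring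
  rw [← hfin]
  have hWc : ContinuousAt W x₀ := (hW.continuousOn zero_le_one).continuousAt
    (Icc_mem_nhds hx₀.1 hx₀.2)
  rcases lt_or_ge K 1 with hK | hK
  · have h1 := hWc.mul (hy.continuousAt hK)
    exact hp.integral_eq_of_tendsto hx₀ hi (h1.tendsto.mono_left nhdsWithin_le_nhds)
      (h1.tendsto.mono_left nhdsWithin_le_nhds)
  · obtain ⟨L, hL⟩ := h.linear hK
    -- Near x₀, W² = a·(a u'²) ≤ L|x - x₀|·(a u'²) with a u'² integrable, which rules out a nonzero
    -- limit.
    have hW0 : W x₀ = 0 := by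
      have h1 := eq_zero_of_tendsto_of_le_abs_sub_mul (f := fun x => W x ^ 2)
        (G := fun x => L * (a x * u' x * u' x)) (exists_uIoo_subset_of_mem_nhdsGT hx₀) hx₀
        ((hWc.tendsto.mono_left nhdsWithin_le_nhds).pow 2)
        ((hu.integrable_weighted h hu).const_mul L) ?_
      · exact pow_eq_zero_iff two_ne_zero |>.1 h1
      · filter_upwards [hWu, ae_muI_mem] with x hx hx01
        have hmem := Ioo_subset_Icc_self hx01
        rw [hx, abs_of_nonneg (sq_nonneg _)]
        have h3 : 0 ≤ a x * u' x * u' x := by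
          rw [mul_assoc]; exact mul_nonneg (h.nonneg hmem) (mul_self_nonneg _)
        nlinarith [mul_le_mul_of_nonneg_right (hL x hmem) h3]
    have hWi : Integrable W' μI := hW'.integrable (by norm_num)
    have hW2 : Integrable (fun x => W' x ^ 2) μI := hW'.integrable_sq
    set C := ∫ x, W' x ^ 2 ∂μI with hC
    -- Cauchy–Schwarz starting from the zero of W at x₀. In the strong case y is only square
    -- integrable near x₀; this bound gives (Wy)² ≤ |x - x₀|·C y², so Wy still tends to zero.
    have hsq : ∀ x ∈ Ioo (0 : ℝ) 1, W x ^ 2 ≤ |x - x₀| * C := by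
      intro x hx
      have hx' := Ioo_subset_Icc_self hx
      have hx₀' := Ioo_subset_Icc_self hx₀
      have key : ∀ c ∈ Icc (0 : ℝ) 1, ∀ d ∈ Icc (0 : ℝ) 1, c ≤ d →
          (W d - W c) ^ 2 ≤ |d - c| * C := by
        intro c hc d hd hcd
        rw [← (hW.mono hc.1 hcd hd.2).integral_eq hcd, abs_of_nonneg (by linarith)]
        refine (sq_intervalIntegral_le (Integrable.intervalIntegrable_muI hWi hc hd)
          (Integrable.intervalIntegrable_muI hW2 hc hd)).trans ?_
        refine mul_le_mul_of_nonneg_left ?_ (by linarith)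
        rw [hC, integral_muI_eq_interval]
        exact intervalIntegral.integral_mono_interval hc.1 hcd hd.2
          (Eventually.of_forall fun x => sq_nonneg _)
          (Integrable.intervalIntegrable_muI hW2 (by simp) (by simp))
      rcases le_total x x₀ with hle | hle
      · have := key x hx' x₀ hx₀' hle
        rw [hW0, abs_sub_comm] at this
        linarith
      · have := key x₀ hx₀' x hx' hle
        rw [hW0] at this
        linarith
    refine hp.integral_eq_of_pow_le (n := 2) (G := fun x => C * y x ^ 2) two_ne_zero hx₀ hi
      (hy.integrable_sq.const_mul C) ?_
    filter_upwards [ae_muI_mem] with x hx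
    rw [sq_abs, mul_pow, ← mul_assoc]
    exact mul_le_mul_of_nonneg_right (hsq x hx) (sq_nonneg _)

theorem integrable_sub_mul_flux_deriv (hu : IsAdmissible a x₀ K u u') (h : IsDegenerate a x₀ K)
    (hW' : MemLp W' 2 μI) : Integrable (fun x => (x - x₀) * u' x * W' x) μI :=
  (hu.memLp_sub_mul h).integrable_mul_two hW'

/-- With m = (x - x₀)/a, the derivative of mW² is m'(a u')² + 2(x - x₀)u'W', and m'a ≥ 1 - K. Since
mW² has the sign of x - x₀, its behaviour at x₀ needs no analysis. -/
theorem integral_sub_mul_flux_deriv_le (hu : IsAdmissible a x₀ K u u') (h : IsDegenerate a x₀ K)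
    (hW : HasACDeriv W W' 0 1) (hW' : MemLp W' 2 μI) (hWu : ∀ᵐ x ∂μI, W x = a x * u' x) :
    ∫ x, (1 - K) * (a x * u' x * u' x) + 2 * ((x - x₀) * u' x * W' x) ∂μI ≤
      linWeight a x₀ 1 * W 1 ^ 2 - linWeight a x₀ 0 * W 0 ^ 2 := by
  have hx₀ := h.x₀_mem
  obtain ⟨m', hm, hle⟩ := h.exists_linWeight_deriv
  have hp := hm.mul ((hW.punctured hx₀).mul (hW.punctured hx₀))
  have h1 := hp.integral_le
    (g := fun x => (1 - K) * (a x * u' x * u' x) + 2 * ((x - x₀) * u' x * W' x)) hx₀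
    (((hu.integrable_weighted h hu).const_mul _).add
      ((hu.integrable_sub_mul_flux_deriv h hW').const_mul 2)) ?_ ?_ ?_
  · simpa only [sq] using h1
  · filter_upwards [hle, hWu, ae_muI_mem, ae_muI_ne x₀] with x hx hWx hx01 hne
    have ha := h.pos x (Ioo_subset_Icc_self hx01) hne
    have e : linWeight a x₀ x * (a x * u' x) = (x - x₀) * u' x := by
      rw [linWeight]; field_simp
    have h3 : 0 ≤ a x * u' x * u' x := by
      rw [mul_assoc]; exact mul_nonneg ha.le (mul_self_nonneg _)
    rw [hWx]
    have h4 := mul_le_mul_of_nonneg_right hx h3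
    have e2 : linWeight a x₀ x * (W' x * (a x * u' x) + a x * u' x * W' x) =
        2 * ((x - x₀) * u' x * W' x) := by linear_combination 2 * W' x * e
    rw [e2]
    nlinarith
  · intro x hx
    exact mul_nonpos_of_nonpos_of_nonneg (h.linWeight_nonpos hx.2.le hx.1.le) (mul_self_nonneg _)
  · intro x hx
    exact mul_nonneg (h.linWeight_nonneg hx.1.le hx.2.le) (mul_self_nonneg _)

end IsAdmissible

end
end DegenerateParabolic

/-! ### The conjugated operator at a fixed time and the interpolation inequality -/

namespace DegenerateParabolic

section

variable {a : ℝ → ℝ} {x₀ K : ℝ} {u u' W W' y y' : ℝ → ℝ}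

theorem IsDegenerate.integrable_potential_mul (h : IsDegenerate a x₀ K) {f g : ℝ → ℝ}
    (hf : MemLp f 2 μI) (hg : MemLp g 2 μI) (κ μ c₁ c₂ : ℝ) :
    Integrable (fun x => (κ ^ 2 * quadWeight a x₀ x - μ * psi a x₀ c₁ c₂ x) * f x * g x) μI := by
  refine ((((h.memLp_quadWeight_mul hf).integrable_mul_two hg).const_mul (κ ^ 2)).sub
    (((memLp_mul_of_hasACDeriv (h.hasACDeriv_psi c₁ c₂) hf).integrable_mul_two hg).const_mul
      μ)).congr (Eventually.of_forall fun x => ?_)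
  simp only [Pi.sub_apply]
  ring

/-- The product of the symmetric and the antisymmetric part of the conjugated operator, at a fixed
time. -/
theorem IsAdmissible.le_integral_conjugated (hu : IsAdmissible a x₀ K u u')
    (h : IsDegenerate a x₀ K) (hW : HasACDeriv W W' 0 1) (hW' : MemLp W' 2 μI)
    (hWu : ∀ᵐ x ∂μI, W x = a x * u' x) (hy : IsAdmissible a x₀ K y y') {κ : ℝ} (hκ : 0 ≤ κ)
    (μ c₁ c₂ : ℝ) :
    (∫ x, -(a x * u' x * y' x) +
        (κ ^ 2 * quadWeight a x₀ x - μ * psi a x₀ c₁ c₂ x) * u x * y x ∂μI) +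
      κ * (2 - K) * (∫ x, a x * u' x * u' x ∂μI) -
      κ * (linWeight a x₀ 1 * W 1 ^ 2 - linWeight a x₀ 0 * W 0 ^ 2) +
      (κ ^ 3 * (2 - K) - κ * μ * c₁) * ∫ x, quadWeight a x₀ x * u x ^ 2 ∂μI ≤
    ∫ x, (W' x + (κ ^ 2 * quadWeight a x₀ x - μ * psi a x₀ c₁ c₂ x) * u x) *
      (y x - 2 * κ * ((x - x₀) * u' x) - κ * u x) ∂μI := by
  obtain ⟨i1, e1⟩ := hu.integral_flux_deriv h hW hW' hWu hy
  obtain ⟨i2, e2⟩ := hu.integral_flux_deriv h hW hW' hWu hu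
  have e3 := hu.integral_sub_mul_flux_deriv_le h hW hW' hWu
  have i3 : Integrable (fun x => (1 - K) * (a x * u' x * u' x) +
      2 * ((x - x₀) * u' x * W' x)) μI := ((hu.integrable_weighted h hu).const_mul _).add
      ((hu.integrable_sub_mul_flux_deriv h hW').const_mul 2)
  have e4 := hu.integral_quad_cross_le h
  have i4 : Integrable (fun x => (2 - K) * (quadWeight a x₀ x * u x ^ 2) +
      quadWeight a x₀ x * (u x ^ 2 + 2 * (x - x₀) * u x * u' x)) μI :=
    ((hu.integrable_quad h).const_mul _).add (hu.integrable_quad_cross h)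
  have e5 := hu.integral_psi_cross_eq h c₁ c₂
  have i5 : Integrable (fun x => c₁ * (quadWeight a x₀ x * u x ^ 2) +
      psi a x₀ c₁ c₂ x * (u x ^ 2 + 2 * (x - x₀) * u x * u' x)) μI :=
    ((hu.integrable_quad h).const_mul c₁).add
      (hu.integrable_mul_cross h (h.hasACDeriv_psi c₁ c₂))
  have i6 := hu.integrable_weighted h hu
  have i7 := hu.integrable_quad h
  have i0 : Integrable (fun x => -(a x * u' x * y' x) +
      (κ ^ 2 * quadWeight a x₀ x - μ * psi a x₀ c₁ c₂ x) * u x * y x) μI :=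
    (hu.integrable_weighted h hy).neg.add
      (h.integrable_potential_mul hu.memLp hy.memLp κ μ c₁ c₂)
  set D := fun x => -(a x * u' x * y' x) +
      (κ ^ 2 * quadWeight a x₀ x - μ * psi a x₀ c₁ c₂ x) * u x * y x
  set g1 := fun x => W' x * y x + a x * u' x * y' x
  set g2 := fun x => W' x * u x + a x * u' x * u' x
  set g3 := fun x => (1 - K) * (a x * u' x * u' x) + 2 * ((x - x₀) * u' x * W' x)
  set g4 := fun x => (2 - K) * (quadWeight a x₀ x * u x ^ 2) +
      quadWeight a x₀ x * (u x ^ 2 + 2 * (x - x₀) * u x * u' x)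
  set g5 := fun x => c₁ * (quadWeight a x₀ x * u x ^ 2) +
      psi a x₀ c₁ c₂ x * (u x ^ 2 + 2 * (x - x₀) * u x * u' x)
  set g6 := fun x => a x * u' x * u' x
  set g7 := fun x => quadWeight a x₀ x * u x ^ 2
  -- Each gᵢ with i ≤ 5 has an integral that is zero or has a known bound. The coefficient 2 - K of
  -- `g6` arises as 1 from -κuW' through `g2`, plus 1 - K from -2κ(x - x₀)u'W' through `g3`. The
  -- coefficient of `g7` collects what is added to make `g4` and `g5` from the potential terms.
  have key : ∀ x, (W' x + (κ ^ 2 * quadWeight a x₀ x - μ * psi a x₀ c₁ c₂ x) * u x) *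
      (y x - 2 * κ * ((x - x₀) * u' x) - κ * u x) =
      D x + g1 x + (-κ) * g2 x + (-κ) * g3 x + κ * (2 - K) * g6 x + (-κ ^ 3) * g4 x +
        (κ * μ) * g5 x + (κ ^ 3 * (2 - K) - κ * μ * c₁) * g7 x := fun x => by
    simp only [D, g1, g2, g3, g4, g5, g6, g7]; ring
  have hsum : ∫ x, D x + g1 x + (-κ) * g2 x + (-κ) * g3 x + κ * (2 - K) * g6 x +
      (-κ ^ 3) * g4 x + (κ * μ) * g5 x + (κ ^ 3 * (2 - K) - κ * μ * c₁) * g7 x ∂μI =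
      ∫ x, D x ∂μI + ∫ x, g1 x ∂μI + (-κ) * ∫ x, g2 x ∂μI + (-κ) * ∫ x, g3 x ∂μI +
      κ * (2 - K) * ∫ x, g6 x ∂μI + (-κ ^ 3) * ∫ x, g4 x ∂μI + (κ * μ) * ∫ x, g5 x ∂μI +
      (κ ^ 3 * (2 - K) - κ * μ * c₁) * ∫ x, g7 x ∂μI := by
    clear_value D g1 g2 g3 g4 g5 g6 g7
    rw [integral_add (by fun_prop) (by fun_prop), integral_add (by fun_prop) (by fun_prop),
      integral_add (by fun_prop) (by fun_prop), integral_add (by fun_prop) (by fun_prop),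
      integral_add (by fun_prop) (by fun_prop), integral_add (by fun_prop) (by fun_prop),
      integral_add (by fun_prop) (by fun_prop)]
    simp only [integral_const_mul]
  rw [integral_congr_ae (Eventually.of_forall key), hsum]
  rw [e1, e2, e5]
  have h3 := mul_le_mul_of_nonneg_left e3 hκ
  have h4 := mul_le_mul_of_nonneg_left e4 (pow_nonneg hκ 3)
  linarith

/-- An interpolation inequality that replaces the Hardy–Poincaré inequality. -/
theorem IsAdmissible.integral_sq_le (hu : IsAdmissible a x₀ K u u') (h : IsDegenerate a x₀ K)
    {r : ℝ} (hr : 0 < r) :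
    ∫ x, u x ^ 2 ∂μI ≤
      r * (∫ x, a x * u' x * u' x ∂μI) + r⁻¹ * ∫ x, quadWeight a x₀ x * u x ^ 2 ∂μI := by
  have i6 := hu.integrable_weighted h hu
  have i7 := hu.integrable_quad h
  have i1 := hu.integrable_cross h
  have h1 : ∫ x, u x ^ 2 ∂μI ≤ ∫ x, (u x ^ 2 + 2 * (x - x₀) * u x * u' x) +
      (r * (a x * u' x * u' x) + r⁻¹ * (quadWeight a x₀ x * u x ^ 2)) ∂μI := by
    refine integral_mono_ae hu.integrable_sq (by fun_prop) ?_
    filter_upwards [ae_muI_mem, ae_muI_ne x₀] with x hx hne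
    have ha := h.pos x (Ioo_subset_Icc_self hx) hne
    -- Young's inequality for 2(x - x₀)uu' in the form of a completed square; the integral of u² +
    -- 2(x - x₀)uu' is nonpositive.
    have e : r * (a x * u' x * u' x) + r⁻¹ * (quadWeight a x₀ x * u x ^ 2) +
        2 * (x - x₀) * u x * u' x = (r * a x * u' x + (x - x₀) * u x) ^ 2 / (r * a x) := by
      rw [quadWeight]; field_simp; ring
    have : 0 ≤ (r * a x * u' x + (x - x₀) * u x) ^ 2 / (r * a x) := by positivity
    linarith
  rw [integral_add i1 (by fun_prop), integral_add (i6.const_mul r) (i7.const_mul r⁻¹),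
    integral_const_mul, integral_const_mul] at h1
  linarith [hu.integral_cross_nonpos h]

/-- Multiplication of admissible functions by a regular function. -/
theorem IsAdmissible.mul_regular (hu : IsAdmissible a x₀ K u u') (h : IsDegenerate a x₀ K)
    {F : ℝ → ℝ} {G G' : ℝ → ℝ} (hF : HasACDeriv F (fun x => G x * linWeight a x₀ x) 0 1)
    (hG : HasACDeriv G G' 0 1) :
    IsAdmissible a x₀ K (fun x => F x * u x)
      (fun x => G x * linWeight a x₀ x * u x + F x * u' x) where
  punctured := (hF.punctured h.x₀_mem).mul hu.punctured
  memLp := memLp_mul_of_hasACDeriv hF hu.memLp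
  weighted := by
    -- F' may be unbounded at x₀, but only through the linear weight, and √a times that is the
    -- bounded weight (x - x₀)/√a.
    refine ((memLp_mul_of_hasACDeriv hG (h.memLp_rootWeight_mul hu.memLp)).add
      (memLp_mul_of_hasACDeriv hF hu.weighted)).ae_eq ?_
    filter_upwards [ae_muI_mem, ae_muI_ne x₀] with x hx hne
    have ha := Real.sqrt_pos.2 (h.pos x (Ioo_subset_Icc_self hx) hne)
    have e : √(a x) * linWeight a x₀ x = rootWeight a x₀ x := by
      rw [linWeight, rootWeight]
      nth_rewrite 2 [← Real.mul_self_sqrt (h.nonneg (Ioo_subset_Icc_self hx))]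
      field_simp
    simp only [Pi.add_apply]
    linear_combination -G x * u x * e
  left := by simp [hu.left]
  right := by simp [hu.right]
  continuousAt hK := by
    have h1 := (hF.continuousOn zero_le_one).continuousAt
      (Icc_mem_nhds h.x₀_mem.1 h.x₀_mem.2)
    exact h1.mul (hu.continuousAt hK)

theorem IsAdmissible.add (hu : IsAdmissible a x₀ K u u') (hy : IsAdmissible a x₀ K y y') :
    IsAdmissible a x₀ K (fun x => u x + y x) (fun x => u' x + y' x) where
  punctured := hu.punctured.add hy.punctured
  memLp := hu.memLp.add hy.memLp
  weighted := (hu.weighted.add hy.weighted).ae_eq (Eventually.of_forall fun x => by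
    simp only [Pi.add_apply]; ring)
  left := by simp [hu.left, hy.left]
  right := by simp [hu.right, hy.right]
  continuousAt hK := (hu.continuousAt hK).add (hy.continuousAt hK)

end
end DegenerateParabolic

/-! ### The Carleman inequality at a fixed time -/

namespace DegenerateParabolic

theorem _root_.AbsolutelyContinuousOnInterval.congr {f g : ℝ → ℝ} {c d : ℝ}
    (hf : AbsolutelyContinuousOnInterval f c d) (hfg : EqOn f g (uIcc c d)) :
    AbsolutelyContinuousOnInterval g c d := by
  rw [absolutelyContinuousOnInterval_iff] at hf ⊢
  intro ε hε
  obtain ⟨δ, hδ, h⟩ := hf ε hε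
  refine ⟨δ, hδ, fun E hE hEδ => ?_⟩
  have hE' : ∀ i ∈ Finset.range E.1, (E.2 i).1 ∈ uIcc c d ∧ (E.2 i).2 ∈ uIcc c d := hE.1
  refine lt_of_eq_of_lt (Finset.sum_congr rfl fun i hi => ?_) (h E hE hEδ)
  rw [hfg (hE' i hi).1, hfg (hE' i hi).2]

theorem HasACDeriv.congr {f f' g : ℝ → ℝ} {c d : ℝ} (hcd : c ≤ d) (hf : HasACDeriv f f' c d)
    (hfg : EqOn f g (Icc c d)) : HasACDeriv g f' c d where
  ac := hf.ac.congr (by rwa [uIcc_of_le hcd])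
  deriv := by
    filter_upwards [hf.deriv] with x hx hx'
    refine (hx hx').congr_of_eventuallyEq ?_
    filter_upwards [Icc_mem_nhds hx'.1 hx'.2] with z hz using (hfg hz).symm

/-- Removal of the singularity. -/
theorem HasPuncturedACDeriv.hasACDeriv {x₀ : ℝ} {f f' : ℝ → ℝ} (hf : HasPuncturedACDeriv x₀ f f')
    (hx₀ : x₀ ∈ Ioo (0 : ℝ) 1) (hf' : Integrable f' μI) (hc : ContinuousAt f x₀) :
    HasACDeriv f f' 0 1 := by
  have hx : x₀ ∈ Icc (0 : ℝ) 1 := Ioo_subset_Icc_self hx₀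
  have hi : ∀ c ∈ Icc (0 : ℝ) 1, ∀ d ∈ Icc (0 : ℝ) 1, IntervalIntegrable f' volume c d :=
    fun c hc d hd => Integrable.intervalIntegrable_muI hf' hc hd
  have h1 := tendsto_nhds_unique (hc.tendsto.mono_left nhdsWithin_le_nhds)
    (tendsto_of_hasACDeriv_left hx₀.1 hf.left (hi _ (by simp) _ hx))
  have h2 := tendsto_nhds_unique (hc.tendsto.mono_left nhdsWithin_le_nhds)
    (tendsto_of_hasACDeriv_right hx₀.2 hf.right (hi _ hx _ (by simp)))
  refine (HasACDeriv.of_integral (r := f 0) zero_le_one (hi 0 (by simp) 1 (by simp))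
    (left_mem_Icc.2 zero_le_one)).congr zero_le_one fun x hx' => ?_
  show f 0 + ∫ y in (0 : ℝ)..x, f' y = f x
  rcases lt_trichotomy x x₀ with hlt | rfl | hgt
  · rw [(hf.left x ⟨hx'.1, hlt⟩).integral_eq hx'.1]; ring
  · exact h1.symm
  · have h3 := (hf.right x ⟨hgt, hx'.2⟩).integral_eq hx'.2
    have h4 := intervalIntegral.integral_add_adjacent_intervals (hi 0 (by simp) x₀ hx)
      (hi x₀ hx x hx')
    have h5 := intervalIntegral.integral_add_adjacent_intervals (hi x₀ hx x hx')
      (hi x hx' 1 (by simp))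
    linarith

section

variable {a : ℝ → ℝ} {x₀ K : ℝ} {v v' z z' g q : ℝ → ℝ}

/-- In the strong case v may be singular at x₀, but (x - x₀)²v² ≤ |x - x₀|v² forces (x - x₀)v to
tend to zero, its value at x₀. This makes the conjugated flux e^{sφ}(a v_x + κ(x - x₀)v) absolutely
continuous across x₀. -/
theorem IsAdmissible.hasACDeriv_sub_mul (hv : IsAdmissible a x₀ K v v')
    (h : IsDegenerate a x₀ K) :
    HasACDeriv (fun x => (x - x₀) * v x) (fun x => v x + (x - x₀) * v' x) 0 1 := by
  have hx₀ := h.x₀_mem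
  have hx : x₀ ∈ Icc (0 : ℝ) 1 := Ioo_subset_Icc_self hx₀
  have hp := ((IsDegenerate.hasPunctured_sub x₀ hx₀).mul hv.punctured).congr_deriv hx₀
    (g' := fun x => v x + (x - x₀) * v' x) (Eventually.of_forall fun x => by ring)
  have hi : Integrable (fun x => v x + (x - x₀) * v' x) μI :=
    (hv.memLp.add (hv.memLp_sub_mul h)).integrable (by norm_num)
  refine hp.hasACDeriv hx₀ hi ?_
  have hle : ∀ᵐ x ∂μI, |((x - x₀) * v x) ^ 2| ≤ |x - x₀| * v x ^ 2 := by
    filter_upwards [ae_muI_mem] with x hx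
    have h1 : |x - x₀| ≤ 1 := by
      rw [abs_le]; constructor <;> linarith [hx.1, hx.2, hx₀.1, hx₀.2]
    rw [abs_of_nonneg (sq_nonneg _), mul_pow, ← sq_abs (x - x₀)]
    gcongr
    nlinarith [abs_nonneg (x - x₀)]
  have hl := tendsto_of_hasACDeriv_left hx₀.1 hp.left
    (Integrable.intervalIntegrable_muI hi (by simp) hx)
  have hr := tendsto_of_hasACDeriv_right hx₀.2 hp.right
    (Integrable.intervalIntegrable_muI hi hx (by simp))
  have h1 := eq_zero_of_tendsto_of_le_abs_sub_mul (exists_uIoo_subset_of_mem_nhdsLT hx₀) hx₀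
    (hl.pow 2) hv.integrable_sq hle
  have h2 := eq_zero_of_tendsto_of_le_abs_sub_mul (exists_uIoo_subset_of_mem_nhdsGT hx₀) hx₀
    (hr.pow 2) hv.integrable_sq hle
  rw [pow_eq_zero_iff two_ne_zero] at h1 h2
  rw [h1] at hl
  rw [h2] at hr
  rw [continuousAt_iff_continuous_left'_right']
  constructor
  · simpa [ContinuousWithinAt] using hl
  · simpa [ContinuousWithinAt] using hr

theorem IsDegenerate.hasACDeriv_exp_psi (h : IsDegenerate a x₀ K) (c₁ c₂ l : ℝ) :
    HasACDeriv (fun x => Real.exp (l * psi a x₀ c₁ c₂ x))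
      (fun x => (c₁ * l * Real.exp (l * psi a x₀ c₁ c₂ x)) * linWeight a x₀ x) 0 1 :=
  (((h.hasACDeriv_psi c₁ c₂).const_mul l).exp zero_le_one).congr_deriv
    (Eventually.of_forall fun x _ => by ring)

/-- The density of the time derivative of the quadratic form
`e^{2lψ} (-a v_x²/2 - c₁ l (x - x₀) v_x v - μ ψ v²/2)`, where `l`, `μ` have the time derivatives
`μ`, `ρ`, and `v` has the time derivative `z`. -/
noncomputable def derivDensity (a : ℝ → ℝ) (x₀ c₁ c₂ l μ ρ : ℝ) (v v' z z' : ℝ → ℝ) (x : ℝ) : ℝ :=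
  Real.exp (2 * l * psi a x₀ c₁ c₂ x) *
    (2 * (μ * psi a x₀ c₁ c₂ x) * (-(1 / 2) * (a x * v' x * v' x) -
        c₁ * l * ((x - x₀) * v' x * v x) - 1 / 2 * (μ * psi a x₀ c₁ c₂ x) * v x ^ 2) -
      a x * v' x * z' x - c₁ * μ * ((x - x₀) * v' x * v x) -
      c₁ * l * ((x - x₀) * z' x * v x + (x - x₀) * v' x * z x) -
      1 / 2 * ρ * psi a x₀ c₁ c₂ x * v x ^ 2 - μ * psi a x₀ c₁ c₂ x * v x * z x)

theorem mul_le_half_add_sq (x y : ℝ) : x * y ≤ 1 / 2 * (x + y) ^ 2 := by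
  nlinarith [sq_nonneg x, sq_nonneg y]

/-- X, Y and N stand for ∫a w_x², ∫b w² and ∫w², and I for ∫ψw². The term with ρ costs half of the X
term and a quarter of the Y term; the term with μ costs another quarter of the Y term. The two
summands in the lower bound for s pay for the μ and the ρ term respectively. -/
theorem absorb_lower_order {X Y N I c₁ k s θ μ ρ M P : ℝ} (hY : 0 ≤ Y)
    (hN : ∀ r > 0, N ≤ r * X + r⁻¹ * Y) (hI : |I| ≤ P * N) (hc₁ : 0 < c₁) (hk : 0 < k)
    (hθ : 0 < θ) (hM : 0 < M) (hP : 0 < P) (hμ : |μ| ≤ s * M * θ ^ 2)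
    (hρ : |ρ| ≤ s * M * θ ^ 2) (hs : 8 * M / (c₁ * k) + 2 * M * P / (c₁ ^ 2 * k) ≤ s) :
    c₁ * k / 2 * (s * θ * X) + c₁ ^ 3 * k / 2 * (s ^ 3 * θ ^ 3 * Y) ≤
      1 / 2 * ρ * I + c₁ * (s * θ) * k * X +
        ((c₁ * (s * θ)) ^ 3 * k - 2 * (c₁ * (s * θ)) * μ * c₁) * Y := by
  have hp1 : 0 < 8 * M / (c₁ * k) := by positivity
  have hp2 : 0 < 2 * M * P / (c₁ ^ 2 * k) := by positivity
  have hs0 : 0 < s := by linarith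
  have hs1 : 8 * M ≤ s * (c₁ * k) := by rw [← div_le_iff₀ (by positivity)]; linarith
  have hs2 : 2 * M * P ≤ s * (c₁ ^ 2 * k) := by rw [← div_le_iff₀ (by positivity)]; linarith
  -- This r makes the X part of (sMθ²/2)PN equal to c₁k/2·sθX; its inverse supplies the extra θ that
  -- turns the Y part into θ³.
  have hr := hN (c₁ * k / (M * P) / θ) (by positivity)
  have h1 : |1 / 2 * ρ * I| ≤ c₁ * k / 2 * (s * θ * X) + c₁ ^ 3 * k / 4 * (s ^ 3 * θ ^ 3 * Y) := by
    have e1 : |1 / 2 * ρ * I| = 1 / 2 * |ρ| * |I| := by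
      rw [abs_mul, abs_mul, abs_of_pos (by norm_num : (0 : ℝ) < 1 / 2)]
    rw [e1]
    calc 1 / 2 * |ρ| * |I| ≤ 1 / 2 * (s * M * θ ^ 2) * (P * N) := by gcongr
      _ ≤ 1 / 2 * (s * M * θ ^ 2) * (P * (c₁ * k / (M * P) / θ * X +
            (c₁ * k / (M * P) / θ)⁻¹ * Y)) := by gcongr
      _ = c₁ * k / 2 * (s * θ * X) + M ^ 2 * P ^ 2 / (2 * (c₁ * k)) * (s * θ ^ 3 * Y) := by
          field_simp
      _ ≤ _ := by
          have e2 : M ^ 2 * P ^ 2 / (2 * (c₁ * k)) ≤ c₁ ^ 3 * k / 4 * s ^ 2 := by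
            rw [div_le_iff₀ (by positivity)]
            have := mul_self_le_mul_self (by positivity) hs2
            nlinarith
          have e3 := mul_le_mul_of_nonneg_right e2 (by positivity : 0 ≤ s * θ ^ 3 * Y)
          nlinarith
  have h2 : 2 * (c₁ * (s * θ)) * μ * c₁ * Y ≤ c₁ ^ 3 * k / 4 * (s ^ 3 * θ ^ 3 * Y) := by
    calc 2 * (c₁ * (s * θ)) * μ * c₁ * Y ≤ 2 * (c₁ * (s * θ)) * (s * M * θ ^ 2) * c₁ * Y := by
          gcongr; exact (le_abs_self _).trans hμ
      _ = c₁ ^ 2 / 4 * (8 * M) * (s ^ 2 * θ ^ 3 * Y) := by ring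
      _ ≤ c₁ ^ 2 / 4 * (s * (c₁ * k)) * (s ^ 2 * θ ^ 3 * Y) := by gcongr
      _ = _ := by ring
  have h3 := (abs_le.1 h1).1
  nlinarith

set_option maxHeartbeats 1000000 in
/-- The Carleman inequality at a fixed time, with the time derivative of a quadratic form as
remainder. -/
theorem IsAdmissible.carleman_fixed_time (hv : IsAdmissible a x₀ K v v') (h : IsDegenerate a x₀ K)
    (hg : HasACDeriv g q 0 1) (hq : MemLp q 2 μI) (hgv : ∀ᵐ x ∂μI, g x = a x * v' x)
    (hz : IsAdmissible a x₀ K z z') {c₁ c₂ s θ μ ρ M P : ℝ} (hc₁ : 0 < c₁)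
    (hψ : ∀ x ∈ Icc (0 : ℝ) 1, |psi a x₀ c₁ c₂ x| ≤ P) (hθ : 0 < θ) (hM : 0 < M) (hP : 0 < P)
    (hμ : |μ| ≤ s * M * θ ^ 2) (hρ : |ρ| ≤ s * M * θ ^ 2)
    (hs : 8 * M / (c₁ * (2 - K)) + 2 * M * P / (c₁ ^ 2 * (2 - K)) ≤ s) :
    min (c₁ * (2 - K) / 4) (c₁ ^ 3 * (2 - K) / 2 / (2 * c₁ ^ 2 + 1)) *
      (∫ x, (s * θ * (a x * v' x * v' x) + s ^ 3 * θ ^ 3 * (quadWeight a x₀ x * v x ^ 2)) *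
        Real.exp (2 * (s * θ) * psi a x₀ c₁ c₂ x) ∂μI) ≤
    1 / 2 * (∫ x, Real.exp (2 * (s * θ) * psi a x₀ c₁ c₂ x) * (z x + q x) ^ 2 ∂μI) -
      (∫ x, derivDensity a x₀ c₁ c₂ (s * θ) μ ρ v v' z z' x ∂μI) +
      s * c₁ * (θ * (linWeight a x₀ 1 * Real.exp (2 * (s * θ) * psi a x₀ c₁ c₂ 1) * g 1 ^ 2 -
        linWeight a x₀ 0 * Real.exp (2 * (s * θ) * psi a x₀ c₁ c₂ 0) * g 0 ^ 2)) := by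
  have hk : 0 < 2 - K := by linarith [h.lt_two]
  have hs0 : 0 < s := lt_of_lt_of_le (by positivity) hs
  set l := s * θ with hl
  set κ := c₁ * l with hκ
  have hκ0 : 0 ≤ κ := by positivity
  set ψ := psi a x₀ c₁ c₂ with hψdef
  set E := fun x => Real.exp (l * ψ x) with hE
  have hEe : ∀ x, Real.exp (2 * l * ψ x) = E x ^ 2 := fun x => by
    rw [hE, ← Real.exp_nat_mul]; congr 1; push_cast; ring
  have hEAC : HasACDeriv E (fun x => (κ * E x) * linWeight a x₀ x) 0 1 :=
    h.hasACDeriv_exp_psi c₁ c₂ l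
  -- The conjugated function w = e^{sφ}v.
  have hw := hv.mul_regular h hEAC (hEAC.const_mul κ)
  have hψAC : HasACDeriv (fun x => μ * ψ x) (fun x => (μ * c₁) * linWeight a x₀ x) 0 1 :=
    ((h.hasACDeriv_psi c₁ c₂).const_mul μ).congr_deriv (Eventually.of_forall fun x _ => by ring)
  have hconst : HasACDeriv (fun _ : ℝ => μ * c₁) (fun _ => 0) 0 1 :=
    HasACDeriv.of_contDiff contDiff_const fun x => hasDerivAt_const x _
  -- This is w_t = e^{sφ}(v_t + sφ_t v), with sφ_t = μψ. It is admissible because v_t is, which is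
  -- what Green's formula against w_t requires.
  have hy := (hz.add (hv.mul_regular h hψAC hconst)).mul_regular h hEAC (hEAC.const_mul κ)
  have hm : ∀ᵐ x ∂μI, a x * linWeight a x₀ x = x - x₀ ∧
      linWeight a x₀ x * (x - x₀) = quadWeight a x₀ x := by
    filter_upwards [ae_muI_mem, ae_muI_ne x₀] with x hx hne
    have ha := h.pos x (Ioo_subset_Icc_self hx) hne
    exact ⟨by rw [linWeight]; field_simp, (IsDegenerate.quadWeight_eq x).symm⟩
  -- The derivative of a w_x, arranged so that the weights multiplying v and v_x give square
  -- integrable terms; the possibly unbounded (x - x₀)/a does not appear alone.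
  set W' := fun x => E x * (q x + 2 * κ * ((x - x₀) * v' x) + κ ^ 2 * (quadWeight a x₀ x * v x) +
    κ * v x) with hW'def
  have hW : HasACDeriv (fun x => E x * (g x + κ * ((x - x₀) * v x))) W' 0 1 := by
    refine (hEAC.mul (hg.add ((hv.hasACDeriv_sub_mul h).const_mul κ))).congr_deriv ?_
    rw [← ae_muI_iff]
    filter_upwards [hm, hgv] with x hx hgx
    simp only [hW'def]
    rw [hgx, ← hx.2]
    linear_combination κ * E x * v' x * hx.1
  have hW'2 : MemLp W' 2 μI := memLp_mul_of_hasACDeriv hEAC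
    (((hq.add ((hv.memLp_sub_mul h).const_mul (2 * κ))).add
      ((h.memLp_quadWeight_mul hv.memLp).const_mul (κ ^ 2))).add (hv.memLp.const_mul κ))
  have hWw : ∀ᵐ x ∂μI, E x * (g x + κ * ((x - x₀) * v x)) =
      a x * (κ * E x * linWeight a x₀ x * v x + E x * v' x) := by
    filter_upwards [hm, hgv] with x hx hgx
    rw [hgx]
    linear_combination -κ * E x * v x * hx.1
  have key := hw.le_integral_conjugated h hW hW'2 hWw hy hκ0 μ c₁ c₂
  set w := fun x => E x * v x with hwdef
  set w' := fun x => κ * E x * linWeight a x₀ x * v x + E x * v' x with hw'def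
  set X := ∫ x, a x * w' x * w' x ∂μI with hX
  set Y := ∫ x, quadWeight a x₀ x * w x ^ 2 ∂μI with hY
  have iX := hw.integrable_weighted h hw
  have iY := hw.integrable_quad h
  have hX0 : 0 ≤ X := integral_nonneg_of_ae (by
    filter_upwards [ae_muI_mem] with x hx
    have := h.nonneg (Ioo_subset_Icc_self hx)
    rw [Pi.zero_apply, mul_assoc]
    exact mul_nonneg this (mul_self_nonneg _))
  have hY0 : 0 ≤ Y := integral_nonneg_of_ae (by
    filter_upwards [ae_muI_mem] with x hx
    exact mul_nonneg (h.quadWeight_nonneg (Ioo_subset_Icc_self hx)) (sq_nonneg _))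
  have iN := hw.integrable_sq
  have iI : Integrable (fun x => ψ x * w x ^ 2) μI :=
    ((memLp_mul_of_hasACDeriv (h.hasACDeriv_psi c₁ c₂) hw.memLp).integrable_mul_two
      hw.memLp).congr (Eventually.of_forall fun x => by simp only [hwdef]; ring)
  have hI : |∫ x, ψ x * w x ^ 2 ∂μI| ≤ P * ∫ x, w x ^ 2 ∂μI := by
    rw [← integral_const_mul, ← Real.norm_eq_abs]
    refine norm_integral_le_of_norm_le (iN.const_mul P) ?_
    filter_upwards [ae_muI_mem] with x hx
    rw [norm_mul, Real.norm_eq_abs, Real.norm_of_nonneg (sq_nonneg _)]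
    exact mul_le_mul_of_nonneg_right (hψ x (Ioo_subset_Icc_self hx)) (sq_nonneg _)
  have habs := absorb_lower_order hY0 (fun r hr => hw.integral_sq_le h hr) hI hc₁ hk hθ hM hP
    hμ hρ hs
  rw [← hl, ← hκ, ← hX] at habs
  -- the product of the two parts of the operator is controlled by the source
  have hright : ∫ x, (W' x + (κ ^ 2 * quadWeight a x₀ x - μ * ψ x) * w x) *
      (E x * (z x + μ * ψ x * v x) - 2 * κ * ((x - x₀) * w' x) - κ * w x) ∂μI ≤
      1 / 2 * ∫ x, Real.exp (2 * l * ψ x) * (z x + q x) ^ 2 ∂μI := by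
    rw [← integral_const_mul]
    have iA : MemLp (fun x => W' x + (κ ^ 2 * quadWeight a x₀ x - μ * ψ x) * w x) 2 μI :=
      (hW'2.add (((h.memLp_quadWeight_mul hw.memLp).const_mul (κ ^ 2)).sub
        (memLp_mul_of_hasACDeriv hψAC hw.memLp))).ae_eq (Eventually.of_forall fun x => by
          simp only [Pi.add_apply, Pi.sub_apply]; ring)
    have iB : MemLp (fun x => E x * (z x + μ * ψ x * v x) - 2 * κ * ((x - x₀) * w' x) - κ * w x)
        2 μI := (hy.memLp.sub ((hw.memLp_sub_mul h).const_mul (2 * κ))).sub (hw.memLp.const_mul κ)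
    have iC : Integrable (fun x => 1 / 2 * (Real.exp (2 * l * ψ x) * (z x + q x) ^ 2)) μI := by
      have h1 : MemLp (fun x => E x * (z x + q x)) 2 μI :=
        memLp_mul_of_hasACDeriv hEAC (hz.memLp.add hq)
      refine (h1.integrable_sq.const_mul (1 / 2)).congr (Eventually.of_forall fun x => ?_)
      show 1 / 2 * (E x * (z x + q x)) ^ 2 = 1 / 2 * (Real.exp (2 * l * ψ x) * (z x + q x) ^ 2)
      rw [hEe]; ring
    refine integral_mono_ae (iA.integrable_mul_two iB) iC ?_
    filter_upwards [hm] with x hx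
    -- The symmetric and antisymmetric parts add up to e^{sφ}(v_t + (a v_x)_x).
    have e1 : W' x + (κ ^ 2 * quadWeight a x₀ x - μ * ψ x) * w x +
        (E x * (z x + μ * ψ x * v x) - 2 * κ * ((x - x₀) * w' x) - κ * w x) =
        E x * (z x + q x) := by
      simp only [hW'def, hwdef, hw'def]
      linear_combination -2 * κ ^ 2 * E x * v x * hx.2
    rw [hEe, ← mul_pow, ← e1]
    exact mul_le_half_add_sq _ _
  -- the time derivative of the quadratic form
  have iD0 : Integrable (fun x => -(a x * w' x * (κ * E x * linWeight a x₀ x *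
      (z x + μ * ψ x * v x) + E x * (z' x + (μ * c₁ * linWeight a x₀ x * v x + μ * ψ x * v' x)))) +
      (κ ^ 2 * quadWeight a x₀ x - μ * ψ x) * w x * (E x * (z x + μ * ψ x * v x))) μI :=
    (hw.integrable_weighted h hy).neg.add
      (h.integrable_potential_mul hw.memLp hy.memLp κ μ c₁ c₂)
  have hleft : ∫ x, -(a x * w' x * (κ * E x * linWeight a x₀ x * (z x + μ * ψ x * v x) +
        E x * (z' x + (μ * c₁ * linWeight a x₀ x * v x + μ * ψ x * v' x)))) +
      (κ ^ 2 * quadWeight a x₀ x - μ * ψ x) * w x * (E x * (z x + μ * ψ x * v x)) ∂μI =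
      (∫ x, derivDensity a x₀ c₁ c₂ l μ ρ v v' z z' x ∂μI) +
        1 / 2 * ρ * (∫ x, ψ x * w x ^ 2 ∂μI) - κ * μ * c₁ * Y := by
    -- The form is (-a w_x² + (κ²b - μψ)w²)/2. Its time derivative falls also on the coefficients,
    -- and κ_t = c₁μ, μ_t = ρ give the two correction terms. Written in v, the κ²b terms of the form
    -- cancel, which is why none occurs in `derivDensity`.
    have e1 : ∀ᵐ x ∂μI, -(a x * w' x * (κ * E x * linWeight a x₀ x * (z x + μ * ψ x * v x) +
        E x * (z' x + (μ * c₁ * linWeight a x₀ x * v x + μ * ψ x * v' x)))) +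
      (κ ^ 2 * quadWeight a x₀ x - μ * ψ x) * w x * (E x * (z x + μ * ψ x * v x)) -
      1 / 2 * ρ * (ψ x * w x ^ 2) + κ * μ * c₁ * (quadWeight a x₀ x * w x ^ 2) =
      derivDensity a x₀ c₁ c₂ l μ ρ v v' z z' x := by
      filter_upwards [hm] with x hx
      rw [derivDensity, hEe]
      simp only [hwdef, hw'def, ← hψdef, ← hκ]
      rw [← hx.2]
      set m := linWeight a x₀ x
      rw [← hx.1]
      ring
    rw [hY, ← integral_congr_ae e1, integral_add _ (iY.const_mul _),
      integral_sub iD0 (iI.const_mul _), integral_const_mul, integral_const_mul]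
    · ring
    · exact iD0.sub (iI.const_mul _)
  -- the energy
  set δ := min (c₁ * (2 - K) / 4) (c₁ ^ 3 * (2 - K) / 2 / (2 * c₁ ^ 2 + 1)) with hδ
  have hδ1 : δ ≤ c₁ * (2 - K) / 4 := min_le_left _ _
  have hδ2 : δ * (2 * c₁ ^ 2 + 1) ≤ c₁ ^ 3 * (2 - K) / 2 := by
    rw [← le_div_iff₀ (by positivity)]; exact min_le_right _ _
  have hδ0 : 0 ≤ δ := le_min (by positivity) (by positivity)
  have henergy : ∫ x, (l * (a x * v' x * v' x) +
      s ^ 3 * θ ^ 3 * (quadWeight a x₀ x * v x ^ 2)) * Real.exp (2 * l * ψ x) ∂μI ≤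
      2 * l * X + (2 * c₁ ^ 2 + 1) * (s ^ 3 * θ ^ 3) * Y := by
    rw [hX, hY, ← integral_const_mul, ← integral_const_mul,
      ← integral_add (iX.const_mul _) (iY.const_mul _)]
    refine integral_mono_of_nonneg ?_ ((iX.const_mul _).add (iY.const_mul _)) ?_
    · filter_upwards [ae_muI_mem] with x hx
      have h1 := h.nonneg (Ioo_subset_Icc_self hx)
      have h2 := h.quadWeight_nonneg (Ioo_subset_Icc_self hx)
      have h3 : 0 ≤ a x * v' x * v' x := by
        rw [mul_assoc]; exact mul_nonneg h1 (mul_self_nonneg _)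
      have hl0 : 0 ≤ l := by positivity
      rw [Pi.zero_apply]
      positivity
    · filter_upwards [hm, ae_muI_mem] with x hx hx01
      have h1 := h.nonneg (Ioo_subset_Icc_self hx01)
      have hl0 : 0 ≤ l := by positivity
      rw [hEe]
      -- Parallelogram identity for e^{sφ}v_x = w_x - κmw with m = (x - x₀)/a: the difference is l·a
      -- times the square of w_x + κmw. Here lκ² = c₁²s³θ³ accounts for the constant 2c₁² + 1.
      have e : 2 * l * (a x * w' x * w' x) +
          (2 * c₁ ^ 2 + 1) * (s ^ 3 * θ ^ 3) * (quadWeight a x₀ x * w x ^ 2) -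
          (l * (a x * v' x * v' x) +
            s ^ 3 * θ ^ 3 * (quadWeight a x₀ x * v x ^ 2)) * E x ^ 2 =
          l * (a x * (2 * κ * linWeight a x₀ x * v x + v' x) ^ 2) * E x ^ 2 := by
        simp only [hwdef, hw'def]
        rw [← hx.2]
        set m := linWeight a x₀ x
        rw [← hx.1, hκ, hl]
        ring
      have : 0 ≤ l * (a x * (2 * κ * linWeight a x₀ x * v x + v' x) ^ 2) * E x ^ 2 := by
        positivity
      linarith
  have hδX := mul_le_mul_of_nonneg_right hδ1 (by positivity : 0 ≤ 2 * l * X)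
  have hδY := mul_le_mul_of_nonneg_right hδ2 (by positivity : 0 ≤ s ^ 3 * θ ^ 3 * Y)
  have hen := mul_le_mul_of_nonneg_left henergy hδ0
  rw [hleft] at key
  have hkey := key.trans hright
  -- Since v vanishes at 0 and 1, the conjugated flux reduces there to e^{sφ}a v_x.
  simp only [hv.left, hv.right, mul_zero, add_zero, mul_pow, ← hEe] at hkey
  have hfin : s * c₁ * (θ * (linWeight a x₀ 1 * Real.exp (2 * l * ψ 1) * g 1 ^ 2 -
        linWeight a x₀ 0 * Real.exp (2 * l * ψ 0) * g 0 ^ 2)) =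
      κ * (linWeight a x₀ 1 * (Real.exp (2 * l * ψ 1) * g 1 ^ 2) -
        linWeight a x₀ 0 * (Real.exp (2 * l * ψ 0) * g 0 ^ 2)) := by
    rw [hκ, hl]; ring
  rw [hfin]
  clear_value X Y δ κ l
  linarith

end
end DegenerateParabolic

namespace DegenerateParabolic

/-! ### Jointly measurable representatives of Bochner functions -/

/-- The primitive of an element of `L²(0,1)`, as a function on the line. -/
noncomputable def primitiveL2 (V : L2I) (x : ℝ) : ℝ := ∫ y in Iic x, V y ∂μI

theorem primitiveL2_eq (V : L2I) (x : ℝ) :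
    primitiveL2 V x = (∫ y in Iic (0 : ℝ), (Ioo (0 : ℝ) 1).indicator V y) +
      ∫ y in (0 : ℝ)..x, (Ioo (0 : ℝ) 1).indicator V y := by
  have hi : Integrable ((Ioo (0 : ℝ) 1).indicator V) := by
    rw [integrable_indicator_iff measurableSet_Ioo]
    exact (Lp.memLp V).integrable (by norm_num)
  rw [← intervalIntegral.integral_Iic_sub_Iic hi.integrableOn hi.integrableOn, primitiveL2,
    setIntegral_indicator measurableSet_Ioo, setIntegral_indicator measurableSet_Ioo,
    Measure.restrict_restrict measurableSet_Iic]
  ring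

theorem continuous_primitiveL2 (V : L2I) : Continuous (primitiveL2 V) := by
  have hi : Integrable ((Ioo (0 : ℝ) 1).indicator V) := by
    rw [integrable_indicator_iff measurableSet_Ioo]
    exact (Lp.memLp V).integrable (by norm_num)
  simp_rw [funext (primitiveL2_eq V)]
  exact continuous_const.add
    (intervalIntegral.continuous_primitive (fun a b => hi.intervalIntegrable) 0)

/-- At a fixed x the primitive is the inner product with an indicator. Strong measurability of a
Bochner function thus passes to the primitive at each x. -/
theorem continuous_primitiveL2_left (x : ℝ) : Continuous fun V : L2I => primitiveL2 V x := by
  have : (fun V : L2I => primitiveL2 V x) = fun V : L2I =>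
      inner ℝ (indicatorConstLp 2 (measurableSet_Iic (a := x)) (measure_ne_top μI _) (1 : ℝ)) V :=
    funext fun V => (L2.inner_indicatorConstLp_one measurableSet_Iic (measure_ne_top μI _) V).symm
  rw [this]
  fun_prop

/-- A pointwise representative of an element of `L²(0,1)`. -/
noncomputable def preciseRep (V : L2I) (x : ℝ) : ℝ :=
  limUnder atTop fun n : ℕ =>
    (1 / ((n : ℝ) + 1))⁻¹ • (primitiveL2 V (x + 1 / ((n : ℝ) + 1)) - primitiveL2 V x)

theorem preciseRep_eq {V : L2I} {x r : ℝ} (h : HasDerivAt (primitiveL2 V) r x) :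
    preciseRep V x = r := by
  have h1 := hasDerivAt_iff_tendsto_slope_zero.1 h
  have h2 : Tendsto (fun n : ℕ => 1 / ((n : ℝ) + 1)) atTop (𝓝[≠] 0) := by
    refine tendsto_nhdsWithin_iff.2 ⟨tendsto_one_div_add_atTop_nhds_zero_nat,
      Eventually.of_forall fun n => ?_⟩
    exact (Nat.one_div_pos_of_nat (α := ℝ)).ne'
  exact (h1.comp h2).limUnder_eq

theorem preciseRep_ae_eq (V : L2I) : V =ᵐ[μI] preciseRep V := by
  have hi : Integrable ((Ioo (0 : ℝ) 1).indicator V) := by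
    rw [integrable_indicator_iff measurableSet_Ioo]
    exact (Lp.memLp V).integrable (by norm_num)
  have h1 := LocallyIntegrable.ae_hasDerivAt_integral hi.locallyIntegrable
  filter_upwards [ae_restrict_of_ae h1, ae_muI_mem] with x hx hx01
  refine (preciseRep_eq ?_).symm
  rw [funext (primitiveL2_eq V)]
  have := (hx 0).const_add (∫ y in Iic (0 : ℝ), (Ioo (0 : ℝ) 1).indicator V y)
  rwa [indicator_of_mem hx01] at this

theorem preciseRep_eq_of_continuousAt {V : L2I} {u : ℝ → ℝ} {x : ℝ} (hu : V =ᵐ[μI] u)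
    (hx : x ∈ Ioo (0 : ℝ) 1) (hc : ContinuousAt u x) : preciseRep V x = u x := by
  refine preciseRep_eq ?_
  have hi : Integrable ((Ioo (0 : ℝ) 1).indicator V) := by
    rw [integrable_indicator_iff measurableSet_Ioo]
    exact (Lp.memLp V).integrable (by norm_num)
  have hVu : (Ioo (0 : ℝ) 1).indicator V =ᵐ[volume] (Ioo (0 : ℝ) 1).indicator u := by
    have := ae_muI_iff.1 hu
    filter_upwards [this] with y hy
    by_cases hy' : y ∈ Ioo (0 : ℝ) 1
    · rw [indicator_of_mem hy', indicator_of_mem hy', hy hy']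
    · rw [indicator_of_notMem hy', indicator_of_notMem hy']
  have hi' := hi.congr hVu
  rw [funext (primitiveL2_eq V)]
  refine HasDerivAt.const_add _ ?_
  have e : (fun x => ∫ y in (0 : ℝ)..x, (Ioo (0 : ℝ) 1).indicator V y) =
      fun x => ∫ y in (0 : ℝ)..x, (Ioo (0 : ℝ) 1).indicator u y := by
    funext x
    exact intervalIntegral.integral_congr_ae (hVu.mono fun y hy _ => hy)
  rw [e]
  have heq : (Ioo (0 : ℝ) 1).indicator u =ᶠ[𝓝 x] u := by
    filter_upwards [Ioo_mem_nhds hx.1 hx.2] with y hy using indicator_of_mem hy u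
  have h3 := intervalIntegral.integral_hasDerivAt_right (hi'.intervalIntegrable (a := 0) (b := x))
    (hi'.aestronglyMeasurable.stronglyMeasurableAtFilter) (hc.congr heq.symm)
  rwa [indicator_of_mem hx] at h3

/-- The primitive is continuous in x and measurable in the parameter, hence jointly measurable;
difference quotients and their sequential limit keep this property. -/
theorem measurable_preciseRep {α : Type*} [MeasurableSpace α] {V : α → L2I}
    (hV : StronglyMeasurable V) : Measurable fun p : α × ℝ => preciseRep (V p.1) p.2 := by
  have h1 : Measurable (Function.uncurry fun (x : ℝ) (t : α) => primitiveL2 (V t) x) :=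
    measurable_uncurry_of_continuous_of_measurable (fun t => continuous_primitiveL2 (V t))
      fun x => ((continuous_primitiveL2_left x).comp_stronglyMeasurable hV).measurable
  have h2 : ∀ r : ℝ, Measurable fun p : α × ℝ => primitiveL2 (V p.1) (p.2 + r) := fun r =>
    h1.comp (by fun_prop : Measurable fun p : α × ℝ => (p.2 + r, p.1))
  have h3 : ∀ n : ℕ, StronglyMeasurable fun p : α × ℝ => (1 / ((n : ℝ) + 1))⁻¹ •
      (primitiveL2 (V p.1) (p.2 + 1 / ((n : ℝ) + 1)) - primitiveL2 (V p.1) p.2) := fun n => by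
    have h4 := h2 (1 / ((n : ℝ) + 1))
    have h5 := h2 0
    simp only [add_zero] at h5
    exact Measurable.stronglyMeasurable (by fun_prop)
  exact (StronglyMeasurable.limUnder h3).measurable

/-- A Bochner square integrable function with values in `L²(0,1)` has a jointly measurable square
integrable representative, with precise values at the points of continuity. -/
theorem exists_joint_representative {T : ℝ} {V : ℝ → L2I} (hV : MemLp V 2 (μT T)) :
    ∃ f : ℝ × ℝ → ℝ, Measurable f ∧ MemLp f 2 ((μT T).prod μI) ∧
      ∀ᵐ t ∂μT T, (V t =ᵐ[μI] fun x => f (t, x)) ∧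
        ∀ u : ℝ → ℝ, V t =ᵐ[μI] u → ∀ x ∈ Ioo (0 : ℝ) 1, ContinuousAt u x → f (t, x) = u x := by
  set V' := hV.1.mk V with hV'
  have hVV' : V =ᵐ[μT T] V' := hV.1.ae_eq_mk
  have hm := measurable_preciseRep hV.1.stronglyMeasurable_mk
  refine ⟨fun p => preciseRep (V' p.1) p.2, hm, ?_, ?_⟩
  · rw [memLp_two_iff_integrable_sq hm.aestronglyMeasurable]
    have hi : ∀ t, Integrable (fun x => preciseRep (V' t) x ^ 2) μI ∧
        ∫ x, preciseRep (V' t) x ^ 2 ∂μI = ‖V' t‖ ^ 2 := fun t => by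
      have h1 := preciseRep_ae_eq (V' t)
      refine ⟨((Lp.memLp (V' t)).ae_eq h1).integrable_sq, ?_⟩
      rw [← real_inner_self_eq_norm_sq, L2.inner_def]
      refine integral_congr_ae ?_
      filter_upwards [h1] with x hx
      rw [← hx]; simp [sq]
    rw [integrable_prod_iff (hm.pow_const 2).aestronglyMeasurable]
    refine ⟨Eventually.of_forall fun t => (hi t).1, ?_⟩
    have h2 : MemLp (fun t => ‖V' t‖) 2 (μT T) := (hV.ae_eq hVV').norm
    refine h2.integrable_sq.congr (Eventually.of_forall fun t => ?_)
    show ‖V' t‖ ^ 2 = ∫ x, ‖preciseRep (V' t) x ^ 2‖ ∂μI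
    rw [← (hi t).2]
    congr 1
    funext x
    rw [Real.norm_of_nonneg (sq_nonneg _)]
  · filter_upwards [hVV'] with t ht
    rw [ht]
    exact ⟨preciseRep_ae_eq _, fun u hu x hx hc => preciseRep_eq_of_continuousAt hu hx hc⟩

end DegenerateParabolic

/-! ### Pointwise values of the space derivative and traces of the flux -/

namespace DegenerateParabolic

variable {a : ℝ → ℝ} {x₀ K : ℝ}

theorem MemH1a.isAdmissible {u : ℝ → ℝ} (hu : MemH1a a x₀ K u) (h : IsDegenerate a x₀ K) :
    IsAdmissible a x₀ K u (dx u) where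
  punctured := by
    rcases lt_or_ge K 1 with hK | hK
    · exact (hasACDeriv_dx (hu.ac.1 hK) le_rfl zero_le_one le_rfl).punctured h.x₀_mem
    · obtain ⟨h1, h2⟩ := hu.ac.2 hK
      exact ⟨fun c hc => hasACDeriv_dx (h1 c hc) le_rfl hc.1 (hc.2.trans h.x₀_mem.2).le,
        fun c hc => hasACDeriv_dx (h2 c hc) (h.x₀_mem.1.trans hc.1).le hc.2 le_rfl⟩
  memLp := hu.memL2
  weighted := hu.weighted
  left := hu.left
  right := hu.right
  continuousAt hK :=
    ((hasACDeriv_dx (hu.ac.1 hK) le_rfl zero_le_one le_rfl).continuousOn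
      zero_le_one).continuousAt (Icc_mem_nhds h.x₀_mem.1 h.x₀_mem.2)

/-- An absolutely continuous function whose derivative has a continuous representative is
differentiable. -/
theorem HasACDeriv.dx_eq {v v' f : ℝ → ℝ} {c d : ℝ} (hcd : c ≤ d) (hv : HasACDeriv v v' c d)
    (hf : ContinuousOn f (Icc c d)) (hvf : ∀ᵐ x, x ∈ Ioo c d → v' x = f x) {x : ℝ}
    (hx : x ∈ Icc (0 : ℝ) 1) (hxcd : x ∈ Icc c d) (hmem : Icc c d ∈ 𝓝[Icc 0 1] x) :
    dx v x = f x := by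
  set F := IccExtend hcd ((Icc c d).domRestrict f) with hF
  have hFc : Continuous F := hf.domRestrict.Icc_extend'
  have hFf : ∀ y ∈ Icc c d, F y = f y := fun y hy => by
    rw [hF, IccExtend_of_mem hcd _ hy]; rfl
  have hvF : ∀ y ∈ Icc c d, v y = v c + ∫ r in c..y, F r := by
    intro y hy
    have h1 := (hv.mono le_rfl hy.1 hy.2).integral_eq hy.1
    have h2 : ∫ r in c..y, F r = ∫ r in c..y, v' r := by
      rw [intervalIntegral.integral_of_le hy.1, intervalIntegral.integral_of_le hy.1,
        integral_Ioc_eq_integral_Ioo, integral_Ioc_eq_integral_Ioo]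
      refine setIntegral_congr_ae measurableSet_Ioo ?_
      filter_upwards [hvf] with r hr hr'
      have hr'' : r ∈ Ioo c d := ⟨hr'.1, hr'.2.trans_le hy.2⟩
      rw [hr hr'', hFf r (Ioo_subset_Icc_self hr'')]
    rw [h2, h1]; ring
  have hd : HasDerivWithinAt (fun y => v c + ∫ r in c..y, F r) (F x) (Icc 0 1) x :=
    ((hFc.integral_hasStrictDerivAt c x).hasDerivAt.const_add (v c)).hasDerivWithinAt
  have hd' : HasDerivWithinAt v (F x) (Icc 0 1) x := by
    refine hd.congr_of_eventuallyEq ?_ (hvF x hxcd)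
    filter_upwards [hmem] with y hy using hvF y hy
  rw [dx, hd'.derivWithin (uniqueDiffOn_Icc zero_lt_one x hx), hFf x hxcd]

/-- On a closed interval away from x₀ the derivative of v has the continuous representative g/a, so
v is differentiable everywhere there. The end points are included because the boundary terms
evaluate v_x at 0 and 1. -/
theorem MemH1a.dx_eq_div {v g : ℝ → ℝ} (hv : MemH1a a x₀ K v) (h : IsDegenerate a x₀ K)
    (hg : MemW1 2 g) (hgv : g =ᵐ[μI] flux a v) {x : ℝ} (hx : x ∈ Icc (0 : ℝ) 1) (hne : x ≠ x₀) :
    dx v x = g x / a x := by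
  have hv' := (hv.isAdmissible h).punctured
  have hgc := (hasACDeriv_dx hg.1 le_rfl zero_le_one le_rfl).continuousOn zero_le_one
  have hgv' : ∀ᵐ x : ℝ, x ∈ Ioo (0 : ℝ) 1 → x ≠ x₀ → dx v x = g x / a x := by
    filter_upwards [ae_muI_iff.1 hgv] with x hx hx01 hne
    rw [hx hx01, flux]
    have := (h.pos x (Ioo_subset_Icc_self hx01) hne).ne'
    field_simp
  rcases lt_or_gt_of_ne hne with hlt | hgt
  · obtain ⟨d, hd1, hd2⟩ := exists_between hlt
    have hd0 : 0 ≤ d := hx.1.trans hd1.le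
    have hd3 : d ≤ 1 := (hd2.trans h.x₀_mem.2).le
    refine (hv'.left d ⟨hd0, hd2⟩).dx_eq (f := fun x => g x / a x) hd0 ?_ ?_ hx ⟨hx.1, hd1.le⟩ ?_
    · exact (hgc.mono (Icc_subset_Icc_right hd3)).div
        (h.continuousOn.mono (Icc_subset_Icc_right hd3))
        fun y hy => (h.pos y ⟨hy.1, hy.2.trans hd3⟩ (hy.2.trans_lt hd2).ne).ne'
    · filter_upwards [hgv'] with y hy hy'
      exact hy ⟨hy'.1, hy'.2.trans_le hd3⟩ (hy'.2.trans hd2).ne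
    · filter_upwards [self_mem_nhdsWithin, mem_nhdsWithin_of_mem_nhds (Iio_mem_nhds hd1)] with y h1 h2
      exact ⟨h1.1, h2.le⟩
  · obtain ⟨c, hc1, hc2⟩ := exists_between hgt
    have hc0 : 0 ≤ c := (h.x₀_mem.1.trans hc1).le
    have hc3 : c ≤ 1 := hc2.le.trans hx.2
    refine (hv'.right c ⟨hc1, hc3⟩).dx_eq (f := fun x => g x / a x) hc3 ?_ ?_ hx ⟨hc2.le, hx.2⟩ ?_
    · exact (hgc.mono (Icc_subset_Icc_left hc0)).div
        (h.continuousOn.mono (Icc_subset_Icc_left hc0))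
        fun y hy => (h.pos y ⟨hc0.trans hy.1, hy.2⟩ (hc1.trans_le hy.1).ne').ne'
    · filter_upwards [hgv'] with y hy hy'
      exact hy ⟨hc0.trans_lt hy'.1, hy'.2⟩ (hc1.trans hy'.1).ne'
    · filter_upwards [self_mem_nhdsWithin, mem_nhdsWithin_of_mem_nhds (Ioi_mem_nhds hc2)] with y h1 h2
      exact ⟨h2.le, h1.2⟩

/-- The equation differentiates a v_x itself rather than its representative g. The two coincide in a
neighbourhood of every interior point other than x₀, so their derivatives agree almost everywhere.
-/
theorem MemH1a.dx_flux_ae {v g : ℝ → ℝ} (hv : MemH1a a x₀ K v) (h : IsDegenerate a x₀ K)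
    (hg : MemW1 2 g) (hgv : g =ᵐ[μI] flux a v) : dx (flux a v) =ᵐ[μI] dx g := by
  filter_upwards [ae_muI_mem, ae_muI_ne x₀] with x hx hne
  rw [dx_eq_deriv _ hx, dx_eq_deriv _ hx]
  refine Filter.EventuallyEq.deriv_eq ?_
  filter_upwards [Ioo_mem_nhds hx.1 hx.2, isOpen_ne.mem_nhds hne] with y hy hy'
  rw [flux, hv.dx_eq_div h hg hgv (Ioo_subset_Icc_self hy) hy']
  have := (h.pos y (Ioo_subset_Icc_self hy) hy').ne'
  field_simp

theorem MemH1a.continuousAt_sqrt_mul_dx {v g : ℝ → ℝ} (hv : MemH1a a x₀ K v)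
    (h : IsDegenerate a x₀ K) (hg : MemW1 2 g) (hgv : g =ᵐ[μI] flux a v) {x : ℝ}
    (hx : x ∈ Ioo (0 : ℝ) 1) (hne : x ≠ x₀) : ContinuousAt (fun x => √(a x) * dx v x) x := by
  have hgc := (hasACDeriv_dx hg.1 le_rfl zero_le_one le_rfl).continuousOn zero_le_one
  have hmem := Icc_mem_nhds hx.1 hx.2
  have h1 : ContinuousAt (fun x => √(a x) * (g x / a x)) x :=
    (h.continuousOn.continuousAt hmem).sqrt.mul ((hgc.continuousAt hmem).div
      (h.continuousOn.continuousAt hmem) (h.pos x (Ioo_subset_Icc_self hx) hne).ne')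
  refine h1.congr ?_
  filter_upwards [Ioo_mem_nhds hx.1 hx.2, isOpen_ne.mem_nhds hne] with y hy hy'
  rw [hv.dx_eq_div h hg hgv (Ioo_subset_Icc_self hy) hy']

/-- The trace of the flux at the right end point. -/
theorem MemW1.right_eq {g : ℝ → ℝ} (hg : MemW1 2 g) : g 1 = ∫ x, g x + x * dx g x ∂μI := by
  -- Integrating (xg)' expresses the trace through integrals over (0,1), from which measurability
  -- and square integrability in time can be read off.
  have h1 := (HasACDeriv.of_contDiff (f := fun x : ℝ => x) (f' := fun _ => 1) (c := 0) (d := 1)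
    contDiff_id hasDerivAt_id).mul (hasACDeriv_dx hg.1 le_rfl zero_le_one le_rfl)
  have h2 := h1.integral_eq zero_le_one
  rw [integral_muI_eq_interval]
  simpa using h2.symm

/-- The trace of the flux at the left end point. -/
theorem MemW1.left_eq {g : ℝ → ℝ} (hg : MemW1 2 g) :
    g 0 = ∫ x, g x - (1 - x) * dx g x ∂μI := by
  have h1 := (HasACDeriv.of_contDiff (f := fun x : ℝ => x - 1) (f' := fun _ => 1) (c := 0) (d := 1)
    (by fun_prop) fun x => (hasDerivAt_id x).sub_const 1).mul
    (hasACDeriv_dx hg.1 le_rfl zero_le_one le_rfl)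
  have h2 := h1.integral_eq zero_le_one
  rw [integral_muI_eq_interval]
  have h3 : ∀ x, g x - (1 - x) * dx g x = 1 * g x + (x - 1) * dx g x := fun x => by ring
  simp_rw [h3, h2]
  simp

end DegenerateParabolic

namespace DegenerateParabolic

/-! ### Weak time derivatives -/

theorem exists_Icc_of_isCompact_subset_Ioo {S : Set ℝ} {T : ℝ} (hT : 0 < T) (hS : IsCompact S)
    (hST : S ⊆ Ioo 0 T) : ∃ p q, 0 < p ∧ p ≤ q ∧ q < T ∧ S ⊆ Icc p q := by
  -- The midpoint is adjoined to make the set nonempty, so that its infimum and supremum are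
  -- attained.
  have hc : IsCompact (insert (T / 2) S) := hS.insert _
  have hne : (insert (T / 2) S).Nonempty := insert_nonempty _ _
  have hsub : insert (T / 2) S ⊆ Ioo 0 T :=
    insert_subset ⟨by linarith, by linarith⟩ hST
  have h1 := hc.sInf_mem hne
  have h2 := hc.sSup_mem hne
  have h3 : insert (T / 2) S ⊆ Icc (sInf (insert (T / 2) S)) (sSup (insert (T / 2) S)) :=
    fun x hx => ⟨csInf_le hc.bddBelow hx, le_csSup hc.bddAbove hx⟩
  exact ⟨_, _, (hsub h1).1, (h3 h1).2, (hsub h2).2, (subset_insert _ _).trans h3⟩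

/-- A test function with vanishing integral is the derivative of a test function. -/
theorem exists_test_primitive {T : ℝ} (hT : 0 < T) {ζ : ℝ → ℝ} (hζ : ContDiff ℝ ∞ ζ)
    (hc : HasCompactSupport ζ) (hs : tsupport ζ ⊆ Ioo 0 T) (h0 : ∫ t in Ioo 0 T, ζ t = 0) :
    ∃ Z : ℝ → ℝ, ContDiff ℝ ∞ Z ∧ HasCompactSupport Z ∧ tsupport Z ⊆ Ioo 0 T ∧ deriv Z = ζ := by
  obtain ⟨p, q, hp, hpq, hq, hsub⟩ := exists_Icc_of_isCompact_subset_Ioo hT hc hs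
  set Z : ℝ → ℝ := fun t => ∫ r in (0 : ℝ)..t, ζ r with hZ
  have hd : ∀ t, HasDerivAt Z (ζ t) t := fun t =>
    (hζ.continuous.integral_hasStrictDerivAt 0 t).hasDerivAt
  have hderiv : deriv Z = ζ := funext fun t => (hd t).deriv
  have hzero : ∀ r, r ∉ Icc p q → ζ r = 0 := fun r hr =>
    image_eq_zero_of_notMem_tsupport fun h => hr (hsub h)
  have hsupp : ∀ t, t ∉ Icc p q → Z t = 0 := by
    intro t ht
    rcases lt_or_ge t p with hlt | hge
    · refine intervalIntegral.integral_zero_ae (Eventually.of_forall fun r hr => hzero r ?_)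
      intro hr'
      rcases le_total 0 t with h | h
      · rw [uIoc_of_le h] at hr; linarith [hr.2, hr'.1]
      · rw [uIoc_of_ge h] at hr; linarith [hr.2, hr'.1]
    · have htq : q < t := by
        by_contra hcon
        exact ht ⟨hge, not_lt.1 hcon⟩
      have h1 : ∫ r in (0 : ℝ)..T, ζ r = 0 := by
        rw [intervalIntegral.integral_of_le hT.le, integral_Ioc_eq_integral_Ioo, h0]
      have h2 : ∫ r in t..T, ζ r = 0 := by
        refine intervalIntegral.integral_zero_ae (Eventually.of_forall fun r hr => hzero r ?_)
        intro hr'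
        rcases le_total t T with h | h
        · rw [uIoc_of_le h] at hr; linarith [hr.1, hr'.2]
        · rw [uIoc_of_ge h] at hr; linarith [hr.1, hr'.2]
      have h3 := intervalIntegral.integral_add_adjacent_intervals
        (hζ.continuous.intervalIntegrable (μ := volume) 0 t) (hζ.continuous.intervalIntegrable t T)
      rw [h1, h2] at h3
      linarith
  have hts : tsupport Z ⊆ Icc p q := closure_minimal (fun t ht => by
    by_contra hcon; exact ht (hsupp t hcon)) isClosed_Icc
  refine ⟨Z, ?_, isCompact_Icc.of_isClosed_subset (isClosed_tsupport Z) hts,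
    hts.trans (Icc_subset_Ioo hp hq), hderiv⟩
  rw [contDiff_infty_iff_deriv]
  exact ⟨fun t => (hd t).differentiableAt, by rwa [hderiv]⟩

theorem integrable_smul_of_continuous {H : Type*} [NormedAddCommGroup H] [NormedSpace ℝ H]
    {V : ℝ → H} {T : ℝ} (hV : Integrable V (μT T)) {η : ℝ → ℝ} (hη : Continuous η)
    (hc : HasCompactSupport η) : Integrable (fun t => η t • V t) (μT T) := by
  obtain ⟨C, hC⟩ := hc.exists_bound_of_continuous hη
  exact hV.bdd_smul C hη.aestronglyMeasurable (Eventually.of_forall hC)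

variable {H : Type*} [NormedAddCommGroup H] [InnerProductSpace ℝ H] [CompleteSpace H]

/-- Integration by parts against a test function. -/
theorem integral_deriv_smul_primitive {W : ℝ → H} {T : ℝ} (hT : 0 < T) (hW : Integrable W (μT T))
    {η : ℝ → ℝ} (hη : ContDiff ℝ ∞ η) (hc : HasCompactSupport η) (hs : tsupport η ⊆ Ioo 0 T) :
    ∫ t in Ioo 0 T, deriv η t • (∫ r in (0 : ℝ)..t, W r) = -∫ t in Ioo 0 T, η t • W t := by
  have hWi : IntervalIntegrable W volume 0 T := by
    rw [intervalIntegrable_iff_integrableOn_Ioo_of_le hT.le]; exact hW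
  have hPc : ContinuousOn (fun t => ∫ r in (0 : ℝ)..t, W r) (Icc 0 T) := by
    have := intervalIntegral.continuousOn_primitive_interval' hWi left_mem_uIcc
    rwa [uIcc_of_le hT.le] at this
  have hPi : Integrable (fun t => ∫ r in (0 : ℝ)..t, W r) (μT T) :=
    (hPc.integrableOn_Icc).mono_set Ioo_subset_Icc_self
  have hdc : Continuous (deriv η) := hη.continuous_deriv (by simp)
  -- Testing against a fixed vector reduces the claim to the scalar product rule for absolutely
  -- continuous functions.
  refine ext_inner_left ℝ fun ξ => ?_
  rw [inner_neg_right, ← integral_inner (integrable_smul_of_continuous hPi hdc hc.deriv),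
    ← integral_inner (integrable_smul_of_continuous hW hη.continuous hc)]
  have hξ : IntervalIntegrable (fun r => inner ℝ ξ (W r)) volume 0 T := by
    rw [intervalIntegrable_iff_integrableOn_Ioo_of_le hT.le]
    exact hW.const_inner ξ
  have hAC := HasACDeriv.of_integral (r := 0) hT.le hξ (left_mem_Icc.2 hT.le)
  have hηAC : HasACDeriv η (deriv η) 0 T := HasACDeriv.of_contDiff (hη.of_le (by simp))
    fun x => ((hη.differentiable (by simp)) x).hasDerivAt
  have h1 := (hηAC.mul hAC).integral_eq hT.le
  have e0 : η 0 = 0 := image_eq_zero_of_notMem_tsupport fun h => lt_irrefl _ (hs h).1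
  have eT : η T = 0 := image_eq_zero_of_notMem_tsupport fun h => lt_irrefl _ (hs h).2
  rw [e0, eT, zero_mul, zero_mul, sub_zero, intervalIntegral.integral_of_le hT.le,
    integral_Ioc_eq_integral_Ioo] at h1
  have h2 : ∀ t ∈ Ioo 0 T, inner ℝ ξ (deriv η t • ∫ r in (0 : ℝ)..t, W r) =
      deriv η t * (0 + ∫ r in (0 : ℝ)..t, inner ℝ ξ (W r)) := fun t ht => by
    have h3 : Integrable W (volume.restrict (Ioc 0 t)) :=
      IntegrableOn.mono_set hW fun r hr => ⟨hr.1, hr.2.trans_lt ht.2⟩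
    rw [inner_smul_right, zero_add, intervalIntegral.integral_of_le ht.1.le,
      intervalIntegral.integral_of_le ht.1.le, integral_inner h3]
  rw [setIntegral_congr_fun measurableSet_Ioo h2]
  have i2 : Integrable (fun t => η t * inner ℝ ξ (W t)) (μT T) := by
    have := integrable_smul_of_continuous (hW.const_inner (𝕜 := ℝ) ξ) hη.continuous hc
    simpa using this
  have i1 : Integrable (fun t => deriv η t * (0 + ∫ r in (0 : ℝ)..t, inner ℝ ξ (W r))) (μT T) := by
    have h4 : Integrable (fun t => 0 + ∫ r in (0 : ℝ)..t, inner ℝ ξ (W r)) (μT T) :=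
      (hAC.continuousOn hT.le).integrableOn_Icc.mono_set Ioo_subset_Icc_self
    simpa using integrable_smul_of_continuous h4 hdc hc.deriv
  rw [integral_add i1 i2] at h1
  simp only [inner_smul_right]
  linarith

/-- A function with an integrable weak derivative is a primitive of it. -/
theorem exists_ae_eq_const_add_primitive {V W : ℝ → H} {T : ℝ} (hT : 0 < T)
    (hV : Integrable V (μT T)) (hW : Integrable W (μT T))
    (hweak : ∀ η : ℝ → ℝ, ContDiff ℝ ∞ η → HasCompactSupport η → tsupport η ⊆ Ioo 0 T →
      ∫ t in Ioo 0 T, deriv η t • V t = -∫ t in Ioo 0 T, η t • W t) :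
    ∃ c : H, ∀ᵐ t ∂μT T, V t = c + ∫ r in (0 : ℝ)..t, W r := by
  have hWi : IntervalIntegrable W volume 0 T := by
    rw [intervalIntegrable_iff_integrableOn_Ioo_of_le hT.le]; exact hW
  have hPc : ContinuousOn (fun t => ∫ r in (0 : ℝ)..t, W r) (Icc 0 T) := by
    have := intervalIntegral.continuousOn_primitive_interval' hWi left_mem_uIcc
    rwa [uIcc_of_le hT.le] at this
  have hPi : Integrable (fun t => ∫ r in (0 : ℝ)..t, W r) (μT T) :=
    (hPc.integrableOn_Icc).mono_set Ioo_subset_Icc_self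
  set R := fun t => V t - ∫ r in (0 : ℝ)..t, W r with hR
  have hRi : Integrable R (μT T) := hV.sub hPi
  have hR0 : ∀ η : ℝ → ℝ, ContDiff ℝ ∞ η → HasCompactSupport η → tsupport η ⊆ Ioo 0 T →
      ∫ t in Ioo 0 T, deriv η t • R t = 0 := by
    intro η hη hc hs
    have hdc : Continuous (deriv η) := hη.continuous_deriv (by simp)
    simp only [hR, smul_sub]
    rw [integral_sub (integrable_smul_of_continuous hV hdc hc.deriv)
      (integrable_smul_of_continuous hPi hdc hc.deriv), hweak η hη hc hs,
      integral_deriv_smul_primitive hT hW hη hc hs, sub_self]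
  let b : ContDiffBump (T / 2) := ⟨T / 8, T / 4, by positivity, by linarith⟩
  set η₀ := b.normed volume with hη₀
  have hb1 : ContDiff ℝ ∞ η₀ := b.contDiff_normed
  have hb2 : HasCompactSupport η₀ := b.hasCompactSupport_normed
  have hb3 : tsupport η₀ ⊆ Ioo 0 T := by
    rw [hη₀, b.tsupport_normed_eq, Real.closedBall_eq_Icc]
    intro t ht
    have h1 : b.rOut = T / 4 := rfl
    rw [h1] at ht
    exact ⟨by linarith [ht.1], by linarith [ht.2]⟩
  have hb4 : ∫ t in Ioo 0 T, η₀ t = 1 := by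
    rw [setIntegral_eq_integral_of_forall_compl_eq_zero, b.integral_normed]
    intro t ht
    exact image_eq_zero_of_notMem_tsupport fun h => ht (hb3 h)
  set c := ∫ t in Ioo 0 T, η₀ t • R t with hc
  have hfin : ∀ᵐ t : ℝ, t ∈ Ioo 0 T → R t - c = 0 := by
    refine isOpen_Ioo.ae_eq_zero_of_integral_contDiff_smul_eq_zero ?_ ?_
    · exact IntegrableOn.locallyIntegrableOn (hRi.sub (integrable_const c))
    · intro η hη hηc hηs
      set m := ∫ t in Ioo 0 T, η t with hm
      have iη : Integrable η (μT T) := (hη.continuous.integrable_of_hasCompactSupport hηc).restrict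
      have iη₀ : Integrable η₀ (μT T) :=
        (hb1.continuous.integrable_of_hasCompactSupport hb2).restrict
      -- The du Bois-Reymond argument: subtracting the multiple m of the unit-mass bump leaves mean
      -- zero, hence the derivative of a test function, against which R integrates to zero. So R and
      -- the constant c have the same integral against every η.
      have hζ1 : ContDiff ℝ ∞ fun t => η t - m * η₀ t := hη.sub (contDiff_const.mul hb1)
      have hζ2 : HasCompactSupport fun t => η t - m * η₀ t := hηc.sub hb2.mul_left
      have hζ3 : tsupport (fun t => η t - m * η₀ t) ⊆ Ioo 0 T := by
        refine (tsupport_sub η fun t => m * η₀ t).trans (union_subset hηs ?_)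
        exact (tsupport_mul_subset_right (f := fun _ => m)).trans hb3
      have hζ4 : ∫ t in Ioo 0 T, η t - m * η₀ t = 0 := by
        rw [integral_sub iη (iη₀.const_mul m), integral_const_mul, hb4]
        simp [hm]
      obtain ⟨Z, hZ1, hZ2, hZ3, hZ4⟩ := exists_test_primitive hT hζ1 hζ2 hζ3 hζ4
      have h1 := hR0 Z hZ1 hZ2 hZ3
      rw [hZ4] at h1
      have iηR := integrable_smul_of_continuous hRi hη.continuous hηc
      have iη₀R := integrable_smul_of_continuous hRi hb1.continuous hb2
      have h2 : ∫ t in Ioo 0 T, (η t - m * η₀ t) • R t =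
          (∫ t in Ioo 0 T, η t • R t) - m • c := by
        simp only [sub_smul, mul_smul]
        have i1 : Integrable (fun t => m • η₀ t • R t) (μT T) := iη₀R.smul m
        rw [integral_sub iηR i1, integral_smul]
      rw [h2] at h1
      rw [← setIntegral_eq_integral_of_forall_compl_eq_zero (s := Ioo 0 T)]
      · simp only [smul_sub]
        rw [integral_sub iηR (iη.smul_const c), integral_smul_const]
        exact h1
      · intro t ht
        rw [image_eq_zero_of_notMem_tsupport fun h => ht (hηs h), zero_smul]
  refine ⟨c, ?_⟩
  rw [ae_restrict_iff' measurableSet_Ioo]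
  filter_upwards [hfin] with t ht ht'
  have := ht ht'
  rw [hR, sub_eq_zero] at this
  rw [← this]
  simp

end DegenerateParabolic

/-! ### Primitives in time along lines of constant `x`, and time weights -/

namespace DegenerateParabolic

/-- Almost every section `f(·,x)` is a primitive of `f₁(·,x)`. -/
def IsTimePrimitive (T : ℝ) (f f₁ : ℝ × ℝ → ℝ) : Prop :=
  ∀ᵐ x ∂μI, ∃ c, ∀ᵐ t ∂μT T, f (t, x) = c + ∫ r in (0 : ℝ)..t, f₁ (r, x)

theorem memLp_two_integrable {α : Type*} [MeasurableSpace α] {μ : Measure α} [IsFiniteMeasure μ]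
    {f : α → ℝ} (hf : MemLp f 2 μ) : Integrable f μ := hf.integrable (by norm_num)

theorem measurable_primitive_left {f : ℝ × ℝ → ℝ} (hf : Measurable f) :
    Measurable fun p : ℝ × ℝ => ∫ r in Ioc 0 p.1, f (r, p.2) := by
  have h1 : ∀ p : ℝ × ℝ, ∫ r in Ioc 0 p.1, f (r, p.2) =
      ∫ r, ({q : (ℝ × ℝ) × ℝ | 0 < q.2 ∧ q.2 ≤ q.1.1}.indicator (fun q => f (q.2, q.1.2)) (p, r)) :=
    fun p => by
      rw [← integral_indicator measurableSet_Ioc]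
      rfl
  simp_rw [h1]
  have hms : MeasurableSet {q : (ℝ × ℝ) × ℝ | 0 < q.2 ∧ q.2 ≤ q.1.1} :=
    (measurableSet_lt measurable_const measurable_snd).inter
      (measurableSet_le measurable_snd measurable_fst.fst)
  have hm : Measurable ({q : (ℝ × ℝ) × ℝ | 0 < q.2 ∧ q.2 ≤ q.1.1}.indicator
      fun q => f (q.2, q.1.2)) := (hf.comp (by fun_prop)).indicator hms
  exact (hm.stronglyMeasurable.integral_prod_right' (ν := volume)).measurable

/-- The primitive of a Bochner function is represented by the primitive of a joint
representative. -/
theorem primitive_ae_eq {T : ℝ} {W : ℝ → L2I} {f₁ : ℝ × ℝ → ℝ}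
    (hf₁2 : MemLp f₁ 2 ((μT T).prod μI)) (hW : Integrable W (μT T))
    (hWf : ∀ᵐ t ∂μT T, W t =ᵐ[μI] fun x => f₁ (t, x)) {t : ℝ} (ht : t ∈ Ioo 0 T) :
    (∫ r in Ioc 0 t, W r : L2I) =ᵐ[μI] fun x => ∫ r in Ioc 0 t, f₁ (r, x) := by
  have hle : volume.restrict (Ioc 0 t) ≤ μT T :=
    Measure.restrict_mono (show Ioc 0 t ⊆ Ioo 0 T from fun r hr => ⟨hr.1, hr.2.trans_lt ht.2⟩) le_rfl
  have hWt : Integrable W (volume.restrict (Ioc 0 t)) := hW.mono_measure hle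
  have hfi : Integrable f₁ ((volume.restrict (Ioc 0 t)).prod μI) :=
    (memLp_two_integrable hf₁2).mono_measure (Measure.prod_mono hle le_rfl)
  have hWf' : ∀ᵐ r ∂volume.restrict (Ioc 0 t), W r =ᵐ[μI] fun x => f₁ (r, x) :=
    ae_mono hle hWf
  refine Integrable.ae_eq_of_forall_setIntegral_eq _ _
    ((Lp.memLp _).integrable (by norm_num)) hfi.integral_prod_right ?_
  -- Pairing with the indicator of A commutes with the Bochner integral; Fubini's theorem then
  -- exchanges the integrals over r and x.
  intro A hA hμA
  rw [← L2.inner_indicatorConstLp_one (𝕜 := ℝ) hA hμA.ne, ← integral_inner hWt]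
  have h1 : ∫ r in Ioc 0 t, inner ℝ (indicatorConstLp 2 hA hμA.ne (1 : ℝ)) (W r) =
      ∫ r in Ioc 0 t, ∫ x in A, f₁ (r, x) ∂μI := by
    refine integral_congr_ae ?_
    filter_upwards [hWf'] with r hr
    rw [L2.inner_indicatorConstLp_one (𝕜 := ℝ) hA hμA.ne]
    exact integral_congr_ae (ae_restrict_of_ae hr)
  rw [h1]
  refine integral_integral_swap ?_
  exact hfi.mono_measure (Measure.prod_mono le_rfl Measure.restrict_le_self)

/-- The Bochner identity holds for almost every t as an equality of classes in x. Joint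
measurability of both sides permits exchanging the order of the two quantifiers, which gives the
identity along almost every line of constant x. -/
theorem isTimePrimitive_of_weak {T : ℝ} (hT : 0 < T) {V W : ℝ → L2I} {f f₁ : ℝ × ℝ → ℝ}
    (hf : Measurable f) (hf₁ : Measurable f₁)
    (hf₁2 : MemLp f₁ 2 ((μT T).prod μI)) (hV : Integrable V (μT T)) (hW : Integrable W (μT T))
    (hVf : ∀ᵐ t ∂μT T, V t =ᵐ[μI] fun x => f (t, x))
    (hWf : ∀ᵐ t ∂μT T, W t =ᵐ[μI] fun x => f₁ (t, x))
    (hweak : ∀ η : ℝ → ℝ, ContDiff ℝ ∞ η → HasCompactSupport η → tsupport η ⊆ Ioo 0 T →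
      ∫ t in Ioo 0 T, deriv η t • V t = -∫ t in Ioo 0 T, η t • W t) :
    IsTimePrimitive T f f₁ := by
  obtain ⟨c, hc⟩ := exists_ae_eq_const_add_primitive hT hV hW hweak
  have hcm : Measurable c := (Lp.stronglyMeasurable c).measurable
  have h1 : ∀ᵐ t ∂μT T, ∀ᵐ x ∂μI, f (t, x) = c x + ∫ r in Ioc 0 t, f₁ (r, x) := by
    filter_upwards [hc, hVf, ae_restrict_mem measurableSet_Ioo] with t ht htf htT
    have h2 := primitive_ae_eq hf₁2 hW hWf htT
    rw [intervalIntegral.integral_of_le htT.1.le] at ht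
    have h3 := Lp.coeFn_add c (∫ r in Ioc 0 t, W r)
    rw [← ht] at h3
    filter_upwards [htf, h2, h3] with x hx1 hx2 hx3
    rw [← hx1, hx3, Pi.add_apply, hx2]
  have hms : MeasurableSet {p : ℝ × ℝ | f (p.1, p.2) = c p.2 + ∫ r in Ioc 0 p.1, f₁ (r, p.2)} :=
    measurableSet_eq_fun hf ((hcm.comp measurable_snd).add (measurable_primitive_left hf₁))
  rw [Measure.ae_ae_comm hms] at h1
  filter_upwards [h1] with x hx
  refine ⟨c x, ?_⟩
  filter_upwards [hx, ae_restrict_mem measurableSet_Ioo] with t ht htT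
  rw [ht, intervalIntegral.integral_of_le htT.1.le]

/-- A weight on `(0,T) × (0,1)` that is bounded together with its time derivative and vanishes as
`t → 0` and `t → T`. -/
structure IsTimeWeight (T : ℝ) (n n' : ℝ × ℝ → ℝ) : Prop where
  meas : AEStronglyMeasurable n ((μT T).prod μI)
  meas' : AEStronglyMeasurable n' ((μT T).prod μI)
  exists_bound : ∃ C, 0 ≤ C ∧ ∀ t ∈ Ioo 0 T, ∀ x ∈ Ioo (0 : ℝ) 1,
    |n (t, x)| ≤ C * (t * (T - t)) ∧ |n' (t, x)| ≤ C
  deriv : ∀ t ∈ Ioo 0 T, ∀ x ∈ Ioo (0 : ℝ) 1, HasDerivAt (fun r => n (r, x)) (n' (t, x)) t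

theorem ae_prod_mem (T : ℝ) :
    ∀ᵐ p ∂(μT T).prod μI, p.1 ∈ Ioo 0 T ∧ p.2 ∈ Ioo (0 : ℝ) 1 := by
  rw [Measure.prod_restrict]
  exact ae_restrict_mem (measurableSet_Ioo.prod measurableSet_Ioo)

theorem IsTimeWeight.ae_bound {T : ℝ} {n n' : ℝ × ℝ → ℝ} (hn : IsTimeWeight T n n') :
    ∃ C, (∀ᵐ p ∂(μT T).prod μI, |n p| ≤ C) ∧ ∀ᵐ p ∂(μT T).prod μI, |n' p| ≤ C := by
  obtain ⟨C, hC0, hC⟩ := hn.exists_bound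
  have hCT : C ≤ C * (1 + T ^ 2) := by nlinarith [sq_nonneg T]
  refine ⟨C * (1 + T ^ 2), ?_, ?_⟩
  · filter_upwards [ae_prod_mem T] with p hp
    refine (hC p.1 hp.1 p.2 hp.2).1.trans ?_
    gcongr
    nlinarith [hp.1.1, hp.1.2, sq_nonneg p.1]
  · filter_upwards [ae_prod_mem T] with p hp
    exact (hC p.1 hp.1 p.2 hp.2).2.trans hCT

theorem IsTimeWeight.integrable {T : ℝ} {n n' f g : ℝ × ℝ → ℝ} (hn : IsTimeWeight T n n')
    (hf : MemLp f 2 ((μT T).prod μI)) (hg : MemLp g 2 ((μT T).prod μI)) :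
    Integrable (fun p => n p * (f p * g p)) ((μT T).prod μI) := by
  obtain ⟨C, hC, -⟩ := hn.ae_bound
  refine ((hf.bounded_mul hn.meas C hC).integrable_mul_two hg).congr
    (Eventually.of_forall fun p => ?_)
  simp only [mul_assoc]

theorem IsTimeWeight.integrable' {T : ℝ} {n n' f g : ℝ × ℝ → ℝ} (hn : IsTimeWeight T n n')
    (hf : MemLp f 2 ((μT T).prod μI)) (hg : MemLp g 2 ((μT T).prod μI)) :
    Integrable (fun p => n' p * (f p * g p)) ((μT T).prod μI) := by
  obtain ⟨C, -, hC⟩ := hn.ae_bound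
  refine ((hf.bounded_mul hn.meas' C hC).integrable_mul_two hg).congr
    (Eventually.of_forall fun p => ?_)
  simp only [mul_assoc]

/-- The scalar product rule, integrated over `(0,T)`. -/
theorem integral_deriv_weight_mul_mul {T C : ℝ} (hT : 0 < T) {n n' F F' G G' h : ℝ → ℝ}
    (hF : HasACDeriv F F' 0 T) (hG : HasACDeriv G G' 0 T)
    (hC : ∀ t ∈ Ioo 0 T, |n t| ≤ C * (t * (T - t)) ∧ |n' t| ≤ C)
    (hn : ∀ t ∈ Ioo 0 T, HasDerivAt n (n' t) t) (hi : Integrable h (μT T))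
    (hh : ∀ᵐ t ∂μT T, h t = n' t * (F t * G t) + n t * (F' t * G t + F t * G' t)) :
    ∫ t in Ioo 0 T, h t = 0 := by
  rw [ae_restrict_iff' measurableSet_Ioo] at hh
  -- The weight is singular in form at t = 0 and t = T and nothing is known about its values there,
  -- so the product rule is used on compact subintervals. The product is at most C·t(T - t)·M, so
  -- both limits at the ends are zero.
  have hAC : ∀ p q, 0 < p → p ≤ q → q < T → HasACDeriv (fun t => n t * (F t * G t)) h p q := by
    intro p q hp hpq hq
    have hsub : Icc p q ⊆ Ioo 0 T := Icc_subset_Ioo hp hq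
    have hnAC : HasACDeriv n n' p q := by
      refine ⟨LipschitzOnWith.absolutelyContinuousOnInterval (K := C.toNNReal) ?_,
        Eventually.of_forall fun t ht => hn t (hsub (Ioo_subset_Icc_self ht))⟩
      rw [uIcc_of_le hpq]
      refine (convex_Icc p q).lipschitzOnWith_of_nnnorm_hasDerivWithin_le
        (fun t ht => (hn t (hsub ht)).hasDerivWithinAt) fun t ht => ?_
      rw [← NNReal.coe_le_coe, coe_nnnorm, Real.norm_eq_abs]
      exact (hC t (hsub ht)).2.trans (Real.le_coe_toNNReal C)
    refine (hnAC.mul ((hF.mono hp.le hpq hq.le).mul (hG.mono hp.le hpq hq.le))).congr_deriv ?_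
    filter_upwards [hh] with t ht ht'
    rw [ht (hsub (Ioo_subset_Icc_self ht'))]
  obtain ⟨M, hM⟩ := isCompact_Icc.exists_bound_of_continuousOn
    ((hF.mul hG).continuousOn hT.le)
  have hM0 : 0 ≤ M := (norm_nonneg _).trans (hM 0 (left_mem_Icc.2 hT.le))
  have hbound : ∀ t ∈ Ioo 0 T, |n t * (F t * G t)| ≤ C * (t * (T - t)) * M := fun t ht => by
    rw [abs_mul]
    have h1 := (hC t ht).1
    exact mul_le_mul h1 (hM t (Ioo_subset_Icc_self ht)) (abs_nonneg _) ((abs_nonneg _).trans h1)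
  have hiT : IntervalIntegrable h volume 0 T := by
    rw [intervalIntegrable_iff_integrableOn_Ioo_of_le hT.le]; exact hi
  have hi1 : IntervalIntegrable h volume 0 (T / 2) := hiT.mono_set (by
    rw [uIcc_of_le hT.le, uIcc_of_le (by positivity)]; exact Icc_subset_Icc_right (by linarith))
  have hi2 : IntervalIntegrable h volume (T / 2) T := hiT.mono_set (by
    rw [uIcc_of_le hT.le, uIcc_of_le (by linarith)]; exact Icc_subset_Icc_left (by linarith))
  have hcont : Continuous fun t : ℝ => C * (t * (T - t)) * M := by fun_prop
  have h0 : Tendsto (fun t => n t * (F t * G t)) (𝓝[>] 0) (𝓝 0) := by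
    have h1 := (hcont.tendsto 0).mono_left (nhdsWithin_le_nhds (s := Ioi 0))
    simp only [zero_mul, mul_zero] at h1
    refine squeeze_zero_norm' ?_ h1
    filter_upwards [Ioo_mem_nhdsGT hT] with t ht using hbound t ht
  have h0' : Tendsto (fun t => n t * (F t * G t)) (𝓝[<] T) (𝓝 0) := by
    have h1 := (hcont.tendsto T).mono_left (nhdsWithin_le_nhds (s := Iio T))
    simp only [sub_self, zero_mul, mul_zero] at h1
    refine squeeze_zero_norm' ?_ h1
    filter_upwards [Ioo_mem_nhdsLT hT] with t ht using hbound t ht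
  have e1 := tendsto_nhds_unique h0 (tendsto_of_hasACDeriv_right (by linarith)
    (fun c hc => hAC c (T / 2) hc.1 hc.2 (by linarith)) hi1)
  have e2 := tendsto_nhds_unique h0' (tendsto_of_hasACDeriv_left (by linarith)
    (fun c hc => hAC (T / 2) c (by linarith) hc.1 hc.2) hi2)
  have e3 := intervalIntegral.integral_add_adjacent_intervals hi1 hi2
  rw [← integral_Ioc_eq_integral_Ioo, ← intervalIntegral.integral_of_le hT.le]
  linarith

/-- The product rule for weighted products of time primitives, integrated over the cylinder. -/
theorem IsTimeWeight.integral_eq_zero {T : ℝ} (hT : 0 < T) {n n' f f₁ g g₁ : ℝ × ℝ → ℝ}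
    (hn : IsTimeWeight T n n') (hf : MemLp f 2 ((μT T).prod μI))
    (hf₁ : MemLp f₁ 2 ((μT T).prod μI)) (hg : MemLp g 2 ((μT T).prod μI))
    (hg₁ : MemLp g₁ 2 ((μT T).prod μI)) (hff : IsTimePrimitive T f f₁)
    (hgg : IsTimePrimitive T g g₁) :
    Integrable (fun p => n' p * (f p * g p) + n p * (f₁ p * g p + f p * g₁ p))
      ((μT T).prod μI) ∧
    ∫ p, n' p * (f p * g p) + n p * (f₁ p * g p + f p * g₁ p) ∂(μT T).prod μI = 0 := by
  have hi : Integrable (fun p => n' p * (f p * g p) + n p * (f₁ p * g p + f p * g₁ p))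
      ((μT T).prod μI) := by
    refine ((hn.integrable' hf hg).add ((hn.integrable hf₁ hg).add (hn.integrable hf hg₁))).congr
      (Eventually.of_forall fun p => ?_)
    simp only [Pi.add_apply]
    ring
  refine ⟨hi, ?_⟩
  -- The time integral is taken first: the product rule in t is available only at fixed x.
  rw [integral_prod_symm _ hi]
  refine integral_eq_zero_of_ae ?_
  obtain ⟨C, -, hC⟩ := hn.exists_bound
  filter_upwards [hff, hgg, hi.prod_left_ae, (memLp_two_integrable hf₁).prod_left_ae,
    (memLp_two_integrable hg₁).prod_left_ae, ae_muI_mem] with x ⟨c, hc⟩ ⟨d, hd⟩ hx hx1 hx2 hx01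
  have hi1 : IntervalIntegrable (fun t => f₁ (t, x)) volume 0 T := by
    rw [intervalIntegrable_iff_integrableOn_Ioo_of_le hT.le]; exact hx1
  have hi2 : IntervalIntegrable (fun t => g₁ (t, x)) volume 0 T := by
    rw [intervalIntegrable_iff_integrableOn_Ioo_of_le hT.le]; exact hx2
  refine integral_deriv_weight_mul_mul hT
    (HasACDeriv.of_integral (r := c) hT.le hi1 (left_mem_Icc.2 hT.le))
    (HasACDeriv.of_integral (r := d) hT.le hi2 (left_mem_Icc.2 hT.le))
    (fun t ht => hC t ht x hx01) (fun t ht => hn.deriv t ht x hx01) hx ?_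
  filter_upwards [hc, hd] with t h1 h2
  rw [h1, h2]

end DegenerateParabolic

namespace DegenerateParabolic

/-! ### The singular time weight -/

/-- The derivative of `Θ`. -/
noncomputable def thetaDeriv (T t : ℝ) : ℝ := -4 * (T - 2 * t) / (t * (T - t)) ^ 5

/-- The second derivative of `Θ`. -/
noncomputable def thetaDeriv₂ (T t : ℝ) : ℝ :=
  20 * (T - 2 * t) ^ 2 / (t * (T - t)) ^ 6 + 8 / (t * (T - t)) ^ 5

theorem measurable_Theta (T : ℝ) : Measurable (Theta T) := by
  unfold Theta; fun_prop

theorem measurable_thetaDeriv (T : ℝ) : Measurable (thetaDeriv T) := by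
  unfold thetaDeriv; fun_prop

theorem measurable_thetaDeriv₂ (T : ℝ) : Measurable (thetaDeriv₂ T) := by
  unfold thetaDeriv₂; fun_prop

section

variable {T t : ℝ}

theorem time_mul_pos (ht : t ∈ Ioo 0 T) : 0 < t * (T - t) :=
  mul_pos ht.1 (sub_pos.2 ht.2)

theorem time_mul_le (T t : ℝ) : t * (T - t) ≤ T ^ 2 := by
  nlinarith [sq_nonneg (T - 2 * t), sq_nonneg T]

theorem Theta_pos (ht : t ∈ Ioo 0 T) : 0 < Theta T t := by
  have := time_mul_pos ht
  unfold Theta; positivity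

theorem hasDerivAt_time_mul (T t : ℝ) : HasDerivAt (fun r => r * (T - r)) (T - 2 * t) t := by
  refine ((hasDerivAt_id t).mul ((hasDerivAt_id t).const_sub T)).congr_deriv ?_
  simp; ring

theorem hasDerivAt_Theta (ht : t ∈ Ioo 0 T) : HasDerivAt (Theta T) (thetaDeriv T t) t := by
  have h0 := (time_mul_pos ht).ne'
  have h := ((hasDerivAt_time_mul T t).pow 4).inv (pow_ne_zero 4 h0)
  have e : (Theta T) = ((fun r => r * (T - r)) ^ 4)⁻¹ := by
    funext r; simp [Theta]
  rw [e]
  refine h.congr_deriv ?_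
  simp only [Pi.pow_apply, thetaDeriv]
  generalize t * (T - t) = τ at *
  field_simp
  norm_num
  ring

theorem hasDerivAt_thetaDeriv (ht : t ∈ Ioo 0 T) :
    HasDerivAt (thetaDeriv T) (thetaDeriv₂ T t) t := by
  have h0 := (time_mul_pos ht).ne'
  have h1 : HasDerivAt (fun r => -4 * (T - 2 * r)) 8 t := by
    refine ((((hasDerivAt_id t).const_mul 2).const_sub T).const_mul (-4)).congr_deriv ?_
    norm_num
  refine (h1.div ((hasDerivAt_time_mul T t).pow 5) (pow_ne_zero 5 h0)).congr_deriv ?_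
  simp only [Pi.pow_apply, thetaDeriv₂]
  generalize t * (T - t) = τ at *
  field_simp
  norm_num
  ring

theorem abs_time_le (ht : t ∈ Ioo 0 T) : |T - 2 * t| ≤ T := by
  rw [abs_le]; constructor <;> linarith [ht.1, ht.2]

theorem time_mul_pow_le (ht : t ∈ Ioo 0 T) (n : ℕ) : (t * (T - t)) ^ n ≤ (T ^ 2) ^ n :=
  pow_le_pow_left₀ (time_mul_pos ht).le (time_mul_le T t) n

theorem one_le_Theta_sq (ht : t ∈ Ioo 0 T) : 1 ≤ (T ^ 2) ^ 8 * Theta T t ^ 2 := by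
  have h0 := time_mul_pos ht
  have h1 := time_mul_pow_le ht 8
  have e : (t * (T - t)) ^ 8 * Theta T t ^ 2 = 1 := by
    rw [Theta, div_pow, one_pow, ← pow_mul, mul_one_div_cancel (pow_pos h0 _).ne']
  rw [← e]
  gcongr

theorem Theta_le_sq (ht : t ∈ Ioo 0 T) : Theta T t ≤ (T ^ 2) ^ 4 * Theta T t ^ 2 := by
  have h0 := time_mul_pos ht
  have h1 := time_mul_pow_le ht 4
  have e : (t * (T - t)) ^ 4 * Theta T t ^ 2 = Theta T t := by
    rw [Theta]; field_simp
  calc Theta T t = (t * (T - t)) ^ 4 * Theta T t ^ 2 := e.symm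
    _ ≤ _ := by gcongr

theorem abs_thetaDeriv_le (ht : t ∈ Ioo 0 T) :
    |thetaDeriv T t| ≤ 4 * T * (T ^ 2) ^ 3 * Theta T t ^ 2 := by
  have h0 := time_mul_pos ht
  have e : |thetaDeriv T t| = 4 * |T - 2 * t| * (t * (T - t)) ^ 3 * Theta T t ^ 2 := by
    rw [thetaDeriv, Theta, abs_div, abs_mul, abs_of_pos (pow_pos h0 5)]
    norm_num
    field_simp
  have h1 := time_mul_pow_le ht 3
  have h2 := abs_time_le ht
  have hT : 0 ≤ T := (abs_nonneg _).trans h2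
  rw [e]
  gcongr

theorem abs_thetaDeriv₂_le (ht : t ∈ Ioo 0 T) :
    |thetaDeriv₂ T t| ≤ (20 * T ^ 2 * (T ^ 2) ^ 2 + 8 * (T ^ 2) ^ 3) * Theta T t ^ 2 := by
  have h0 := time_mul_pos ht
  have e : thetaDeriv₂ T t =
      (20 * |T - 2 * t| ^ 2 * (t * (T - t)) ^ 2 + 8 * (t * (T - t)) ^ 3) * Theta T t ^ 2 := by
    rw [thetaDeriv₂, Theta, sq_abs]
    field_simp
  have h1 := time_mul_pow_le ht 3
  have h2 := abs_time_le ht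
  have h3 := time_mul_pow_le ht 2
  rw [e, abs_of_nonneg (by positivity)]
  gcongr

/-- Both derivatives of `Θ` are controlled by `Θ²`. -/
theorem exists_theta_bounds (hT : 0 < T) : ∃ M, 0 < M ∧ ∀ t ∈ Ioo 0 T,
    1 ≤ M * Theta T t ^ 2 ∧ Theta T t ≤ M * Theta T t ^ 2 ∧
    |thetaDeriv T t| ≤ M * Theta T t ^ 2 ∧ |thetaDeriv₂ T t| ≤ M * Theta T t ^ 2 := by
  refine ⟨(T ^ 2) ^ 8 + (T ^ 2) ^ 4 + 4 * T * (T ^ 2) ^ 3 +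
    (20 * T ^ 2 * (T ^ 2) ^ 2 + 8 * (T ^ 2) ^ 3), by positivity, fun t ht => ?_⟩
  have p0 : 0 ≤ (T ^ 2) ^ 8 * Theta T t ^ 2 := by positivity
  have p1 : 0 ≤ (T ^ 2) ^ 4 * Theta T t ^ 2 := by positivity
  have p2 : 0 ≤ 4 * T * (T ^ 2) ^ 3 * Theta T t ^ 2 := by positivity
  have p3 : 0 ≤ (20 * T ^ 2 * (T ^ 2) ^ 2 + 8 * (T ^ 2) ^ 3) * Theta T t ^ 2 := by positivity
  have h0 := one_le_Theta_sq ht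
  have h1 := Theta_le_sq ht
  have h2 := abs_thetaDeriv_le ht
  have h3 := abs_thetaDeriv₂_le ht
  simp only [add_mul] at p3 h3 ⊢
  refine ⟨?_, ?_, ?_, ?_⟩ <;> linarith

end

theorem pow_mul_exp_neg_le {c y : ℝ} (hc : 0 < c) (hy : 0 ≤ y) (n : ℕ) :
    y ^ n * Real.exp (-(c * y)) ≤ n.factorial / c ^ n := by
  have h1 := Real.pow_div_factorial_le_exp (c * y) (by positivity) n
  rw [Real.exp_neg, ← div_eq_mul_inv, div_le_div_iff₀ (Real.exp_pos _) (by positivity)]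
  have hf : (0 : ℝ) < n.factorial := by positivity
  rw [div_le_iff₀ hf, mul_pow] at h1
  linarith

/-- Exponentially decaying weights absorb powers of `Θ`. -/
theorem exists_Theta_pow_mul_exp_le {ε s T : ℝ} (hε : 0 < ε) (hs : 0 < s) (n : ℕ) :
    ∃ C, 0 ≤ C ∧ ∀ t ∈ Ioo 0 T, ∀ y ≤ -ε,
      Theta T t ^ n * Real.exp (2 * (s * Theta T t) * y) ≤ C := by
  refine ⟨n.factorial / (2 * s * ε) ^ n, by positivity, fun t ht y hy => ?_⟩
  have hθ := Theta_pos ht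
  refine le_trans ?_ (pow_mul_exp_neg_le (c := 2 * s * ε) (by positivity) hθ.le n)
  gcongr
  have := mul_le_mul_of_nonneg_left hy (by positivity : 0 ≤ 2 * (s * Theta T t))
  linarith

/-- The weights of the Carleman estimate are admissible. -/
theorem isTimeWeight_exp {T s ε P A B : ℝ} {k k' β ψ : ℝ → ℝ} (hT : 0 < T) (hs : 0 < s)
    (hε : 0 < ε) (hP : 0 ≤ P) (hA : 0 ≤ A) (hB : 0 ≤ B) (hk : Measurable k) (hk' : Measurable k')
    (hkd : ∀ t ∈ Ioo 0 T, HasDerivAt k (k' t) t)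
    (hkb : ∀ t ∈ Ioo 0 T, |k t| ≤ A * Theta T t ^ 2 ∧ |k' t| ≤ A * Theta T t ^ 2)
    (hβ : AEStronglyMeasurable β μI) (hψ : AEStronglyMeasurable ψ μI)
    (hβb : ∀ x ∈ Ioo (0 : ℝ) 1, |β x| ≤ B)
    (hψb : ∀ x ∈ Ioo (0 : ℝ) 1, -P ≤ ψ x ∧ ψ x ≤ -ε) :
    IsTimeWeight T (fun p => k p.1 * (β p.2 * Real.exp (2 * (s * Theta T p.1) * ψ p.2)))
      (fun p => (k' p.1 + 2 * (s * thetaDeriv T p.1) * ψ p.2 * k p.1) *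
        (β p.2 * Real.exp (2 * (s * Theta T p.1) * ψ p.2))) := by
  have hβ2 : AEMeasurable (fun p : ℝ × ℝ => β p.2) ((μT T).prod μI) := hβ.comp_snd.aemeasurable
  have hψ2 : AEMeasurable (fun p : ℝ × ℝ => ψ p.2) ((μT T).prod μI) := hψ.comp_snd.aemeasurable
  have hθ := measurable_Theta T
  have hθ' := measurable_thetaDeriv T
  have he : AEMeasurable (fun p : ℝ × ℝ => β p.2 * Real.exp (2 * (s * Theta T p.1) * ψ p.2))
      ((μT T).prod μI) := by fun_prop
  refine ⟨(by fun_prop : AEMeasurable _ _).aestronglyMeasurable,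
    (by fun_prop : AEMeasurable _ _).aestronglyMeasurable, ?_, ?_⟩
  · obtain ⟨M, hM0, hM⟩ := exists_theta_bounds hT
    obtain ⟨C3, hC30, hC3⟩ := exists_Theta_pow_mul_exp_le (T := T) hε hs 3
    -- The fourth power is for the derivative, where Θ'k = O(Θ⁴). For the weight itself k = O(Θ²),
    -- and Θ² = Θ³(t(T - t))⁴: bounding Θ³e^{2sφ} leaves powers of t(T - t), one of which gives the
    -- vanishing at the ends.
    obtain ⟨C4, hC40, hC4⟩ := exists_Theta_pow_mul_exp_le (T := T) hε hs 4
    have hn0 : 0 ≤ A * B * C3 * (T ^ 2) ^ 3 := by positivity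
    have hn1 : 0 ≤ A * (M + 2 * s * M * P) * B * C4 := by positivity
    refine ⟨A * B * C3 * (T ^ 2) ^ 3 + A * (M + 2 * s * M * P) * B * C4, by positivity,
      fun t ht x hx => ?_⟩
    have hβx := hβb x hx
    obtain ⟨hψ1, hψ3⟩ := hψb x hx
    have hψx : |ψ x| ≤ P := abs_le.2 ⟨hψ1, by linarith⟩
    obtain ⟨hk1, hk2⟩ := hkb t ht
    obtain ⟨m1, m2, m3, m4⟩ := hM t ht
    have c3 := hC3 t ht (ψ x) hψ3
    have c4 := hC4 t ht (ψ x) hψ3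
    have hθp := Theta_pos ht
    have hτ := time_mul_pos ht
    have hep := Real.exp_pos (2 * (s * Theta T t) * ψ x)
    dsimp only
    generalize Real.exp (2 * (s * Theta T t) * ψ x) = e at *
    constructor
    · refine le_trans ?_ (mul_le_mul_of_nonneg_right (le_add_of_nonneg_right hn1) hτ.le)
      have e1 : Theta T t ^ 2 = Theta T t ^ 3 * ((t * (T - t)) ^ 3 * (t * (T - t))) := by
        rw [Theta]; field_simp
      rw [abs_mul, abs_mul, abs_of_pos hep]
      calc |k t| * (|β x| * e) ≤ A * Theta T t ^ 2 * (B * e) := by gcongr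
        _ = A * B * (Theta T t ^ 3 * e) * (t * (T - t)) ^ 3 * (t * (T - t)) := by rw [e1]; ring
        _ ≤ A * B * C3 * (T ^ 2) ^ 3 * (t * (T - t)) := by
          have := time_mul_le T t
          gcongr
    · refine le_trans ?_ (le_add_of_nonneg_left hn0)
      rw [abs_mul, abs_mul, abs_of_pos hep]
      have e2 : |k' t + 2 * (s * thetaDeriv T t) * ψ x * k t| ≤
          A * (M + 2 * s * M * P) * Theta T t ^ 4 := by
        calc |k' t + 2 * (s * thetaDeriv T t) * ψ x * k t|
            ≤ |k' t| + |2 * (s * thetaDeriv T t) * ψ x * k t| := abs_add_le _ _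
          _ = |k' t| + 2 * (s * |thetaDeriv T t|) * |ψ x| * |k t| := by
            rw [abs_mul, abs_mul, abs_mul, abs_mul, abs_of_pos hs, abs_two]
          _ ≤ A * Theta T t ^ 2 * (M * Theta T t ^ 2) +
              2 * (s * (M * Theta T t ^ 2)) * P * (A * Theta T t ^ 2) := by
            gcongr
            refine hk2.trans (le_mul_of_one_le_right (by positivity) m1)
          _ = _ := by ring
      calc |k' t + 2 * (s * thetaDeriv T t) * ψ x * k t| * (|β x| * e)
          ≤ A * (M + 2 * s * M * P) * Theta T t ^ 4 * (B * e) := by gcongr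
        _ = A * (M + 2 * s * M * P) * B * (Theta T t ^ 4 * e) := by ring
        _ ≤ A * (M + 2 * s * M * P) * B * C4 := by gcongr
  · intro t ht x hx
    have h1 : HasDerivAt (fun r => Real.exp (2 * (s * Theta T r) * ψ x))
        (Real.exp (2 * (s * Theta T t) * ψ x) * (2 * (s * thetaDeriv T t) * ψ x)) t :=
      ((((hasDerivAt_Theta ht).const_mul s).const_mul 2).mul_const (ψ x)).exp
    refine ((hkd t ht).mul (h1.const_mul (β x))).congr_deriv ?_
    ring

end DegenerateParabolic

/-! ### Vanishing of the integrated time derivative -/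

namespace DegenerateParabolic

variable {a : ℝ → ℝ} {x₀ K T c₁ c₂ : ℝ}

theorem ae_prod_of_forall_mem {α β : Type*} [MeasurableSpace α] [MeasurableSpace β]
    {μ : Measure α} {ν : Measure β} [SFinite ν] {S : Set β} {P : α × β → Prop}
    (h : ∀ᵐ t ∂μ, ∀ x ∈ S, P (t, x)) (hS : ∀ᵐ x ∂ν, x ∈ S) : ∀ᵐ p ∂μ.prod ν, P p := by
  filter_upwards [Measure.quasiMeasurePreserving_fst.ae h,
    Measure.quasiMeasurePreserving_snd.ae hS] with p h1 h2 using h1 p.2 h2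

theorem restrict_QT (T : ℝ) : (volume : Measure (ℝ × ℝ)).restrict (QT T) = (μT T).prod μI := by
  rw [Measure.prod_restrict]; rfl

theorem IsDegenerate.psi_meas (h : IsDegenerate a x₀ K) (c₁ c₂ : ℝ) :
    AEStronglyMeasurable (psi a x₀ c₁ c₂) μI :=
  (((h.hasACDeriv_psi c₁ c₂).continuousOn zero_le_one).mono
    Ioo_subset_Icc_self).aestronglyMeasurable measurableSet_Ioo

/-- Products of square integrable functions remain integrable after multiplication by powers of `Θ`
and the exponential weight. -/
theorem integrable_Theta_pow_mul_exp {s ε B : ℝ} {β ψ : ℝ → ℝ} {f g : ℝ × ℝ → ℝ} (hs : 0 < s)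
    (hε : 0 < ε) (hB : 0 ≤ B) (n : ℕ)
    (hβ : AEStronglyMeasurable β μI) (hψ : AEStronglyMeasurable ψ μI)
    (hβb : ∀ x ∈ Ioo (0 : ℝ) 1, |β x| ≤ B) (hψb : ∀ x ∈ Ioo (0 : ℝ) 1, ψ x ≤ -ε)
    (hf : MemLp f 2 ((μT T).prod μI)) (hg : MemLp g 2 ((μT T).prod μI)) :
    Integrable (fun p => β p.2 * (Theta T p.1 ^ n * Real.exp (2 * (s * Theta T p.1) * ψ p.2)) *
      (f p * g p)) ((μT T).prod μI) := by
  have hβ2 : AEMeasurable (fun p : ℝ × ℝ => β p.2) ((μT T).prod μI) := hβ.comp_snd.aemeasurable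
  have hψ2 : AEMeasurable (fun p : ℝ × ℝ => ψ p.2) ((μT T).prod μI) := hψ.comp_snd.aemeasurable
  have hθ := measurable_Theta T
  have he : AEMeasurable (fun p : ℝ × ℝ => β p.2 *
      (Theta T p.1 ^ n * Real.exp (2 * (s * Theta T p.1) * ψ p.2))) ((μT T).prod μI) := by fun_prop
  obtain ⟨C, hC0, hC⟩ := exists_Theta_pow_mul_exp_le (T := T) hε hs n
  refine ((hf.bounded_mul he.aestronglyMeasurable (B * C) ?_).integrable_mul_two hg).congr
    (Eventually.of_forall fun p => by simp only [mul_assoc])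
  filter_upwards [ae_prod_mem T] with p hp
  have hθp := Theta_pos hp.1
  rw [abs_mul, abs_of_pos (mul_pos (pow_pos hθp n) (Real.exp_pos _))]
  exact mul_le_mul (hβb _ hp.2) (hC _ hp.1 _ (hψb _ hp.2)) (by positivity) hB

/-- The density of the time derivative, in terms of joint representatives `v`, `p = √a v_x`,
`z = v_t` and `ζ = √a v_{tx}`. -/
noncomputable def timeDensity (a : ℝ → ℝ) (x₀ c₁ c₂ T s : ℝ) (v p z ζ : ℝ × ℝ → ℝ) (q : ℝ × ℝ) : ℝ :=
  Real.exp (2 * (s * Theta T q.1) * psi a x₀ c₁ c₂ q.2) *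
    (2 * ((s * thetaDeriv T q.1) * psi a x₀ c₁ c₂ q.2) * (-(1 / 2) * (p q * p q) -
        c₁ * (s * Theta T q.1) * (rootWeight a x₀ q.2 * p q * v q) -
        1 / 2 * ((s * thetaDeriv T q.1) * psi a x₀ c₁ c₂ q.2) * v q ^ 2) -
      p q * ζ q - c₁ * (s * thetaDeriv T q.1) * (rootWeight a x₀ q.2 * p q * v q) -
      c₁ * (s * Theta T q.1) * (rootWeight a x₀ q.2 * ζ q * v q + rootWeight a x₀ q.2 * p q * z q) -
      1 / 2 * (s * thetaDeriv₂ T q.1) * psi a x₀ c₁ c₂ q.2 * v q ^ 2 -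
      (s * thetaDeriv T q.1) * psi a x₀ c₁ c₂ q.2 * v q * z q)

/-- The density splits into three exact time derivatives, of e^{2sφ} times -p²/2, -c₁sΘ·(x -
x₀)/√a·pv and -sΘ'ψv²/2. Using p = √a v_x keeps all factors square integrable and the weights
bounded in x. -/
theorem IsDegenerate.integral_timeDensity (h : IsDegenerate a x₀ K) (hT : 0 < T) {s ε P : ℝ}
    (hs : 0 < s) (hε : 0 < ε) (hP : 0 ≤ P)
    (hψ : ∀ x ∈ Icc (0 : ℝ) 1, -P ≤ psi a x₀ c₁ c₂ x ∧ psi a x₀ c₁ c₂ x ≤ -ε)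
    {v p z ζ : ℝ × ℝ → ℝ} (hv : MemLp v 2 ((μT T).prod μI)) (hp : MemLp p 2 ((μT T).prod μI))
    (hz : MemLp z 2 ((μT T).prod μI)) (hζ : MemLp ζ 2 ((μT T).prod μI))
    (hvz : IsTimePrimitive T v z) (hpζ : IsTimePrimitive T p ζ) :
    Integrable (timeDensity a x₀ c₁ c₂ T s v p z ζ) ((μT T).prod μI) ∧
      ∫ q, timeDensity a x₀ c₁ c₂ T s v p z ζ q ∂(μT T).prod μI = 0 := by
  obtain ⟨M, hM0, hM⟩ := exists_theta_bounds hT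
  obtain ⟨R, hR0, hR⟩ := h.exists_rootWeight_bound
  have hψ' : ∀ x ∈ Ioo (0 : ℝ) 1, -P ≤ psi a x₀ c₁ c₂ x ∧ psi a x₀ c₁ c₂ x ≤ -ε :=
    fun x hx => hψ x (Ioo_subset_Icc_self hx)
  have hψm := h.psi_meas c₁ c₂
  have w1 := isTimeWeight_exp (k := fun _ => 1) (k' := fun _ => 0) (β := fun _ => -(1 / 2))
    (B := 1 / 2) hT hs hε hP hM0.le (by norm_num) measurable_const measurable_const
    (fun t _ => hasDerivAt_const t 1) (fun t ht => by
      obtain ⟨h1, -⟩ := hM t ht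
      exact ⟨by simpa using h1, by simp; positivity⟩)
    aestronglyMeasurable_const hψm (fun x _ => by norm_num) hψ'
  have w2 := isTimeWeight_exp (k := Theta T) (k' := thetaDeriv T)
    (β := fun x => -(c₁ * s) * rootWeight a x₀ x) (B := |c₁ * s| * R) hT hs hε hP hM0.le
    (by positivity) (measurable_Theta T) (measurable_thetaDeriv T)
    (fun t ht => hasDerivAt_Theta ht) (fun t ht => by
      obtain ⟨-, h2, h3, -⟩ := hM t ht
      exact ⟨by rwa [abs_of_pos (Theta_pos ht)], h3⟩)
    (h.rootWeight_meas.const_mul _) hψm (fun x hx => by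
      rw [abs_mul, abs_neg]
      gcongr
      exact (hR x (Ioo_subset_Icc_self hx)).1) hψ'
  have w3 := isTimeWeight_exp (k := thetaDeriv T) (k' := thetaDeriv₂ T)
    (β := fun x => -(1 / 2 * s) * psi a x₀ c₁ c₂ x) (B := 1 / 2 * s * P) hT hs hε hP hM0.le
    (by positivity) (measurable_thetaDeriv T) (measurable_thetaDeriv₂ T)
    (fun t ht => hasDerivAt_thetaDeriv ht) (fun t ht => by
      obtain ⟨-, -, h3, h4⟩ := hM t ht
      exact ⟨h3, h4⟩)
    (hψm.const_mul _) hψm (fun x hx => by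
      rw [abs_mul, abs_neg, abs_of_pos (by positivity : 0 < 1 / 2 * s)]
      gcongr
      exact abs_le.2 ⟨(hψ' x hx).1, by linarith [(hψ' x hx).2]⟩) hψ'
  obtain ⟨i1, e1⟩ := w1.integral_eq_zero hT hp hζ hp hζ hpζ hpζ
  obtain ⟨i2, e2⟩ := w2.integral_eq_zero hT hp hζ hv hz hpζ hvz
  obtain ⟨i3, e3⟩ := w3.integral_eq_zero hT hv hz hv hz hvz hvz
  have i := (i1.add i2).add i3
  have e := integral_add' (i1.add i2) i3
  rw [integral_add' i1 i2, e1, e2, e3] at e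
  refine ⟨i.congr (Eventually.of_forall fun q => ?_),
    ((integral_congr_ae (Eventually.of_forall fun q => ?_)).trans e).trans (by norm_num)⟩
  · simp only [timeDensity, Pi.add_apply]
    ring
  · simp only [timeDensity, Pi.add_apply]
    ring

end DegenerateParabolic

/-! ### Joint representatives of a solution -/

namespace DegenerateParabolic

variable {a : ℝ → ℝ} {x₀ K T c₁ c₂ : ℝ}

/-- Jointly measurable representatives of `v`, `√a v_x`, `(a v_x)_x`, `v_t` and `√a v_{tx}` for a
solution `v`. -/
structure IsJointRep (a : ℝ → ℝ) (x₀ K T : ℝ) (h v : ℝ → ℝ → ℝ) (f p q z ζ : ℝ × ℝ → ℝ) : Prop where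
  memLp_f : MemLp f 2 ((μT T).prod μI)
  memLp_p : MemLp p 2 ((μT T).prod μI)
  memLp_q : MemLp q 2 ((μT T).prod μI)
  memLp_z : MemLp z 2 ((μT T).prod μI)
  memLp_ζ : MemLp ζ 2 ((μT T).prod μI)
  prim_f : IsTimePrimitive T f z
  prim_p : IsTimePrimitive T p ζ
  slice : ∀ᵐ t ∂μT T, ∃ w g : ℝ → ℝ, MemH1a a x₀ K (v t) ∧ MemH1a a x₀ K w ∧ MemW1 2 g ∧
    g =ᵐ[μI] flux a (v t) ∧
    (∀ x ∈ Ioo (0 : ℝ) 1 \ {x₀}, f (t, x) = v t x ∧ p (t, x) = √(a x) * dx (v t) x) ∧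
    (∀ᵐ x ∂μI, q (t, x) = dx g x) ∧ (∀ᵐ x ∂μI, z (t, x) = w x) ∧
    (∀ᵐ x ∂μI, ζ (t, x) = √(a x) * dx w x) ∧ ∀ᵐ x ∂μI, w x + dx g x = h t x

theorem IsSolution.exists_isJointRep {h v : ℝ → ℝ → ℝ} (hv : IsSolution a x₀ K T h v)
    (ha : IsDegenerate a x₀ K) (hT : 0 < T) :
    ∃ f p q z ζ : ℝ × ℝ → ℝ, IsJointRep a x₀ K T h v f p q z ζ := by
  obtain ⟨U, hU, hUv⟩ := hv.memL2H2
  obtain ⟨w, ⟨V, W, hV, hVv, hW, hWw, hweak⟩, heq⟩ := hv.equation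
  set F : WithLp 2 (L2I × L2I) →L[ℝ] L2I := WithLp.fstL 2 ℝ L2I L2I
  set S : WithLp 2 (L2I × L2I) →L[ℝ] L2I := WithLp.sndL 2 ℝ L2I L2I
  set J := (H1a a x₀ K).subtypeL
  have hVJ : MemLp (fun t => (V t : WithLp 2 (L2I × L2I))) 2 (μT T) := J.comp_memLp' hV
  have hWJ : MemLp (fun t => (W t : WithLp 2 (L2I × L2I))) 2 (μT T) := J.comp_memLp' hW
  have hV1 : MemLp (fun t => (V t : WithLp 2 (L2I × L2I)).fst) 2 (μT T) := F.comp_memLp' hVJ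
  have hV2 : MemLp (fun t => (V t : WithLp 2 (L2I × L2I)).snd) 2 (μT T) := S.comp_memLp' hVJ
  have hW1 : MemLp (fun t => (W t : WithLp 2 (L2I × L2I)).fst) 2 (μT T) := F.comp_memLp' hWJ
  have hW2 : MemLp (fun t => (W t : WithLp 2 (L2I × L2I)).snd) 2 (μT T) := S.comp_memLp' hWJ
  have hU2 : MemLp (fun t => (U t : WithLp 2 (H1a a x₀ K × L2I)).snd) 2 (μT T) := by
    refine hU.of_le (Continuous.comp_aestronglyMeasurable
      (g := fun P : H2a a x₀ K => (P : WithLp 2 (H1a a x₀ K × L2I)).snd)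
      ((WithLp.continuous_snd 2 _ _).comp continuous_subtype_val) hU.1) ?_
    exact Eventually.of_forall fun t => WithLp.norm_snd_le _ (U t : WithLp 2 (H1a a x₀ K × L2I))
  obtain ⟨f, hfm, hf2, hf⟩ := exists_joint_representative hV1
  obtain ⟨p, hpm, hp2, hp⟩ := exists_joint_representative hV2
  obtain ⟨q, hqm, hq2, hq⟩ := exists_joint_representative hU2
  obtain ⟨z, hzm, hz2, hz⟩ := exists_joint_representative hW1
  obtain ⟨ζ, hζm, hζ2, hζ⟩ := exists_joint_representative hW2
  -- Continuous linear maps commute with the weak derivative. The two coordinate projections show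
  -- that v has weak derivative v_t and that √a v_x has weak derivative √a v_{tx}, with no second
  -- space derivative of v_t involved.
  have hproj : ∀ L : WithLp 2 (L2I × L2I) →L[ℝ] L2I, ∀ η : ℝ → ℝ, ContDiff ℝ ∞ η →
      HasCompactSupport η → tsupport η ⊆ Ioo 0 T →
      ∫ t in Ioo 0 T, deriv η t • L (V t) = -∫ t in Ioo 0 T, η t • L (W t) := by
    intro L η hη hηc hηT
    have h1 := congrArg L (hweak η hη hηc hηT)
    rw [map_neg, ← L.integral_comp_comm (integrable_smul_of_continuous
        (hVJ.integrable (by norm_num)) (hη.continuous_deriv (by norm_num)) hηc.deriv),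
      ← L.integral_comp_comm (integrable_smul_of_continuous
        (hWJ.integrable (by norm_num)) hη.continuous hηc)] at h1
    simpa only [map_smul] using h1
  refine ⟨f, p, q, z, ζ, hf2, hp2, hq2, hz2, hζ2, ?_, ?_, ?_⟩
  · exact isTimePrimitive_of_weak hT hfm hzm hz2 (hV1.integrable (by norm_num))
      (hW1.integrable (by norm_num)) (hf.mono fun t ht => ht.1) (hz.mono fun t ht => ht.1) (hproj F)
  · exact isTimePrimitive_of_weak hT hpm hζm hζ2 (hV2.integrable (by norm_num))
      (hW2.integrable (by norm_num)) (hp.mono fun t ht => ht.1) (hζ.mono fun t ht => ht.1) (hproj S)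
  · filter_upwards [hf, hp, hq, hz, hζ, hUv, hVv, hWw, heq] with
      t ⟨_, hft⟩ ⟨_, hpt⟩ ⟨hqt, _⟩ ⟨hzt, _⟩ ⟨hζt, _⟩ ⟨hU1, g, hg, hgv, hUg⟩ hVt hWt het
    refine ⟨w t, g, hVt.mem, hWt.mem, hg, hgv, fun x hx => ⟨?_, ?_⟩, ?_, ?_, ?_, ?_⟩
    · exact hft _ hVt.fst x hx.1 ((hVt.mem.isAdmissible ha).punctured.continuousAt hx.1 hx.2)
    · exact hpt _ hVt.snd x hx.1 (hVt.mem.continuousAt_sqrt_mul_dx ha hg hgv hx.1 hx.2)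
    · exact hqt.symm.trans hUg
    · exact hzt.symm.trans hWt.fst
    · exact hζt.symm.trans hWt.snd
    · filter_upwards [het, hVt.mem.dx_flux_ae ha hg hgv] with x hx1 hx2
      rw [← hx1, hx2]

theorem ae_muI_mem_diff (x₀ : ℝ) : ∀ᵐ x ∂μI, x ∈ Ioo (0 : ℝ) 1 \ {x₀} := by
  filter_upwards [ae_muI_mem, ae_muI_ne x₀] with x h1 h2 using ⟨h1, h2⟩

/-- The integral over `(0,1)` of a square integrable function is square integrable in time. -/
theorem memLp_integral_section {Q : ℝ × ℝ → ℝ} (hQ : MemLp Q 2 ((μT T).prod μI)) :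
    MemLp (fun t => ∫ x, Q (t, x) ∂μI) 2 (μT T) := by
  have hm : AEStronglyMeasurable (fun t => ∫ x, Q (t, x) ∂μI) (μT T) := hQ.1.integral_prod_right'
  rw [memLp_two_iff_integrable_sq hm]
  have hi := hQ.integrable_sq
  refine hi.integral_prod_left.mono' (hm.pow 2) ?_
  filter_upwards [hi.prod_right_ae, (memLp_two_integrable hQ).prod_right_ae] with t h1 h2
  rw [Real.norm_of_nonneg (sq_nonneg _)]
  have h3 := sq_intervalIntegral_le (Integrable.intervalIntegrable_muI h2 (c := 0) (d := 1) (by simp) (by simp))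
    (Integrable.intervalIntegrable_muI h1 (c := 0) (d := 1) (by simp) (by simp))
  rw [← integral_muI_eq_interval, ← integral_muI_eq_interval] at h3
  linarith

end DegenerateParabolic

/-! ### Integrability of the densities and the inequality on time slices -/

namespace DegenerateParabolic

variable {a : ℝ → ℝ} {x₀ K T c₁ c₂ : ℝ}

theorem exp_phi_eq (a : ℝ → ℝ) (x₀ c₁ c₂ T s t x : ℝ) :
    Real.exp (2 * s * phi a x₀ c₁ c₂ T t x) =
      Real.exp (2 * (s * Theta T t) * psi a x₀ c₁ c₂ x) := by
  rw [phi]; congr 1; ring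

theorem energyDensity_eq (a : ℝ → ℝ) (x₀ c₁ c₂ T s : ℝ) (v : ℝ → ℝ → ℝ) (t x : ℝ) :
    energyDensity a x₀ c₁ c₂ T s v t x =
      (s * Theta T t * (a x * dx (v t) x * dx (v t) x) +
        s ^ 3 * Theta T t ^ 3 * (quadWeight a x₀ x * v t x ^ 2)) *
      Real.exp (2 * (s * Theta T t) * psi a x₀ c₁ c₂ x) := by
  rw [energyDensity, exp_phi_eq, quadWeight]; ring

theorem sourceDensity_eq (a : ℝ → ℝ) (x₀ c₁ c₂ T s : ℝ) (h : ℝ → ℝ → ℝ) (t x : ℝ) :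
    sourceDensity a x₀ c₁ c₂ T s h t x =
      Real.exp (2 * (s * Theta T t) * psi a x₀ c₁ c₂ x) * h t x ^ 2 := by
  rw [sourceDensity, exp_phi_eq, mul_comm]

theorem MemH1a.boundaryDensity_eq {v : ℝ → ℝ → ℝ} {g : ℝ → ℝ} {t : ℝ}
    (hv : MemH1a a x₀ K (v t)) (ha : IsDegenerate a x₀ K) (hg : MemW1 2 g)
    (hgv : g =ᵐ[μI] flux a (v t)) (c₁ c₂ T s : ℝ) {x : ℝ} (hx : x ∈ Icc (0 : ℝ) 1) (hne : x ≠ x₀) :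
    boundaryDensity a x₀ c₁ c₂ T s v t x =
      Theta T t * (linWeight a x₀ x * Real.exp (2 * (s * Theta T t) * psi a x₀ c₁ c₂ x) *
        g x ^ 2) := by
  have := (ha.pos x hx hne).ne'
  rw [boundaryDensity, exp_phi_eq, hv.dx_eq_div ha hg hgv hx hne, linWeight]
  field_simp

namespace IsJointRep

variable {h v : ℝ → ℝ → ℝ} {f p q z ζ : ℝ × ℝ → ℝ}

theorem integrable_energyDensity (hr : IsJointRep a x₀ K T h v f p q z ζ)
    (ha : IsDegenerate a x₀ K) {s ε : ℝ} (hs : 0 < s) (hε : 0 < ε)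
    (hψ : ∀ x ∈ Icc (0 : ℝ) 1, psi a x₀ c₁ c₂ x ≤ -ε) :
    Integrable (fun y : ℝ × ℝ => energyDensity a x₀ c₁ c₂ T s v y.1 y.2) ((μT T).prod μI) := by
  obtain ⟨R, hR0, hR⟩ := ha.exists_rootWeight_bound
  have hψ' : ∀ x ∈ Ioo (0 : ℝ) 1, psi a x₀ c₁ c₂ x ≤ -ε := fun x hx => hψ x (Ioo_subset_Icc_self hx)
  have i1 := integrable_Theta_pow_mul_exp (T := T) (β := fun _ => s) hs hε hs.le 1
    aestronglyMeasurable_const (ha.psi_meas c₁ c₂) (fun x _ => (abs_of_pos hs).le) hψ'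
    hr.memLp_p hr.memLp_p
  have i2 := integrable_Theta_pow_mul_exp (T := T) (β := fun x => s ^ 3 * quadWeight a x₀ x)
    (B := s ^ 3 * R) hs hε (by positivity) 3 (ha.quadWeight_meas.const_mul _) (ha.psi_meas c₁ c₂)
    (fun x hx => by
      rw [abs_mul, abs_of_pos (pow_pos hs 3)]
      gcongr
      exact (hR x (Ioo_subset_Icc_self hx)).2) hψ' hr.memLp_f hr.memLp_f
  refine (i1.add i2).congr (ae_prod_of_forall_mem ?_ (ae_muI_mem_diff x₀))
  filter_upwards [hr.slice] with t ⟨w, g, _, _, _, _, hfp, _⟩ x hx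
  obtain ⟨h1, h2⟩ := hfp x hx
  simp only [Pi.add_apply, energyDensity_eq, h1, h2]
  have hsq := Real.mul_self_sqrt (ha.nonneg (Ioo_subset_Icc_self hx.1))
  linear_combination s * Theta T t * Real.exp (2 * (s * Theta T t) * psi a x₀ c₁ c₂ x) *
    dx (v t) x ^ 2 * hsq

/-- The traces of the flux at the end points are square integrable in time. -/
theorem exists_trace (hr : IsJointRep a x₀ K T h v f p q z ζ) (ha : IsDegenerate a x₀ K) :
    ∃ G₀ G₁ : ℝ → ℝ, MemLp G₀ 2 (μT T) ∧ MemLp G₁ 2 (μT T) ∧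
      ∀ᵐ t ∂μT T, ∀ g, MemW1 2 g → g =ᵐ[μI] flux a (v t) → g 0 = G₀ t ∧ g 1 = G₁ t := by
  obtain ⟨A, hA⟩ := isCompact_Icc.exists_bound_of_continuousOn ha.continuousOn.sqrt
  have hap : MemLp (fun y : ℝ × ℝ => √(a y.2) * p y) 2 ((μT T).prod μI) := by
    refine hr.memLp_p.bounded_mul (φ := fun y => √(a y.2))
      (ha.aemeasurable.sqrt.aestronglyMeasurable.comp_snd) A ?_
    filter_upwards [ae_prod_mem T] with y hy using hA _ (Ioo_subset_Icc_self hy.2)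
  have hq1 : MemLp (fun y : ℝ × ℝ => y.2 * q y) 2 ((μT T).prod μI) := by
    refine hr.memLp_q.bounded_mul (by fun_prop) 1 ?_
    filter_upwards [ae_prod_mem T] with y hy
    exact abs_le.2 ⟨by linarith [hy.2.1], hy.2.2.le⟩
  have hq0 : MemLp (fun y : ℝ × ℝ => (1 - y.2) * q y) 2 ((μT T).prod μI) := by
    refine hr.memLp_q.bounded_mul (φ := fun y => 1 - y.2) (by fun_prop) 1 ?_
    filter_upwards [ae_prod_mem T] with y hy
    exact abs_le.2 ⟨by linarith [hy.2.2], by linarith [hy.2.1]⟩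
  refine ⟨_, _, memLp_integral_section (hap.sub hq0), memLp_integral_section (hap.add hq1), ?_⟩
  filter_upwards [hr.slice] with t ⟨w, g', hv, _, hg', hgv', hfp, hqt, _⟩ g hg hgv
  have h0 : ∀ᵐ x ∂μI, g x = √(a x) * p (t, x) := by
    filter_upwards [ae_muI_mem_diff x₀, hgv] with x hx hgx
    rw [(hfp x hx).2, hgx, flux]
    linear_combination -dx (v t) x * Real.mul_self_sqrt (ha.nonneg (Ioo_subset_Icc_self hx.1))
  have h1 : ∀ᵐ x ∂μI, dx g x = q (t, x) := by
    filter_upwards [hv.dx_flux_ae ha hg hgv, hv.dx_flux_ae ha hg' hgv', hqt] with x h1 h2 h3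
    rw [h3, ← h1, h2]
  constructor
  · rw [hg.left_eq]
    refine integral_congr_ae ?_
    filter_upwards [h0, h1] with x e0 e1
    simp only [Pi.sub_apply, e0, e1]
  · rw [hg.right_eq]
    refine integral_congr_ae ?_
    filter_upwards [h0, h1] with x e0 e1
    simp only [Pi.add_apply, e0, e1]

theorem integrable_boundaryDensity (hr : IsJointRep a x₀ K T h v f p q z ζ)
    (ha : IsDegenerate a x₀ K) {s ε : ℝ} (hs : 0 < s) (hε : 0 < ε)
    (hψ : ∀ x ∈ Icc (0 : ℝ) 1, psi a x₀ c₁ c₂ x ≤ -ε) :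
    Integrable (fun t => boundaryDensity a x₀ c₁ c₂ T s v t 1 -
      boundaryDensity a x₀ c₁ c₂ T s v t 0) (μT T) := by
  obtain ⟨G₀, G₁, hG₀, hG₁, hG⟩ := hr.exists_trace ha
  obtain ⟨C, hC0, hC⟩ := exists_Theta_pow_mul_exp_le (T := T) hε hs 1
  have key : ∀ y ∈ Icc (0 : ℝ) 1, ∀ G : ℝ → ℝ, MemLp G 2 (μT T) →
      Integrable (fun t => Theta T t * (linWeight a x₀ y *
        Real.exp (2 * (s * Theta T t) * psi a x₀ c₁ c₂ y) * G t ^ 2)) (μT T) := by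
    intro y hy G hG
    have hθ := measurable_Theta T
    have h1 : MemLp (fun t => (Theta T t ^ 1 * Real.exp (2 * (s * Theta T t) * psi a x₀ c₁ c₂ y)) *
        G t) 2 (μT T) := by
      refine hG.bounded_mul (by fun_prop) C ?_
      filter_upwards [ae_restrict_mem measurableSet_Ioo] with t ht
      have hθp := Theta_pos ht
      rw [abs_of_pos (by positivity)]
      exact hC t ht _ (hψ y hy)
    refine ((h1.integrable_mul_two hG).const_mul (linWeight a x₀ y)).congr
      (Eventually.of_forall fun t => ?_)
    ring
  refine ((key 1 (by simp) G₁ hG₁).sub (key 0 (by simp) G₀ hG₀)).congr ?_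
  filter_upwards [hr.slice, hG] with t ⟨w, g, hv, _, hg, hgv, _⟩ hGt
  obtain ⟨e0, e1⟩ := hGt g hg hgv
  rw [hv.boundaryDensity_eq ha hg hgv c₁ c₂ T s (by simp) ha.x₀_mem.2.ne',
    hv.boundaryDensity_eq ha hg hgv c₁ c₂ T s (by simp) ha.x₀_mem.1.ne, Pi.sub_apply, e0, e1]

theorem integrable_sourceDensity {h : ℝ → ℝ → ℝ} (ha : IsDegenerate a x₀ K)
    (hh : MemLp (fun y : ℝ × ℝ => h y.1 y.2) 2 ((μT T).prod μI)) {s ε : ℝ} (hs : 0 < s) (hε : 0 < ε)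
    (hψ : ∀ x ∈ Icc (0 : ℝ) 1, psi a x₀ c₁ c₂ x ≤ -ε) :
    Integrable (fun y : ℝ × ℝ => sourceDensity a x₀ c₁ c₂ T s h y.1 y.2) ((μT T).prod μI) := by
  refine (integrable_Theta_pow_mul_exp (T := T) (β := fun _ => 1) hs hε zero_le_one 0
    aestronglyMeasurable_const (ha.psi_meas c₁ c₂) (fun x _ => by simp)
    (fun x hx => hψ x (Ioo_subset_Icc_self hx)) hh hh).congr (Eventually.of_forall fun y => ?_)
  simp only [sourceDensity_eq]
  ring

/-- The Carleman inequality on almost every time slice. -/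
theorem carleman_slice (hr : IsJointRep a x₀ K T h v f p q z ζ)
    (ha : IsDegenerate a x₀ K) (hc₁ : 0 < c₁) {P M s : ℝ} (hP : 0 < P)
    (hψ : ∀ x ∈ Icc (0 : ℝ) 1, |psi a x₀ c₁ c₂ x| ≤ P) (hM : 0 < M)
    (hθ : ∀ t ∈ Ioo 0 T, |thetaDeriv T t| ≤ M * Theta T t ^ 2 ∧
      |thetaDeriv₂ T t| ≤ M * Theta T t ^ 2)
    (hs0 : 0 < s) (hs : 8 * M / (c₁ * (2 - K)) + 2 * M * P / (c₁ ^ 2 * (2 - K)) ≤ s) :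
    ∀ᵐ t ∂μT T, min (c₁ * (2 - K) / 4) (c₁ ^ 3 * (2 - K) / 2 / (2 * c₁ ^ 2 + 1)) *
      (∫ x, energyDensity a x₀ c₁ c₂ T s v t x ∂μI) ≤
      1 / 2 * (∫ x, sourceDensity a x₀ c₁ c₂ T s h t x ∂μI) -
      (∫ x, timeDensity a x₀ c₁ c₂ T s f p z ζ (t, x) ∂μI) +
      s * c₁ * (boundaryDensity a x₀ c₁ c₂ T s v t 1 - boundaryDensity a x₀ c₁ c₂ T s v t 0) := by
  filter_upwards [hr.slice, ae_restrict_mem measurableSet_Ioo] with t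
    ⟨w, g, hv, hw, hg, hgv, hfp, hqt, hzt, hζt, het⟩ ht
  obtain ⟨h1, h2⟩ := hθ t ht
  have hb : ∀ r, |r| ≤ M * Theta T t ^ 2 → |s * r| ≤ s * M * Theta T t ^ 2 := fun r hr => by
    rw [abs_mul, abs_of_pos hs0, mul_assoc]
    gcongr
  have key := (hv.isAdmissible ha).carleman_fixed_time ha
    (hasACDeriv_dx hg.1 le_rfl zero_le_one le_rfl) hg.2 hgv (hw.isAdmissible ha) hc₁ hψ
    (Theta_pos ht) hM hP (hb _ h1) (hb _ h2) hs
  have e1 : ∫ x, sourceDensity a x₀ c₁ c₂ T s h t x ∂μI =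
      ∫ x, Real.exp (2 * (s * Theta T t) * psi a x₀ c₁ c₂ x) * (w x + dx g x) ^ 2 ∂μI := by
    refine integral_congr_ae ?_
    filter_upwards [het] with x hx
    rw [sourceDensity_eq, hx]
  -- The quadratic expressions in the representatives become those of the slice through √a·√a = a
  -- and √a·(x - x₀)/√a = x - x₀, valid off x₀.
  have e2 : ∫ x, timeDensity a x₀ c₁ c₂ T s f p z ζ (t, x) ∂μI =
      ∫ x, derivDensity a x₀ c₁ c₂ (s * Theta T t) (s * thetaDeriv T t) (s * thetaDeriv₂ T t)
        (v t) (dx (v t)) w (dx w) x ∂μI := by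
    refine integral_congr_ae ?_
    filter_upwards [ae_muI_mem_diff x₀, hzt, hζt] with x hx hzx hζx
    obtain ⟨k1, k2⟩ := hfp x hx
    have r1 := Real.mul_self_sqrt (ha.nonneg (Ioo_subset_Icc_self hx.1))
    have r2 := ha.sqrt_mul_rootWeight hx.1 hx.2
    have m1 : p (t, x) * p (t, x) = a x * dx (v t) x * dx (v t) x := by
      rw [k2]; linear_combination dx (v t) x ^ 2 * r1
    have m2 : rootWeight a x₀ x * p (t, x) = (x - x₀) * dx (v t) x := by
      rw [k2]; linear_combination dx (v t) x * r2
    have m3 : rootWeight a x₀ x * ζ (t, x) = (x - x₀) * dx w x := by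
      rw [hζx]; linear_combination dx w x * r2
    have m4 : p (t, x) * ζ (t, x) = a x * dx (v t) x * dx w x := by
      rw [k2, hζx]; linear_combination dx (v t) x * dx w x * r1
    simp only [timeDensity, derivDensity, m1, m2, m3, m4, k1, hzx]
  rw [e1, e2, hv.boundaryDensity_eq ha hg hgv c₁ c₂ T s (by simp) ha.x₀_mem.2.ne',
    hv.boundaryDensity_eq ha hg hgv c₁ c₂ T s (by simp) ha.x₀_mem.1.ne]
  simp_rw [energyDensity_eq]
  rw [← mul_sub]
  exact key

end IsJointRep

end DegenerateParabolic

/-! ### Integration over time -/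

open DegenerateParabolic

theorem theorem4p1 (a : ℝ → ℝ) (x₀ K T c₁ c₂ : ℝ) (hT : 0 < T)
    (ha : CoefficientHypothesis a x₀ K) (hc₁ : 0 < c₁)
    (hc₂ : max ((1 - x₀) ^ 2 / (a 1 * (2 - K))) (x₀ ^ 2 / (a 0 * (2 - K))) < c₂) :
    ∃ C s₀ : ℝ, 0 < C ∧ 0 < s₀ ∧
      ∀ h v : ℝ → ℝ → ℝ, IsSolution a x₀ K T h v → ∀ s ≥ s₀,
        IntegrableOn (fun p : ℝ × ℝ => energyDensity a x₀ c₁ c₂ T s v p.1 p.2) (QT T) ∧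
        IntegrableOn (fun p : ℝ × ℝ => sourceDensity a x₀ c₁ c₂ T s h p.1 p.2) (QT T) ∧
        IntegrableOn (fun t => boundaryDensity a x₀ c₁ c₂ T s v t 1 -
          boundaryDensity a x₀ c₁ c₂ T s v t 0) (Ioo 0 T) ∧
        (∫ p in QT T, energyDensity a x₀ c₁ c₂ T s v p.1 p.2) ≤
          C * ((∫ p in QT T, sourceDensity a x₀ c₁ c₂ T s h p.1 p.2) +
            s * c₁ * ∫ t in Ioo 0 T, (boundaryDensity a x₀ c₁ c₂ T s v t 1 -
              boundaryDensity a x₀ c₁ c₂ T s v t 0)) := by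
  have hd := ha.isDegenerate
  obtain ⟨hc₂0, ε, hε, hψ⟩ := hd.exists_psi_bounds hc₁ hc₂
  obtain ⟨M, hM, hθ⟩ := exists_theta_bounds hT
  have hk : 0 < 2 - K := by linarith [hd.lt_two]
  have hP : 0 < c₁ * c₂ := mul_pos hc₁ hc₂0
  set δ := min (c₁ * (2 - K) / 4) (c₁ ^ 3 * (2 - K) / 2 / (2 * c₁ ^ 2 + 1)) with hδ
  have hδ0 : 0 < δ := lt_min (by positivity) (by positivity)
  -- The threshold is that of `absorb_lower_order` with k = 2 - K and P = c₁c₂, the bound for |ψ|; δ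
  -- is the constant lost in passing from w back to v. Neither depends on h, v or s.
  refine ⟨1 / δ, 8 * M / (c₁ * (2 - K)) + 2 * M * (c₁ * c₂) / (c₁ ^ 2 * (2 - K)),
    by positivity, by positivity, fun h v hv s hs => ?_⟩
  have hs0 : 0 < s := lt_of_lt_of_le (by positivity) hs
  obtain ⟨f, p, q, z, ζ, hr⟩ := hv.exists_isJointRep hd hT
  have hh := hv.source
  rw [restrict_QT] at hh
  have iE := hr.integrable_energyDensity hd hs0 hε fun x hx => (hψ x hx).2
  have iS := IsJointRep.integrable_sourceDensity hd hh hs0 hε fun x hx => (hψ x hx).2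
  have iB := hr.integrable_boundaryDensity hd hs0 hε fun x hx => (hψ x hx).2
  obtain ⟨iD, eD⟩ := hd.integral_timeDensity hT hs0 hε hP.le hψ hr.memLp_f hr.memLp_p hr.memLp_z
    hr.memLp_ζ hr.prim_f hr.prim_p
  have hslice := hr.carleman_slice hd hc₁ hP
    (fun x hx => abs_le.2 ⟨(hψ x hx).1, by linarith [(hψ x hx).2]⟩) hM
    (fun t ht => (hθ t ht).2.2) hs0 hs
  simp only [IntegrableOn, restrict_QT]
  refine ⟨iE, iS, iB, ?_⟩
  have i1 := iS.integral_prod_left.const_mul (1 / 2)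
  have i2 := iB.const_mul (s * c₁)
  have hint := integral_mono_ae (iE.integral_prod_left.const_mul δ)
    ((i1.sub iD.integral_prod_left).add i2) hslice
  rw [integral_add' (i1.sub iD.integral_prod_left) i2, integral_sub' i1 iD.integral_prod_left,
    integral_const_mul, integral_const_mul, integral_const_mul, ← integral_prod _ iE,
    ← integral_prod _ iS, ← integral_prod _ iD, eD] at hint
  -- Nonnegativity allows the factor 1/2 of the source term to be raised to 1, so that one constant
  -- serves for both terms on the right.
  have hS0 : 0 ≤ ∫ y, sourceDensity a x₀ c₁ c₂ T s h y.1 y.2 ∂(μT T).prod μI :=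
    integral_nonneg fun y => mul_nonneg (sq_nonneg _) (Real.exp_pos _).le
  rw [one_div, inv_mul_eq_div, le_div_iff₀ hδ0]
  linarith
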